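/- Let $\mathbb D$ be the open unit disc, $\mathbb T$ the unit circle, $\partial_z=\frac12(\partial_x-i\partial_y)$, $\partial_{\bar z}=\frac12(\partial_x+i\partial_y)$. Let $\alpha,\beta\in\mathbb R\setminus\{-1,-2,-3,\dots\}$ with $\alpha+\beta>-1$, and let $1\le p\le\infty$. A function $u:\mathbb D\to\mathbb C$ is $(\alpha,\beta)$-harmonic if it is of class $C^2$ (in the real sense) on $\mathbb D$ and $$(1-|z|^2)\big((1-|z|^2)\partial_z\partial_{\bar z}u+\alpha z\,\partial_z u+\beta\bar z\,\partial_{\bar z}u-\alpha\beta u\big)=0\quad\text{on }\mathbb D .$$ For $f\in L^1(\mathbb T)$ put $$P_{\alpha,\beta}[f](z)=\frac1{2\pi}\int_0^{2\pi}P_{\alpha,\beta}(ze^{-i\theta})f(e^{i\theta})\,d\theta,\qquad P_{\alpha,\beta}(z)=c_{\alpha,\beta}\frac{(1-|z|^2)^{\alpha+\beta+1}}{(1-z)^{\alpha+1}(1-\bar z)^{\beta+1}},\qquad c_{\alpha,\beta}=\frac{\Gamma(\alpha+1)\Gamma(\beta+1)}{\Gamma(\alpha+\beta+1)},$$ with principal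 branches of the powers. For $\lambda>-1$ and $0\le r<1$ let $I_\lambda(r)=\frac1{2\pi}\int_0^{2\pi}\frac{(1-r^2)^\lambda}{|1-re^{-i\theta}|^{\lambda+1}}\,d\theta$, and for $\lambda>0$ let $c_\lambda=\Gamma(\lambda)/\Gamma(\frac\lambda2+\frac12)^2$. Write $\dot f(e^{i\theta})=\frac{d}{d\theta}f(e^{i\theta})$; $\|\cdot\|_{L^p}$ is the norm of $L^p(\mathbb T)$ for the measure $d\theta/2\pi$; $M_p(r,u)$ is the $L^p(d\theta/2\pi)$-norm of $\theta\mapsto u(re^{i\theta})$ (the essential supremum if $p=\infty$). $L^p(\mathbb D)$ is taken with respect to area measure. $H^p_G(\mathbb D)$ is the space of measurable $u:\mathbb D\to\mathbb C$, measurable on each circle $|z|=r$ with $0<r<1$, such that $\|u\|_p<\infty$, where $\|u\|_p=\sup_{0<r<1}M_p(r,u)$ if $p<\infty$ and $\|u\|_\infty=\sup_{\mathbb D}|u|$. **Theorem.** Let $f:\mathbb T\to\mathbb C$ be absolutely continuous with $\dot f\in L^p(\mathbb T)$, and let $u=P_{\alpha,\beta}[f]$. Then $u$ is $(\alpha,\beta)$-harmonic,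 and for all $0\le r<1$ $$M_p(r,z\partial_z u)\le|c_{\alpha,\beta}|\,I_{\alpha+\beta}(r)\big(\|\dot f\|_{L^p}+|\beta|\,\|f\|_{L^p}\big),\qquad M_p(r,\bar z\partial_{\bar z} u)\le|c_{\alpha,\beta}|\,I_{\alpha+\beta}(r)\big(\|\dot f\|_{L^p}+|\alpha|\,\|f\|_{L^p}\big).$$ (i) If $\alpha+\beta>0$, then $\partial_z u,\partial_{\bar z}u\in H^p_G(\mathbb D)$, and $$\|z\partial_z u\|_p\le|c_{\alpha,\beta}|\,c_{\alpha+\beta}\big(\|\dot f\|_{L^p}+|\beta|\,\|f\|_{L^p}\big),\qquad \|\bar z\partial_{\bar z} u\|_p\le|c_{\alpha,\beta}|\,c_{\alpha+\beta}\big(\|\dot f\|_{L^p}+|\alpha|\,\|f\|_{L^p}\big).$$ (ii) If $\alpha+\beta<0$ and $p<-\frac1{\alpha+\beta}$, then $\partial_z u,\partial_{\bar z}u\in L^p(\mathbb D)$. (iii) If $\alpha+\beta<0$ and $p\ge-\frac1{\alpha+\beta}$, then there is an absolutely continuous $f:\mathbb T\to\mathbb C$ with $\dot f\in L^p(\mathbb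 T)$ such that $u=P_{\alpha,\beta}[f]$ is $(\alpha,\beta)$-harmonic, neither $\partial_z u$ nor $\partial_{\bar z}u$ is in $L^p(\mathbb D)$, and neither of them is in $H^1_G(\mathbb D)$. -/

import Mathlib

open MeasureTheory Set
open scoped ENNReal

noncomputable section

/-- The Wirtinger derivative `∂_z = (∂_x - i ∂_y) / 2`. -/
def dz (u : ℂ → ℂ) (z : ℂ) : ℂ :=
  (1 / 2) * (fderiv ℝ u z 1 - Complex.I * fderiv ℝ u z Complex.I)

/-- The Wirtinger derivative `∂_{z̄} = (∂_x + i ∂_y) / 2`. -/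
def dzbar (u : ℂ → ℂ) (z : ℂ) : ℂ :=
  (1 / 2) * (fderiv ℝ u z 1 + Complex.I * fderiv ℝ u z Complex.I)

/-- The open unit disc. -/
def unitDisc : Set ℂ := Metric.ball 0 1

/-- The operator
`Δ_{α,β} = (1-|z|²) ((1-|z|²) ∂_z ∂_{z̄} + α z ∂_z + β z̄ ∂_{z̄} - α β)`. -/
def abLaplacian (α β : ℝ) (u : ℂ → ℂ) (z : ℂ) : ℂ :=
  (1 - (‖z‖ : ℂ) ^ 2) * ((1 - (‖z‖ : ℂ) ^ 2) * dz (dzbar u) z + α * z * dz u z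
    + β * starRingEnd ℂ z * dzbar u z - α * β * u z)

/-- `u` is `(α,β)`-harmonic: `C²` in the unit disc (in the real sense) with `Δ_{α,β} u = 0`. -/
def IsABHarmonic (α β : ℝ) (u : ℂ → ℂ) : Prop :=
  ContDiffOn ℝ 2 u unitDisc ∧ ∀ z ∈ unitDisc, abLaplacian α β u z = 0

/-- `c_{α,β} = Γ(α+1) Γ(β+1) / Γ(α+β+1)`. -/
def cAB (α β : ℝ) : ℝ :=
  Real.Gamma (α + 1) * Real.Gamma (β + 1) / Real.Gamma (α + β + 1)

/-- The Poisson kernel `P_{α,β}`; the complex powers are principal branches, and `1 - z`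
has positive real part for `z` in the unit disc. -/
def abPoissonKernel (α β : ℝ) (z : ℂ) : ℂ :=
  (cAB α β : ℂ) * (((1 - ‖z‖ ^ 2) ^ (α + β + 1) : ℝ) : ℂ) /
    ((1 - z) ^ ((α : ℂ) + 1) * (1 - starRingEnd ℂ z) ^ ((β : ℂ) + 1))

/-- The Poisson integral `P_{α,β}[f](z) = (1/2π) ∫_0^{2π} P_{α,β}(z e^{-iθ}) f(e^{iθ}) dθ`. -/
def abPoissonIntegral (α β : ℝ) (f : Circle → ℂ) (z : ℂ) : ℂ :=
  (1 / (2 * (Real.pi : ℂ))) * ∫ θ in (0 : ℝ)..(2 * Real.pi),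
    abPoissonKernel α β (z * Complex.exp (-(θ * Complex.I))) * f (Circle.exp θ)

/-- `I_λ(r) = (1/2π) ∫_0^{2π} (1-r²)^λ / |1 - r e^{-iθ}|^{λ+1} dθ`. -/
def integralI (l r : ℝ) : ℝ :=
  (1 / (2 * Real.pi)) * ∫ θ in (0 : ℝ)..(2 * Real.pi),
    (1 - r ^ 2) ^ l / ‖1 - (r : ℂ) * Complex.exp (-(θ * Complex.I))‖ ^ (l + 1)

/-- `c_λ = Γ(λ) / Γ(λ/2 + 1/2)²`. -/
def cConst (l : ℝ) : ℝ := Real.Gamma l / Real.Gamma (l / 2 + 1 / 2) ^ 2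

/-- The normalized measure `dθ / 2π` on the angles of one period. -/
def angleMeasure : Measure ℝ :=
  ENNReal.ofReal (1 / (2 * Real.pi)) • volume.restrict (Ioc 0 (2 * Real.pi))

/-- Absolute continuity of a function on the unit circle, in the angle. -/
def CircleAbsCont (f : Circle → ℂ) : Prop :=
  AbsolutelyContinuousOnInterval (fun t : ℝ => f (Circle.exp t)) 0 (2 * Real.pi)

/-- `θ ↦ ḟ(e^{iθ}) = d/dθ f(e^{iθ})`, as a function of the angle. -/
def angularDeriv (f : Circle → ℂ) (θ : ℝ) : ℂ :=
  deriv (fun t : ℝ => f (Circle.exp t)) θ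

/-- The norm `‖f‖_{L^p}` of a function on the circle, with respect to `dθ / 2π`. -/
def circleNorm (p : ℝ≥0∞) (f : Circle → ℂ) : ℝ≥0∞ :=
  eLpNorm (fun θ : ℝ => f (Circle.exp θ)) p angleMeasure

/-- `M_p(r,u)`: the `L^p(dθ/2π)` norm of `θ ↦ u(r e^{iθ})` (essential supremum for `p = ∞`). -/
def meanP (p : ℝ≥0∞) (r : ℝ) (u : ℂ → ℂ) : ℝ≥0∞ :=
  eLpNorm (fun θ : ℝ => u ((r : ℂ) * Complex.exp (θ * Complex.I))) p angleMeasure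

open Classical in
/-- The generalized Hardy norm: `sup_{0<r<1} M_p(r,u)` for `p < ∞`, and `sup_𝔻 |u|` for
`p = ∞`. -/
def hardyNorm (p : ℝ≥0∞) (u : ℂ → ℂ) : ℝ≥0∞ :=
  if p = ∞ then ⨆ z ∈ unitDisc, ‖u z‖ₑ else ⨆ r ∈ Ioo (0 : ℝ) 1, meanP p r u

/-- The generalized Hardy space `H_G^p(𝔻)`: Lebesgue measurable functions on the disc
whose restriction to each circle is Lebesgue measurable (so that the means exist), with finite
Hardy norm. -/
def MemHardy (p : ℝ≥0∞) (u : ℂ → ℂ) : Prop :=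
  AEMeasurable u (volume.restrict unitDisc) ∧
  (∀ r ∈ Ioo (0 : ℝ) 1,
    AEMeasurable (fun θ : ℝ => u ((r : ℂ) * Complex.exp (θ * Complex.I))) angleMeasure) ∧
  hardyNorm p u < ∞

/-- The space `L^p(𝔻)` with respect to area measure. -/
def MemLpDisc (p : ℝ≥0∞) (u : ℂ → ℂ) : Prop :=
  MemLp u p (volume.restrict unitDisc)

end

/-! Write s = α + β. Each derivative of P_{α,β} is bounded only by a multiple of (1-|z|²)^s /
|1-z|^(s+2), one power of |1-z| too singular for the claimed estimates. The regularity of f supplies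
that power. The radial factor of P_{α,β} is invisible to the angular operator z∂_z - z̄∂_z̄, and
this leads to the identity z∂_z P = (z∂_z - z̄∂_z̄)Q + βR (`mul_dz_abPoissonKernel`), where Q =
P(1-z̄)/(1-|z|²) and R = P z̄(1-z)/(1-|z|²). Both Q and R are bounded by |c_{α,β}| (1-|z|²)^s /
|1-z|^(s+1). Under the convolution the angular operator is a θ-derivative, so integration by parts
(`circleTransform_angular`) moves it onto f. Young's inequality on the circle then gives the mean
estimate, because the mean of the majorant is |c_{α,β}| I_s(r). Complex conjugation exchanges α with
β and ∂_z with ∂_z̄, so only ∂_z needs to be treated.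

The size of I_λ is read off from the means over t of |1-re^{it}|^(2m), which increase with r and
have a finite limit at r = 1 when m > -1/2, computed by the beta integral and Legendre duplication
(`monotoneOn_chordMean`, `chordMean_one`). For λ > 0, a Möbius change of variable on the circle
turns I_λ(r) into such a mean with m = (λ-1)/2, whence I_λ ≤ c_λ. For λ < 0, the exponent m =
-(λ+1)/2 is admissible as it stands and I_λ(r) ≤ c_{-λ} (1-r²)^λ. Since (1-r)^(λp) is integrable at
1 exactly when λp > -1, part (ii) follows in polar coordinates.

For sharpness, f is a non-negative Lipschitz bump at -1, observed from z near 1. There the kernel is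
far from its pole and its derivative is (1-|z|²)^s times a continuous function close to a non-zero
real number, so nothing cancels in the integral and both derivatives of u are at least κ(1-|z|²)^s
near 1 (`exists_le_norm_dz_dzbar`). This defeats L^p of the disc at the critical exponent and above,
and makes the L^1 means on circles unbounded.

Harmonicity is a computation for the kernel, carried to u because the convolution commutes with
every rotation-invariant operation in the equation. -/

/-! ### Wirtinger calculus -/

/-- The real-linear map `h ↦ A h + B h̄`. -/
noncomputable def wirtingerCLM (A B : ℂ) : ℂ →L[ℝ] ℂ :=
  A • ContinuousLinearMap.id ℝ ℂ + B • (Complex.conjCLE : ℂ →L[ℝ] ℂ)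

@[simp] lemma wirtingerCLM_apply (A B h : ℂ) :
    wirtingerCLM A B h = A * h + B * starRingEnd ℂ h := by
  simp [wirtingerCLM]

lemma contDiff_wirtingerCLM {n : WithTop ℕ∞} :
    ContDiff ℝ n fun p : ℂ × ℂ => wirtingerCLM p.1 p.2 := by
  unfold wirtingerCLM
  fun_prop

lemma intervalIntegral_wirtingerCLM {a b : ℝ} {f g : ℝ → ℂ} (hf : IntervalIntegrable f volume a b)
    (hg : IntervalIntegrable g volume a b) :
    ∫ θ in a..b, wirtingerCLM (f θ) (g θ) =
      wirtingerCLM (∫ θ in a..b, f θ) (∫ θ in a..b, g θ) := by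
  have h1 : IntervalIntegrable (fun θ => f θ • ContinuousLinearMap.id ℝ ℂ) volume a b :=
    intervalIntegrable_iff.2 ((intervalIntegrable_iff.1 hf).smul_const _)
  have h2 : IntervalIntegrable (fun θ => g θ • (Complex.conjCLE : ℂ →L[ℝ] ℂ)) volume a b :=
    intervalIntegrable_iff.2 ((intervalIntegrable_iff.1 hg).smul_const _)
  unfold wirtingerCLM
  rw [intervalIntegral.integral_add h1 h2, intervalIntegral.integral_smul_const,
    intervalIntegral.integral_smul_const]

lemma norm_wirtingerCLM_le (A B : ℂ) : ‖wirtingerCLM A B‖ ≤ ‖A‖ + ‖B‖ := by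
  refine ContinuousLinearMap.opNorm_le_bound _ (by positivity) fun h => ?_
  rw [wirtingerCLM_apply]
  calc ‖A * h + B * starRingEnd ℂ h‖ ≤ ‖A * h‖ + ‖B * starRingEnd ℂ h‖ := norm_add_le _ _
    _ = (‖A‖ + ‖B‖) * ‖h‖ := by simp [add_mul]

lemma clm_ext_of_one_I {L M : ℂ →L[ℝ] ℂ} (h1 : L 1 = M 1) (hI : L Complex.I = M Complex.I) :
    L = M := by
  ext z
  have hz : z = z.re • (1 : ℂ) + z.im • Complex.I := by
    simp [Complex.re_add_im]
  rw [hz, map_add, map_add, map_smul, map_smul, map_smul, map_smul, h1, hI]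

/-- `u` is real-differentiable at `z` with `∂_z u = A` and `∂_{z̄} u = B`. -/
def HasWirtingerAt (u : ℂ → ℂ) (A B z : ℂ) : Prop :=
  HasFDerivAt u (wirtingerCLM A B) z

namespace HasWirtingerAt

variable {u v : ℂ → ℂ} {A B A' B' z : ℂ}

lemma dz_eq (h : HasWirtingerAt u A B z) : dz u z = A := by
  have h' : fderiv ℝ u z = wirtingerCLM A B := HasFDerivAt.fderiv h
  simp only [dz, h', wirtingerCLM_apply, map_one, Complex.conj_I]
  linear_combination (-(A / 2) + B / 2) * Complex.I_sq

lemma dzbar_eq (h : HasWirtingerAt u A B z) : dzbar u z = B := by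
  have h' : fderiv ℝ u z = wirtingerCLM A B := HasFDerivAt.fderiv h
  simp only [dzbar, h', wirtingerCLM_apply, map_one, Complex.conj_I]
  linear_combination (A / 2 - B / 2) * Complex.I_sq

lemma mul (hu : HasWirtingerAt u A B z) (hv : HasWirtingerAt v A' B' z) :
    HasWirtingerAt (fun z => u z * v z) (u z * A' + A * v z) (u z * B' + B * v z) z := by
  refine (HasFDerivAt.mul hu hv).congr_fderiv ?_
  ext <;> simp <;> ring

lemma const_mul (c : ℂ) (hu : HasWirtingerAt u A B z) :
    HasWirtingerAt (fun z => c * u z) (c * A) (c * B) z := by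
  refine (HasFDerivAt.const_mul hu c).congr_fderiv ?_
  ext <;> simp <;> ring

lemma add (hu : HasWirtingerAt u A B z) (hv : HasWirtingerAt v A' B' z) :
    HasWirtingerAt (fun z => u z + v z) (A + A') (B + B') z := by
  refine (HasFDerivAt.add hu hv).congr_fderiv ?_
  ext <;> simp <;> ring

lemma congr_right (hu : HasWirtingerAt u A B z) (hA : A = A') (hB : B = B') :
    HasWirtingerAt u A' B' z := by
  subst hA hB; exact hu

lemma comp_mul_right {w : ℂ} (hu : HasWirtingerAt u A B (z * w)) :
    HasWirtingerAt (fun z => u (z * w)) (A * w) (B * starRingEnd ℂ w) z := by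
  have h1 : HasFDerivAt (fun z : ℂ => z * w) (wirtingerCLM w 0) z := by
    refine ((hasFDerivAt_id (𝕜 := ℝ) z).mul_const w).congr_fderiv ?_
    ext <;> simp
  refine (HasFDerivAt.comp (g := u) (f := fun z : ℂ => z * w) z hu h1).congr_fderiv ?_
  ext <;> simp <;> ring

lemma conj (hu : HasWirtingerAt u A B z) :
    HasWirtingerAt (fun z => starRingEnd ℂ (u z)) (starRingEnd ℂ B) (starRingEnd ℂ A) z := by
  have h1 := (Complex.conjCLE : ℂ →L[ℝ] ℂ).hasFDerivAt (x := u z)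
  refine (HasFDerivAt.comp z h1 hu).congr_fderiv ?_
  ext <;> simp <;> ring

end HasWirtingerAt

lemma hasWirtingerAt_of_hasDerivAt {u : ℂ → ℂ} {A z : ℂ} (h : HasDerivAt u A z) :
    HasWirtingerAt u A 0 z := by
  refine (h.hasFDerivAt.restrictScalars ℝ).congr_fderiv ?_
  ext <;> simp [mul_comm]

lemma hasWirtingerAt_conj_of_hasDerivAt {u : ℂ → ℂ} {B z : ℂ}
    (h : HasDerivAt u B (starRingEnd ℂ z)) :
    HasWirtingerAt (fun z => u (starRingEnd ℂ z)) 0 B z := by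
  have h1 := (Complex.conjCLE : ℂ →L[ℝ] ℂ).hasFDerivAt (x := z)
  refine (HasFDerivAt.comp z (h.hasFDerivAt.restrictScalars ℝ) h1).congr_fderiv ?_
  ext <;> simp [mul_comm]

lemma DifferentiableAt.hasWirtingerAt {u : ℂ → ℂ} {z : ℂ} (h : DifferentiableAt ℝ u z) :
    HasWirtingerAt u (dz u z) (dzbar u z) z := by
  refine h.hasFDerivAt.congr_fderiv (clm_ext_of_one_I ?_ ?_)
  · simp [dz, dzbar]; ring
  · simp only [dz, dzbar, wirtingerCLM_apply, Complex.conj_I]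
    linear_combination (fderiv ℝ u z Complex.I) * Complex.I_sq

lemma isOpen_unitDisc : IsOpen unitDisc := Metric.isOpen_ball

lemma mem_unitDisc {z : ℂ} : z ∈ unitDisc ↔ ‖z‖ < 1 := by simp [unitDisc]

lemma ContDiffOn.differentiableAt_unitDisc {u : ℂ → ℂ} {n : WithTop ℕ∞}
    (h : ContDiffOn ℝ n u unitDisc) (hn : n ≠ 0) {z : ℂ} (hz : z ∈ unitDisc) :
    DifferentiableAt ℝ u z :=
  (h.differentiableOn hn).differentiableAt (isOpen_unitDisc.mem_nhds hz)

lemma ContDiffOn.dz {u : ℂ → ℂ} {n : ℕ} (h : ContDiffOn ℝ (n + 1) u unitDisc) :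
    ContDiffOn ℝ n (dz u) unitDisc := by
  have h' := ((contDiffOn_succ_iff_fderiv_of_isOpen isOpen_unitDisc).1 h).2.2
  unfold _root_.dz
  exact contDiffOn_const.mul ((h'.clm_apply contDiffOn_const).sub
    (contDiffOn_const.mul (h'.clm_apply contDiffOn_const)))

lemma ContDiffOn.dzbar {u : ℂ → ℂ} {n : ℕ} (h : ContDiffOn ℝ (n + 1) u unitDisc) :
    ContDiffOn ℝ n (dzbar u) unitDisc := by
  have h' := ((contDiffOn_succ_iff_fderiv_of_isOpen isOpen_unitDisc).1 h).2.2
  unfold _root_.dzbar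
  exact contDiffOn_const.mul ((h'.clm_apply contDiffOn_const).add
    (contDiffOn_const.mul (h'.clm_apply contDiffOn_const)))

/-- The real differential is a smooth function of the pair (∂_z u, ∂_z̄ u), so regularity can be
bootstrapped from the two Wirtinger derivatives. -/
lemma contDiffOn_succ_of_hasWirtingerAt {u A B : ℂ → ℂ} {n : ℕ}
    (h : ∀ z ∈ unitDisc, HasWirtingerAt u (A z) (B z) z)
    (hA : ContDiffOn ℝ n A unitDisc) (hB : ContDiffOn ℝ n B unitDisc) :
    ContDiffOn ℝ (n + 1) u unitDisc := by
  refine (contDiffOn_succ_iff_fderiv_of_isOpen isOpen_unitDisc).2 ⟨fun z hz =>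
    (HasFDerivAt.differentiableAt (h z hz)).differentiableWithinAt, by simp, ?_⟩
  refine (contDiff_wirtingerCLM.comp_contDiffOn (hA.prodMk hB)).congr fun z hz => ?_
  exact HasFDerivAt.fderiv (h z hz)

/-! ### Convolution of a function on the disc with a function of the angle -/

/-- `z ↦ (1/2π) ∫_0^{2π} F(z e^{-iθ}) g(θ) dθ`. -/
noncomputable def circleTransform (F : ℂ → ℂ) (g : ℝ → ℂ) (z : ℂ) : ℂ :=
  (1 / (2 * (Real.pi : ℂ))) * ∫ θ in (0 : ℝ)..(2 * Real.pi),
    F (z * Complex.exp (-(θ * Complex.I))) * g θ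

lemma norm_exp_neg_mul_I (θ : ℝ) : ‖Complex.exp (-(θ * Complex.I))‖ = 1 := by
  rw [← neg_mul, ← Complex.ofReal_neg, Complex.norm_exp_ofReal_mul_I]

lemma conj_exp_neg_mul_I (θ : ℝ) :
    starRingEnd ℂ (Complex.exp (-(θ * Complex.I))) = Complex.exp (θ * Complex.I) := by
  rw [← Complex.exp_conj]; simp

lemma rotate_mem_unitDisc {z : ℂ} (hz : z ∈ unitDisc) (θ : ℝ) :
    z * Complex.exp (-(θ * Complex.I)) ∈ unitDisc := by
  rw [mem_unitDisc] at *
  rwa [norm_mul, norm_exp_neg_mul_I, mul_one]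

lemma ContinuousOn.comp_rotate {F : ℂ → ℂ} (hF : ContinuousOn F unitDisc) {z : ℂ}
    (hz : z ∈ unitDisc) :
    Continuous fun θ : ℝ => F (z * Complex.exp (-(θ * Complex.I))) :=
  hF.comp_continuous (by fun_prop) fun θ => rotate_mem_unitDisc hz θ

/-- Closed discs about 0 are compact and rotation invariant, so the bound is uniform in θ. This
provides the dominating function for every limit under the integral. -/
lemma ContinuousOn.exists_bound_near {F : ℂ → ℂ} (hF : ContinuousOn F unitDisc) {z₀ : ℂ}
    (hz₀ : z₀ ∈ unitDisc) :
    ∃ C, 0 ≤ C ∧ ∃ s ∈ nhds z₀, s ⊆ unitDisc ∧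
      ∀ z ∈ s, ∀ θ : ℝ, ‖F (z * Complex.exp (-(θ * Complex.I)))‖ ≤ C := by
  obtain ⟨ρ, h1, h2⟩ := exists_between (mem_unitDisc.1 hz₀)
  have hsub : Metric.closedBall (0 : ℂ) ρ ⊆ unitDisc := Metric.closedBall_subset_ball h2
  obtain ⟨C, hC⟩ := (isCompact_closedBall (0 : ℂ) ρ).exists_bound_of_continuousOn (hF.mono hsub)
  refine ⟨|C|, abs_nonneg _, Metric.ball 0 ρ, Metric.isOpen_ball.mem_nhds (by simpa using h1),
    Metric.ball_subset_closedBall.trans hsub, fun z hz θ => (hC _ ?_).trans (le_abs_self C)⟩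
  rw [mem_closedBall_zero_iff, norm_mul, norm_exp_neg_mul_I, mul_one]
  exact (mem_ball_zero_iff.1 hz).le

lemma continuousOn_circleTransform {F : ℂ → ℂ} (hF : ContinuousOn F unitDisc) {g : ℝ → ℂ}
    (hg : IntervalIntegrable g volume 0 (2 * Real.pi)) :
    ContinuousOn (circleTransform F g) unitDisc := by
  intro z₀ hz₀
  refine (continuousAt_const.mul ?_).continuousWithinAt
  obtain ⟨C, -, s, hs, hsd, hC⟩ := hF.exists_bound_near hz₀
  refine intervalIntegral.continuousAt_of_dominated_interval (bound := fun θ => C * ‖g θ‖)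
    ?_ ?_ (hg.norm.const_mul C) ?_
  · filter_upwards [isOpen_unitDisc.mem_nhds hz₀] with z hz
    exact (hF.comp_rotate hz).aestronglyMeasurable.mul (intervalIntegrable_iff.1 hg).aestronglyMeasurable
  · filter_upwards [hs] with z hz
    refine Filter.Eventually.of_forall fun θ _ => ?_
    rw [norm_mul]
    exact mul_le_mul_of_nonneg_right (hC z hz θ) (norm_nonneg _)
  · refine Filter.Eventually.of_forall fun θ _ => ContinuousAt.mul ?_ continuousAt_const
    exact ContinuousAt.comp_of_eq
      (hF.continuousAt (isOpen_unitDisc.mem_nhds (rotate_mem_unitDisc hz₀ θ)))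
      (by fun_prop) rfl

lemma intervalIntegrable_rotate_mul {F : ℂ → ℂ} (hF : ContinuousOn F unitDisc) {g : ℝ → ℂ}
    (hg : IntervalIntegrable g volume 0 (2 * Real.pi)) {z : ℂ} (hz : z ∈ unitDisc) :
    IntervalIntegrable (fun θ : ℝ => F (z * Complex.exp (-(θ * Complex.I))) * g θ) volume
      0 (2 * Real.pi) :=
  hg.continuousOn_mul (hF.comp_rotate hz).continuousOn

lemma circleTransform_add {F G : ℂ → ℂ} (hF : ContinuousOn F unitDisc)
    (hG : ContinuousOn G unitDisc) {g : ℝ → ℂ}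
    (hg : IntervalIntegrable g volume 0 (2 * Real.pi)) {z : ℂ} (hz : z ∈ unitDisc) :
    circleTransform (fun z => F z + G z) g z = circleTransform F g z + circleTransform G g z := by
  simp only [circleTransform, add_mul]
  rw [intervalIntegral.integral_add (intervalIntegrable_rotate_mul hF hg hz)
    (intervalIntegrable_rotate_mul hG hg hz), mul_add]

lemma circleTransform_const_mul (c : ℂ) (F : ℂ → ℂ) (g : ℝ → ℂ) (z : ℂ) :
    circleTransform (fun z => c * F z) g z = c * circleTransform F g z := by
  simp only [circleTransform, mul_assoc]
  rw [intervalIntegral.integral_const_mul]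
  ring

lemma intervalIntegrable_mul_exp {g : ℝ → ℂ} (hg : IntervalIntegrable g volume 0 (2 * Real.pi)) :
    IntervalIntegrable (fun θ : ℝ => Complex.exp (-(θ * Complex.I)) * g θ) volume
      0 (2 * Real.pi) :=
  hg.continuousOn_mul (by fun_prop)

lemma intervalIntegrable_mul_exp' {g : ℝ → ℂ} (hg : IntervalIntegrable g volume 0 (2 * Real.pi)) :
    IntervalIntegrable (fun θ : ℝ => Complex.exp (θ * Complex.I) * g θ) volume
      0 (2 * Real.pi) :=
  hg.continuousOn_mul (by fun_prop)

lemma HasWirtingerAt.intervalIntegral {F : ℂ → ℝ → ℂ} {A B : ℂ → ℝ → ℂ} {s : Set ℂ} {z₀ : ℂ}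
    (hs : s ∈ nhds z₀) {a b : ℝ} {bound : ℝ → ℝ}
    (hF : ∀ z ∈ s, IntervalIntegrable (F z) volume a b)
    (hA : IntervalIntegrable (A z₀) volume a b) (hB : IntervalIntegrable (B z₀) volume a b)
    (hbound : ∀ θ, ∀ z ∈ s, ‖A z θ‖ + ‖B z θ‖ ≤ bound θ)
    (hbi : IntervalIntegrable bound volume a b)
    (hd : ∀ θ, ∀ z ∈ s, HasWirtingerAt (fun z => F z θ) (A z θ) (B z θ) z) :
    HasWirtingerAt (fun z => ∫ θ in a..b, F z θ) (∫ θ in a..b, A z₀ θ) (∫ θ in a..b, B z₀ θ)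
      z₀ := by
  unfold HasWirtingerAt
  rw [← intervalIntegral_wirtingerCLM hA hB]
  refine intervalIntegral.hasFDerivAt_integral_of_dominated_of_fderiv_le (𝕜 := ℝ)
    (F' := fun z θ => wirtingerCLM (A z θ) (B z θ)) hs ?_ (hF z₀ (mem_of_mem_nhds hs)) ?_
    (Filter.Eventually.of_forall fun θ _ z hz => (norm_wirtingerCLM_le _ _).trans (hbound θ z hz))
    hbi (Filter.Eventually.of_forall fun θ _ z hz => hd θ z hz)
  · filter_upwards [hs] with z hz
    exact (intervalIntegrable_iff.1 (hF z hz)).aestronglyMeasurable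
  · exact (contDiff_wirtingerCLM (n := 0)).continuous.comp_aestronglyMeasurable
      ((intervalIntegrable_iff.1 hA).aestronglyMeasurable.prodMk
        (intervalIntegrable_iff.1 hB).aestronglyMeasurable)

/-- By the chain rule, rotation by e^{-iθ} multiplies ∂_z by e^{-iθ} and ∂_z̄ by its conjugate.
These phases are absorbed into the density `g`, so the derivatives are again transforms. -/
lemma HasWirtingerAt.circleTransform {F A B : ℂ → ℂ}
    (hF : ∀ z ∈ unitDisc, HasWirtingerAt F (A z) (B z) z)
    (hA : ContinuousOn A unitDisc) (hB : ContinuousOn B unitDisc) {g : ℝ → ℂ}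
    (hg : IntervalIntegrable g volume 0 (2 * Real.pi)) {z : ℂ} (hz : z ∈ unitDisc) :
    HasWirtingerAt (circleTransform F g)
      (_root_.circleTransform A (fun θ => Complex.exp (-(θ * Complex.I)) * g θ) z)
      (_root_.circleTransform B (fun θ => Complex.exp (θ * Complex.I) * g θ) z) z := by
  have hFc : ContinuousOn F unitDisc := fun z hz =>
    (HasFDerivAt.continuousAt (hF z hz)).continuousWithinAt
  obtain ⟨CA, hCA0, sA, hsA, hsAd, hCA⟩ := hA.exists_bound_near hz
  obtain ⟨CB, hCB0, sB, hsB, hsBd, hCB⟩ := hB.exists_bound_near hz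
  refine (HasWirtingerAt.intervalIntegral
    (A := fun z θ => A (z * Complex.exp (-(θ * Complex.I))) *
      (Complex.exp (-(θ * Complex.I)) * g θ))
    (B := fun z θ => B (z * Complex.exp (-(θ * Complex.I))) * (Complex.exp (θ * Complex.I) * g θ))
    (bound := fun θ => (CA + CB) * ‖g θ‖) (Filter.inter_mem hsA hsB)
    (fun z hz => intervalIntegrable_rotate_mul hFc hg (hsAd hz.1))
    (intervalIntegrable_rotate_mul hA (intervalIntegrable_mul_exp hg) hz)
    (intervalIntegrable_rotate_mul hB (intervalIntegrable_mul_exp' hg) hz)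
    (fun θ z hz => ?_) (hg.norm.const_mul _) fun θ z hz => ?_).const_mul _
  · simp only [norm_mul, norm_exp_neg_mul_I, Complex.norm_exp_ofReal_mul_I, one_mul, add_mul]
    exact add_le_add (mul_le_mul_of_nonneg_right (hCA z hz.1 θ) (norm_nonneg _))
      (mul_le_mul_of_nonneg_right (hCB z hz.2 θ) (norm_nonneg _))
  · have h1 := ((hF _ (rotate_mem_unitDisc (hsAd hz.1) θ)).comp_mul_right).const_mul (g θ)
    simp only [mul_comm _ (g θ)]
    refine h1.congr_right ?_ ?_
    · ring
    · rw [conj_exp_neg_mul_I]; ring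

/-- The transform of a `C^n` function is `C^n`. -/
lemma contDiffOn_circleTransform {n : ℕ} : ∀ {F : ℂ → ℂ}, ContDiffOn ℝ n F unitDisc →
    ∀ {g : ℝ → ℂ}, IntervalIntegrable g volume 0 (2 * Real.pi) →
      ContDiffOn ℝ n (circleTransform F g) unitDisc := by
  induction n with
  | zero =>
    intro F hF g hg
    simp only [CharP.cast_eq_zero, contDiffOn_zero] at *
    exact continuousOn_circleTransform hF hg
  | succ n ih =>
    intro F hF g hg
    push_cast at hF ⊢
    -- The derivatives are transforms of other kernels against modulated densities; this is why the
    -- induction quantifies over both `F` and `g`.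
    refine contDiffOn_succ_of_hasWirtingerAt
      (fun z hz => HasWirtingerAt.circleTransform
        (fun z hz => (hF.differentiableAt_unitDisc (by simp) hz).hasWirtingerAt)
        hF.dz.continuousOn hF.dzbar.continuousOn hg hz)
      (ih hF.dz (intervalIntegrable_mul_exp hg)) (ih hF.dzbar (intervalIntegrable_mul_exp' hg))

lemma dz_circleTransform {F : ℂ → ℂ} (hF : ContDiffOn ℝ 1 F unitDisc) {g : ℝ → ℂ}
    (hg : IntervalIntegrable g volume 0 (2 * Real.pi)) {z : ℂ} (hz : z ∈ unitDisc) :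
    dz (circleTransform F g) z =
      circleTransform (dz F) (fun θ => Complex.exp (-(θ * Complex.I)) * g θ) z := by
  have hF' : ContDiffOn ℝ ((0 : ℕ) + 1) F unitDisc := by simpa using hF
  exact (HasWirtingerAt.circleTransform
        (fun z hz => (hF.differentiableAt_unitDisc (by simp) hz).hasWirtingerAt)
        hF'.dz.continuousOn hF'.dzbar.continuousOn hg hz).dz_eq

lemma dzbar_circleTransform {F : ℂ → ℂ} (hF : ContDiffOn ℝ 1 F unitDisc) {g : ℝ → ℂ}
    (hg : IntervalIntegrable g volume 0 (2 * Real.pi)) {z : ℂ} (hz : z ∈ unitDisc) :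
    dzbar (circleTransform F g) z =
      circleTransform (dzbar F) (fun θ => Complex.exp (θ * Complex.I) * g θ) z := by
  have hF' : ContDiffOn ℝ ((0 : ℕ) + 1) F unitDisc := by simpa using hF
  exact (HasWirtingerAt.circleTransform
        (fun z hz => (hF.differentiableAt_unitDisc (by simp) hz).hasWirtingerAt)
        hF'.dz.continuousOn hF'.dzbar.continuousOn hg hz).dzbar_eq

/-! ### The kernel `P_{α,β}` and its derivatives -/

lemma one_sub_mem_slitPlane {z : ℂ} (hz : z ∈ unitDisc) : 1 - z ∈ Complex.slitPlane := by
  rw [Complex.mem_slitPlane_iff]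
  left
  have := (Complex.re_le_norm z).trans_lt (mem_unitDisc.1 hz)
  simpa using this

lemma one_sub_ne_zero {z : ℂ} (hz : z ∈ unitDisc) : 1 - z ≠ 0 :=
  Complex.slitPlane_ne_zero (one_sub_mem_slitPlane hz)

lemma conj_mem_unitDisc {z : ℂ} (hz : z ∈ unitDisc) : starRingEnd ℂ z ∈ unitDisc := by
  simpa [mem_unitDisc] using hz

lemma one_sub_conj_ne_zero {z : ℂ} (hz : z ∈ unitDisc) : 1 - starRingEnd ℂ z ≠ 0 :=
  one_sub_ne_zero (conj_mem_unitDisc hz)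

lemma one_sub_norm_sq_pos {z : ℂ} (hz : z ∈ unitDisc) : 0 < 1 - ‖z‖ ^ 2 := by
  have := mem_unitDisc.1 hz
  nlinarith [norm_nonneg z]

lemma ofReal_one_sub_norm_sq (z : ℂ) :
    ((1 - ‖z‖ ^ 2 : ℝ) : ℂ) = 1 - z * starRingEnd ℂ z := by
  push_cast
  rw [Complex.mul_conj']

lemma one_sub_mul_conj_ne_zero {z : ℂ} (hz : z ∈ unitDisc) : 1 - z * starRingEnd ℂ z ≠ 0 := by
  rw [← ofReal_one_sub_norm_sq]
  exact_mod_cast (one_sub_norm_sq_pos hz).ne'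

lemma hasWirtingerAt_one_sub_conj (z : ℂ) :
    HasWirtingerAt (fun z => 1 - starRingEnd ℂ z) 0 (-1) z :=
  hasWirtingerAt_conj_of_hasDerivAt (u := fun z => 1 - z)
    (by simpa using (hasDerivAt_id (starRingEnd ℂ z)).const_sub 1)

lemma hasWirtingerAt_id (z : ℂ) : HasWirtingerAt (fun z => z) 1 0 z :=
  hasWirtingerAt_of_hasDerivAt (hasDerivAt_id z)

lemma hasWirtingerAt_conj (z : ℂ) : HasWirtingerAt (fun z => starRingEnd ℂ z) 0 1 z :=
  hasWirtingerAt_conj_of_hasDerivAt (u := fun z => z) (hasDerivAt_id _)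

lemma hasWirtingerAt_one_sub_mul_conj (z : ℂ) :
    HasWirtingerAt (fun z => 1 - z * starRingEnd ℂ z) (-starRingEnd ℂ z) (-z) z := by
  have h := ((hasWirtingerAt_id z).mul (hasWirtingerAt_conj z)).const_mul (-1)
  have h1 := (hasWirtingerAt_of_hasDerivAt (hasDerivAt_const z (1 : ℂ))).add h
  have : (fun z => 1 - z * starRingEnd ℂ z) =
    fun z : ℂ => 1 + -1 * (z * starRingEnd ℂ z) := by funext z; ring
  rw [this]
  exact h1.congr_right (by ring) (by ring)

lemma HasWirtingerAt.inv {u : ℂ → ℂ} {A B z : ℂ} (hu : HasWirtingerAt u A B z) (h0 : u z ≠ 0) :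
    HasWirtingerAt (fun z => (u z)⁻¹) (-A / u z ^ 2) (-B / u z ^ 2) z := by
  have h1 := (hasDerivAt_inv h0).hasFDerivAt.restrictScalars ℝ
  refine (HasFDerivAt.comp (g := fun w : ℂ => w⁻¹) z h1 hu).congr_fderiv ?_
  ext <;> simp <;> field_simp <;> ring

lemma hasWirtingerAt_one_sub_norm_sq_rpow (s : ℝ) {z : ℂ} (hz : z ∈ unitDisc) :
    HasWirtingerAt (fun z => (((1 - ‖z‖ ^ 2) ^ s : ℝ) : ℂ))
      ((((1 - ‖z‖ ^ 2) ^ s : ℝ) : ℂ) * (-s * starRingEnd ℂ z / (1 - z * starRingEnd ℂ z)))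
      ((((1 - ‖z‖ ^ 2) ^ s : ℝ) : ℂ) * (-s * z / (1 - z * starRingEnd ℂ z))) z := by
  have hpos := one_sub_norm_sq_pos hz
  have hne := one_sub_mul_conj_ne_zero hz
  have h1 : HasFDerivAt (fun z : ℂ => 1 - ‖z‖ ^ 2) (-(2 • (innerSL ℝ z))) z :=
    ((hasStrictFDerivAt_norm_sq z).hasFDerivAt).const_sub 1
  have h2 := (Real.hasDerivAt_rpow_const (p := s) (Or.inl hpos.ne')).comp_hasFDerivAt z h1
  have h3 := Complex.ofRealCLM.hasFDerivAt.comp z h2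
  refine HasFDerivAt.congr_fderiv h3 ?_
  have hr : (1 - ‖z‖ ^ 2) ^ (s - 1) = (1 - ‖z‖ ^ 2) ^ s / (1 - ‖z‖ ^ 2) := by
    rw [Real.rpow_sub hpos, Real.rpow_one]
  rw [← ofReal_one_sub_norm_sq] at hne ⊢
  refine ContinuousLinearMap.ext fun h => ?_
  have hin : ((inner ℝ z h : ℝ) : ℂ) = (z * starRingEnd ℂ h + starRingEnd ℂ z * h) / 2 := by
    apply Complex.ext <;> simp [Complex.inner] <;> ring
  simp only [ContinuousLinearMap.comp_apply, Complex.ofRealCLM_apply,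
    smul_apply, neg_apply, innerSL_apply_apply,
    smul_eq_mul, wirtingerCLM_apply, hr, Complex.ofReal_mul, Complex.ofReal_neg, nsmul_eq_mul,
    Complex.ofReal_div, hin]
  field_simp
  push_cast
  ring

lemma hasDerivAt_one_sub_cpow_neg (a : ℂ) {z : ℂ} (hz : z ∈ unitDisc) :
    HasDerivAt (fun z => ((1 - z) ^ a)⁻¹) (((1 - z) ^ a)⁻¹ * (a / (1 - z))) z := by
  have h1 := ((hasDerivAt_id z).const_sub 1).cpow_const (c := a) (one_sub_mem_slitPlane hz)
  have hne : (1 - z) ^ a ≠ 0 := by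
    rw [Complex.cpow_ne_zero_iff]; exact Or.inl (one_sub_ne_zero hz)
  refine (h1.fun_inv (by simpa using hne)).congr_deriv ?_
  have h0 := one_sub_ne_zero hz
  simp only [id]
  rw [Complex.cpow_sub _ _ h0, Complex.cpow_one]
  field_simp

lemma abPoissonKernel_eq (α β : ℝ) (z : ℂ) :
    abPoissonKernel α β z = (cAB α β : ℂ) * ((((1 - ‖z‖ ^ 2) ^ (α + β + 1) : ℝ) : ℂ) *
      (((1 - z) ^ ((α : ℂ) + 1))⁻¹ * ((1 - starRingEnd ℂ z) ^ ((β : ℂ) + 1))⁻¹)) := by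
  rw [abPoissonKernel, div_eq_mul_inv, mul_inv]
  ring

/-- `∂_z log P_{α,β}`. -/
noncomputable def logDz (α β : ℝ) (z : ℂ) : ℂ :=
  -(α + β + 1) * starRingEnd ℂ z / (1 - z * starRingEnd ℂ z) + (α + 1) / (1 - z)

/-- `∂_{z̄} log P_{α,β}`. -/
noncomputable def logDzbar (α β : ℝ) (z : ℂ) : ℂ :=
  -(α + β + 1) * z / (1 - z * starRingEnd ℂ z) + (β + 1) / (1 - starRingEnd ℂ z)

lemma hasWirtingerAt_abPoissonKernel (α β : ℝ) {z : ℂ} (hz : z ∈ unitDisc) :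
    HasWirtingerAt (abPoissonKernel α β) (abPoissonKernel α β z * logDz α β z)
      (abPoissonKernel α β z * logDzbar α β z) z := by
  have h1 := hasWirtingerAt_one_sub_norm_sq_rpow (α + β + 1) hz
  have h2 := hasWirtingerAt_of_hasDerivAt (hasDerivAt_one_sub_cpow_neg ((α : ℂ) + 1) hz)
  have h3 := hasWirtingerAt_conj_of_hasDerivAt
    (hasDerivAt_one_sub_cpow_neg ((β : ℂ) + 1) (conj_mem_unitDisc hz))
  have h := (h1.mul (h2.mul h3)).const_mul (cAB α β : ℂ)
  rw [show abPoissonKernel α β = _ from funext (abPoissonKernel_eq α β)]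
  refine h.congr_right ?_ ?_
  · simp only [logDz]; push_cast; ring
  · simp only [logDzbar]; push_cast; ring

lemma contDiffOn_abPoissonKernel (α β : ℝ) {n : WithTop ℕ∞} :
    ContDiffOn ℝ n (abPoissonKernel α β) unitDisc := by
  have hE : ∀ a : ℂ, ContDiffOn ℝ n (fun z => ((1 - z) ^ a)⁻¹) unitDisc := fun a =>
    (DifferentiableOn.contDiffOn (fun z hz =>
      (hasDerivAt_one_sub_cpow_neg a hz).differentiableAt.differentiableWithinAt)
      isOpen_unitDisc).restrict_scalars ℝ
  rw [show abPoissonKernel α β = _ from funext (abPoissonKernel_eq α β)]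
  refine contDiffOn_const.mul (ContDiffOn.mul ?_ (ContDiffOn.mul (hE _) ?_))
  · refine Complex.ofRealCLM.contDiff.comp_contDiffOn ?_
    refine ContDiffOn.rpow_const_of_ne ?_ fun z hz => (one_sub_norm_sq_pos hz).ne'
    exact contDiffOn_const.sub (contDiff_norm_sq ℝ).contDiffOn
  · exact (hE _).comp (Complex.conjCLE.contDiff (n := n)).contDiffOn
      fun z hz => conj_mem_unitDisc hz

lemma dz_abPoissonKernel (α β : ℝ) {z : ℂ} (hz : z ∈ unitDisc) :
    dz (abPoissonKernel α β) z = abPoissonKernel α β z * logDz α β z :=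
  (hasWirtingerAt_abPoissonKernel α β hz).dz_eq

lemma dzbar_abPoissonKernel (α β : ℝ) {z : ℂ} (hz : z ∈ unitDisc) :
    dzbar (abPoissonKernel α β) z = abPoissonKernel α β z * logDzbar α β z :=
  (hasWirtingerAt_abPoissonKernel α β hz).dzbar_eq

lemma dz_congr {u v : ℂ → ℂ} (h : EqOn u v unitDisc) {z : ℂ} (hz : z ∈ unitDisc) :
    dz u z = dz v z := by
  have : u =ᶠ[nhds z] v := Filter.eventuallyEq_of_mem (isOpen_unitDisc.mem_nhds hz) h
  simp only [dz, this.fderiv_eq]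

/-- If ∂_z̄ P = P·b, then ∂_z∂_z̄ P = P((∂_z log P) b + ∂_z b). Only the first term of b contributes
to ∂_z b, its second term being antiholomorphic. -/
lemma dz_dzbar_abPoissonKernel (α β : ℝ) {z : ℂ} (hz : z ∈ unitDisc) :
    dz (dzbar (abPoissonKernel α β)) z = abPoissonKernel α β z *
      (logDz α β z * logDzbar α β z - (α + β + 1) / (1 - z * starRingEnd ℂ z) ^ 2) := by
  have hne := one_sub_mul_conj_ne_zero hz
  have h2 := (((hasWirtingerAt_id z).mul
    ((hasWirtingerAt_one_sub_mul_conj z).inv hne)).const_mul (-(α + β + 1))).add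
    (((hasWirtingerAt_one_sub_conj z).inv (one_sub_conj_ne_zero hz)).const_mul (β + 1))
  have h3 := (hasWirtingerAt_abPoissonKernel α β hz).mul h2
  rw [dz_congr (v := fun z => abPoissonKernel α β z * (-(α + β + 1) *
    (z * (1 - z * starRingEnd ℂ z)⁻¹) + (β + 1) * (1 - starRingEnd ℂ z)⁻¹))
    (fun z hz => ?_) hz, h3.dz_eq]
  · simp only [logDzbar]
    field_simp
    ring
  · rw [dzbar_abPoissonKernel α β hz, logDzbar]
    ring

/-- The kernel is annihilated by the differential operator. -/
lemma abPoissonKernel_pde (α β : ℝ) {z : ℂ} (hz : z ∈ unitDisc) :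
    (1 - (‖z‖ : ℂ) ^ 2) * dz (dzbar (abPoissonKernel α β)) z
      + α * (z * dz (abPoissonKernel α β) z)
      + β * (starRingEnd ℂ z * dzbar (abPoissonKernel α β) z)
      - α * β * abPoissonKernel α β z = 0 := by
  have hne := one_sub_mul_conj_ne_zero hz
  have h1 := one_sub_ne_zero hz
  have h2 := one_sub_conj_ne_zero hz
  rw [dz_dzbar_abPoissonKernel α β hz, dz_abPoissonKernel α β hz, dzbar_abPoissonKernel α β hz,
    ← Complex.mul_conj']
  simp only [logDz, logDzbar]
  -- The kernel factors out, leaving a rational identity valid with z and z̄ as independent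
  -- variables.
  generalize abPoissonKernel α β z = K
  generalize starRingEnd ℂ z = w at *
  field_simp
  ring

/-! ### Splitting z∂_z P into an angular derivative and a remainder -/

/-- `P_{α,β}(z) (1 - z̄) / (1 - |z|²)`. -/
noncomputable def kernelQ (α β : ℝ) (z : ℂ) : ℂ :=
  abPoissonKernel α β z * ((1 - starRingEnd ℂ z) * (1 - z * starRingEnd ℂ z)⁻¹)

/-- `P_{α,β}(z) z̄ (1 - z) / (1 - |z|²)`. -/
noncomputable def kernelR (α β : ℝ) (z : ℂ) : ℂ :=
  abPoissonKernel α β z * (starRingEnd ℂ z * (1 - z) * (1 - z * starRingEnd ℂ z)⁻¹)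

lemma contDiffOn_inv_one_sub_mul_conj {n : WithTop ℕ∞} :
    ContDiffOn ℝ n (fun z => (1 - z * starRingEnd ℂ z)⁻¹) unitDisc :=
  ContDiffOn.inv ((contDiff_const.sub
    (contDiff_id.mul Complex.conjCLE.contDiff)).contDiffOn) fun _ hz => one_sub_mul_conj_ne_zero hz

lemma contDiffOn_kernelQ (α β : ℝ) {n : WithTop ℕ∞} :
    ContDiffOn ℝ n (kernelQ α β) unitDisc :=
  (contDiffOn_abPoissonKernel α β).mul
    ((contDiff_const.sub Complex.conjCLE.contDiff).contDiffOn.mul contDiffOn_inv_one_sub_mul_conj)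

lemma contDiffOn_kernelR (α β : ℝ) {n : WithTop ℕ∞} :
    ContDiffOn ℝ n (kernelR α β) unitDisc :=
  (contDiffOn_abPoissonKernel α β).mul
    ((Complex.conjCLE.contDiff.mul (contDiff_const.sub contDiff_id)).contDiffOn.mul
      contDiffOn_inv_one_sub_mul_conj)

/-- The angular operator ignores the radial factor, and the extra 1 - z̄ in `kernelQ` lowers the
exponent β + 1 to β. Hence it gives Q((α+1)z/(1-z) - βz̄/(1-z̄)), and the discrepancy with z∂_z P is
exactly β times `kernelR`. Neither kernel is more singular than `majorant`. -/
lemma mul_dz_abPoissonKernel (α β : ℝ) {z : ℂ} (hz : z ∈ unitDisc) :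
    z * dz (abPoissonKernel α β) z =
      (z * dz (kernelQ α β) z - starRingEnd ℂ z * dzbar (kernelQ α β) z)
        + β * kernelR α β z := by
  have hne := one_sub_mul_conj_ne_zero hz
  have h1 := one_sub_ne_zero hz
  have h2 := one_sub_conj_ne_zero hz
  have hQ : HasWirtingerAt (kernelQ α β) _ _ z := (hasWirtingerAt_abPoissonKernel α β hz).mul
    ((hasWirtingerAt_one_sub_conj z).mul ((hasWirtingerAt_one_sub_mul_conj z).inv hne))
  rw [dz_abPoissonKernel α β hz, hQ.dz_eq, hQ.dzbar_eq]
  simp only [logDz, logDzbar, kernelR]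
  generalize abPoissonKernel α β z = K
  generalize starRingEnd ℂ z = w at *
  field_simp
  ring

/-- `|c_{α,β}| (1 - |z|²)^{α+β} / |1 - z|^{α+β+1}`. -/
noncomputable def majorant (α β : ℝ) (z : ℂ) : ℝ :=
  |cAB α β| * ((1 - ‖z‖ ^ 2) ^ (α + β) / ‖1 - z‖ ^ (α + β + 1))

lemma norm_abPoissonKernel (α β : ℝ) {z : ℂ} (hz : z ∈ unitDisc) :
    ‖abPoissonKernel α β z‖ * (‖1 - z‖ * (1 - ‖z‖ ^ 2)⁻¹) = majorant α β z := by
  have hpos := one_sub_norm_sq_pos hz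
  have h1 : 0 < ‖1 - z‖ := norm_pos_iff.2 (one_sub_ne_zero hz)
  have hc : ‖1 - starRingEnd ℂ z‖ = ‖1 - z‖ := by
    rw [← Complex.norm_conj]; simp
  have ha : ((α : ℂ) + 1) = ((α + 1 : ℝ) : ℂ) := by push_cast; rfl
  have hb : ((β : ℂ) + 1) = ((β + 1 : ℝ) : ℂ) := by push_cast; rfl
  rw [abPoissonKernel, majorant, norm_div, norm_mul, norm_mul, ha, hb, Complex.norm_cpow_real,
    Complex.norm_cpow_real, hc, Complex.norm_real, Complex.norm_real, Real.norm_eq_abs,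
    Real.norm_of_nonneg (Real.rpow_nonneg hpos.le _), ← Real.rpow_add h1,
    Real.rpow_add hpos, Real.rpow_one,
    show α + 1 + (β + 1) = (α + β + 1) + 1 by ring, Real.rpow_add h1 (α + β + 1), Real.rpow_one]
  have : 0 < ‖1 - z‖ ^ (α + β + 1) := Real.rpow_pos_of_pos h1 _
  field_simp

lemma norm_one_sub_mul_conj {z : ℂ} (hz : z ∈ unitDisc) :
    ‖1 - z * starRingEnd ℂ z‖ = 1 - ‖z‖ ^ 2 := by
  rw [← ofReal_one_sub_norm_sq, Complex.norm_real, Real.norm_of_nonneg (one_sub_norm_sq_pos hz).le]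

lemma norm_kernelQ (α β : ℝ) {z : ℂ} (hz : z ∈ unitDisc) :
    ‖kernelQ α β z‖ = majorant α β z := by
  have hc : ‖1 - starRingEnd ℂ z‖ = ‖1 - z‖ := by
    rw [← Complex.norm_conj]; simp
  rw [kernelQ, norm_mul, norm_mul, norm_inv, norm_one_sub_mul_conj hz, hc,
    norm_abPoissonKernel α β hz]

lemma norm_kernelR_le (α β : ℝ) {z : ℂ} (hz : z ∈ unitDisc) :
    ‖kernelR α β z‖ ≤ majorant α β z := by
  rw [kernelR, norm_mul, norm_mul, norm_mul, norm_inv, norm_one_sub_mul_conj hz,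
    ← norm_abPoissonKernel α β hz, Complex.norm_conj]
  have := (one_sub_norm_sq_pos hz)
  have h1 := (mem_unitDisc.1 hz).le
  gcongr
  exact mul_le_of_le_one_left (norm_nonneg _) h1

/-- Conjugation commutes with principal powers because 1 - z stays off the negative real axis. This
symmetry reduces every statement on ∂_z̄ to one on ∂_z. -/
lemma conj_abPoissonKernel (α β : ℝ) {z : ℂ} (hz : z ∈ unitDisc) :
    starRingEnd ℂ (abPoissonKernel α β z) = abPoissonKernel β α z := by
  have harg : ∀ {w : ℂ}, w ∈ unitDisc → (1 - w).arg ≠ Real.pi := fun hw =>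
    Complex.slitPlane_arg_ne_pi (one_sub_mem_slitPlane hw)
  have key : ∀ (a : ℝ) {w : ℂ}, w ∈ unitDisc →
      starRingEnd ℂ ((1 - w) ^ ((a : ℂ) + 1)) = (1 - starRingEnd ℂ w) ^ ((a : ℂ) + 1) := by
    intro a w hw
    have := Complex.conj_cpow (1 - w) ((a : ℂ) + 1) (harg hw)
    simp only [map_sub, map_one, map_add, Complex.conj_ofReal] at this
    exact this.symm
  rw [abPoissonKernel, abPoissonKernel, map_div₀, map_mul, map_mul, key α hz,
    key β (conj_mem_unitDisc hz), Complex.conj_conj, Complex.conj_ofReal, Complex.conj_ofReal,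
    mul_comm ((1 - z) ^ ((β : ℂ) + 1)), show β + α + 1 = α + β + 1 by ring]
  congr 3
  rw [cAB, cAB, mul_comm (Real.Gamma (β + 1)), show β + α + 1 = α + β + 1 by ring]

/-! ### Derivatives of the Poisson integral -/

lemma circleTransform_congr {F G : ℂ → ℂ} (h : EqOn F G unitDisc) (g : ℝ → ℂ) {z : ℂ}
    (hz : z ∈ unitDisc) : circleTransform F g z = circleTransform G g z := by
  simp only [circleTransform]
  congr 1
  refine intervalIntegral.integral_congr fun θ _ => ?_
  simp only [h (rotate_mem_unitDisc hz θ)]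

/-- Together with the next two lemmas, this shows that the transform commutes with
rotation-invariant operations: multiplying by z or z̄ cancels the phase created by ∂_z or ∂_z̄, and
a radial factor does not see the rotation. -/
lemma mul_circleTransform (F : ℂ → ℂ) (g : ℝ → ℂ) (z : ℂ) :
    z * circleTransform F (fun θ => Complex.exp (-(θ * Complex.I)) * g θ) z =
      circleTransform (fun z => z * F z) g z := by
  simp only [circleTransform]
  rw [mul_left_comm, ← intervalIntegral.integral_const_mul]
  congr 2
  funext θ
  ring

lemma conj_mul_circleTransform (F : ℂ → ℂ) (g : ℝ → ℂ) (z : ℂ) :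
    starRingEnd ℂ z * circleTransform F (fun θ => Complex.exp (θ * Complex.I) * g θ) z =
      circleTransform (fun z => starRingEnd ℂ z * F z) g z := by
  simp only [circleTransform]
  rw [mul_left_comm, ← intervalIntegral.integral_const_mul]
  congr 2
  funext θ
  rw [map_mul, conj_exp_neg_mul_I]
  ring

lemma norm_mul_circleTransform (w : ℝ → ℂ) (F : ℂ → ℂ) (g : ℝ → ℂ) (z : ℂ) :
    w ‖z‖ * circleTransform F g z = circleTransform (fun z => w ‖z‖ * F z) g z := by
  simp only [circleTransform]
  rw [mul_left_comm, ← intervalIntegral.integral_const_mul]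
  congr 2
  funext θ
  rw [norm_mul, norm_exp_neg_mul_I, mul_one]
  ring

lemma abPoissonIntegral_eq_circleTransform (α β : ℝ) (f : Circle → ℂ) :
    abPoissonIntegral α β f =
      circleTransform (abPoissonKernel α β) fun θ => f (Circle.exp θ) := rfl

lemma dz_dzbar_circleTransform {F : ℂ → ℂ} (hF : ContDiffOn ℝ 2 F unitDisc) {g : ℝ → ℂ}
    (hg : IntervalIntegrable g volume 0 (2 * Real.pi)) {z : ℂ} (hz : z ∈ unitDisc) :
    dz (dzbar (circleTransform F g)) z = circleTransform (dz (dzbar F)) g z := by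
  have hF1 : ContDiffOn ℝ 1 (dzbar F) unitDisc := by
    have : ContDiffOn ℝ ((1 : ℕ) + 1) F unitDisc := by
      norm_num; exact hF
    exact_mod_cast this.dzbar
  rw [dz_congr (fun z hz => dzbar_circleTransform (hF.of_le (by norm_num)) hg hz) hz,
    dz_circleTransform hF1 (intervalIntegrable_mul_exp' hg) hz]
  -- The phases e^{iθ} from ∂_z̄ and e^{-iθ} from ∂_z cancel.
  congr 1
  funext θ
  rw [← mul_assoc, ← Complex.exp_add]
  simp

lemma circleTransform_zero_left (g : ℝ → ℂ) (z : ℂ) : circleTransform (fun _ => 0) g z = 0 := by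
  simp [circleTransform]

theorem isABHarmonic_abPoissonIntegral (α β : ℝ) {f : Circle → ℂ}
    (hf : IntervalIntegrable (fun θ : ℝ => f (Circle.exp θ)) volume 0 (2 * Real.pi)) :
    IsABHarmonic α β (abPoissonIntegral α β f) := by
  rw [abPoissonIntegral_eq_circleTransform]
  have hK : ContDiffOn ℝ ((1 : ℕ) + 1) (abPoissonKernel α β) unitDisc :=
    contDiffOn_abPoissonKernel α β
  have hK1 : ContDiffOn ℝ 1 (abPoissonKernel α β) unitDisc := contDiffOn_abPoissonKernel α β
  refine ⟨contDiffOn_circleTransform (n := 2) (contDiffOn_abPoissonKernel α β) hf,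
    fun z hz => ?_⟩
  have c1 : ContinuousOn (fun z => z * dz (abPoissonKernel α β) z) unitDisc :=
    continuousOn_id.mul hK.dz.continuousOn
  have c2 : ContinuousOn (fun z => starRingEnd ℂ z * dzbar (abPoissonKernel α β) z) unitDisc :=
    Complex.continuous_conj.continuousOn.mul hK.dzbar.continuousOn
  have hd : ContDiffOn ℝ ((0 : ℕ) + 1) (dzbar (abPoissonKernel α β)) unitDisc := by
    exact_mod_cast hK.dzbar
  have c0 : ContinuousOn (fun z : ℂ => (1 - (‖z‖ : ℂ) ^ 2) *
      dz (dzbar (abPoissonKernel α β)) z) unitDisc :=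
    ContinuousOn.mul (by fun_prop) hd.dz.continuousOn
  -- The equation for the kernel is integrated against `f`; the rewriting below then moves each
  -- operation outside the integral.
  have hcong := circleTransform_congr (F := fun z => ((1 - (‖z‖ : ℂ) ^ 2) *
      dz (dzbar (abPoissonKernel α β)) z + α * (z * dz (abPoissonKernel α β) z))
      + (β * (starRingEnd ℂ z * dzbar (abPoissonKernel α β) z)
      + (-(α * β)) * abPoissonKernel α β z)) (G := fun _ => 0)
      (fun z hz => by
        simp only
        rw [← abPoissonKernel_pde α β hz]
        ring) (fun θ => f (Circle.exp θ)) hz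
  have c1' : ContinuousOn (fun z => α * (z * dz (abPoissonKernel α β) z)) unitDisc :=
    continuousOn_const.mul c1
  have c2' : ContinuousOn (fun z => β * (starRingEnd ℂ z * dzbar (abPoissonKernel α β) z))
      unitDisc := continuousOn_const.mul c2
  have c3 : ContinuousOn (fun z => (-(α * β)) * abPoissonKernel α β z) unitDisc :=
    continuousOn_const.mul hK.continuousOn
  have c01 : ContinuousOn (fun z => (1 - (‖z‖ : ℂ) ^ 2) * dz (dzbar (abPoissonKernel α β)) z
      + α * (z * dz (abPoissonKernel α β) z)) unitDisc := c0.add c1'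
  have c23 : ContinuousOn (fun z => β * (starRingEnd ℂ z * dzbar (abPoissonKernel α β) z)
      + (-(α * β)) * abPoissonKernel α β z) unitDisc := c2'.add c3
  rw [circleTransform_add c01 c23 hf hz, circleTransform_add c0 c1' hf hz,
    circleTransform_add c2' c3 hf hz,
    circleTransform_const_mul, circleTransform_const_mul, circleTransform_const_mul,
    circleTransform_zero_left,
    ← norm_mul_circleTransform (fun x => 1 - (x : ℂ) ^ 2), ← mul_circleTransform,
    ← conj_mul_circleTransform, ← dz_circleTransform hK1 hf hz,
    ← dzbar_circleTransform hK1 hf hz, ← dz_dzbar_circleTransform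
      (contDiffOn_abPoissonKernel α β) hf hz] at hcong
  rw [abLaplacian]
  refine mul_eq_zero_of_right _ ?_
  rw [← hcong]
  ring

/-! ### Integration by parts for complex absolutely continuous functions -/

/-- A Lipschitz map multiplies the oscillation sums by at most `K`. Applied to real part, imaginary
part and conjugation, it transfers the real theory of absolute continuity to complex values. -/
lemma LipschitzWith.comp_absolutelyContinuousOnInterval {X Y : Type*} [PseudoMetricSpace X]
    [PseudoMetricSpace Y] {K : NNReal} {φ : X → Y} (hφ : LipschitzWith K φ) {h : ℝ → X} {a b : ℝ}
    (hh : AbsolutelyContinuousOnInterval h a b) :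
    AbsolutelyContinuousOnInterval (fun x => φ (h x)) a b := by
  unfold AbsolutelyContinuousOnInterval at *
  have h2 := hh.const_mul (K : ℝ)
  rw [mul_zero] at h2
  refine squeeze_zero (fun t => Finset.sum_nonneg fun i _ => dist_nonneg) (fun t => ?_) h2
  rw [Finset.mul_sum]
  exact Finset.sum_le_sum fun i _ => hφ.dist_le_mul _ _

lemma IntervalIntegrable.complex_ofReal {h : ℝ → ℝ} {a b : ℝ}
    (hh : IntervalIntegrable h volume a b) :
    IntervalIntegrable (fun x => (h x : ℂ)) volume a b :=
  intervalIntegrable_iff.2 (intervalIntegrable_iff.1 hh).ofReal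

lemma lipschitzWith_re : LipschitzWith 1 Complex.re :=
  LipschitzWith.of_dist_le_mul fun x y => by
    simpa [Real.dist_eq, Complex.dist_eq] using Complex.abs_re_le_norm (x - y)

lemma lipschitzWith_im : LipschitzWith 1 Complex.im :=
  LipschitzWith.of_dist_le_mul fun x y => by
    simpa [Real.dist_eq, Complex.dist_eq] using Complex.abs_im_le_norm (x - y)

namespace AbsolutelyContinuousOnInterval

variable {h : ℝ → ℂ} {a b : ℝ}

lemma complex_re (hh : AbsolutelyContinuousOnInterval h a b) :
    AbsolutelyContinuousOnInterval (fun x => (h x).re) a b :=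
  lipschitzWith_re.comp_absolutelyContinuousOnInterval hh

lemma complex_im (hh : AbsolutelyContinuousOnInterval h a b) :
    AbsolutelyContinuousOnInterval (fun x => (h x).im) a b :=
  lipschitzWith_im.comp_absolutelyContinuousOnInterval hh

lemma complex_ae_hasDerivAt (hh : AbsolutelyContinuousOnInterval h a b) :
    ∀ᵐ x : ℝ, x ∈ uIcc a b → HasDerivAt h
      (((deriv (fun x => (h x).re) x : ℝ) : ℂ) + ((deriv (fun x => (h x).im) x : ℝ) : ℂ) * Complex.I) x := by
  filter_upwards [hh.complex_re.ae_differentiableAt, hh.complex_im.ae_differentiableAt]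
    with x h1 h2 hx
  have := (h1 hx).hasDerivAt.ofReal_comp.add ((h2 hx).hasDerivAt.ofReal_comp.mul_const Complex.I)
  refine this.congr_of_eventuallyEq (Filter.Eventually.of_forall fun y => ?_)
  simp [Complex.re_add_im]

lemma complex_ae_deriv_eq (hh : AbsolutelyContinuousOnInterval h a b) :
    (fun x => ((deriv (fun x => (h x).re) x : ℝ) : ℂ) + ((deriv (fun x => (h x).im) x : ℝ) : ℂ) * Complex.I)
      =ᵐ[volume.restrict (uIoc a b)] deriv h := by
  filter_upwards [ae_restrict_of_ae hh.complex_ae_hasDerivAt,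
    ae_restrict_mem measurableSet_uIoc] with x hx hxm
  exact (hx (uIoc_subset_uIcc hxm)).deriv.symm

lemma complex_intervalIntegrable_deriv (hh : AbsolutelyContinuousOnInterval h a b) :
    IntervalIntegrable (deriv h) volume a b :=
  ((IntervalIntegrable.complex_ofReal hh.complex_re.intervalIntegrable_deriv).add
    ((IntervalIntegrable.complex_ofReal hh.complex_im.intervalIntegrable_deriv).mul_const Complex.I)).congr_ae
    hh.complex_ae_deriv_eq

lemma complex_integral_deriv_eq_sub (hh : AbsolutelyContinuousOnInterval h a b) :
    ∫ x in a..b, deriv h x = h b - h a := by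
  rw [← intervalIntegral.integral_congr_ae_restrict hh.complex_ae_deriv_eq,
    intervalIntegral.integral_add (IntervalIntegrable.complex_ofReal hh.complex_re.intervalIntegrable_deriv)
    ((IntervalIntegrable.complex_ofReal hh.complex_im.intervalIntegrable_deriv).mul_const Complex.I),
    intervalIntegral.integral_mul_const, intervalIntegral.integral_ofReal,
    intervalIntegral.integral_ofReal, hh.complex_re.integral_deriv_eq_sub,
    hh.complex_im.integral_deriv_eq_sub]
  apply Complex.ext <;> simp

/-- Integration by parts against a function with continuous derivative. -/
lemma complex_integral_deriv_mul (hh : AbsolutelyContinuousOnInterval h a b) {q q' : ℝ → ℂ}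
    (hq : ∀ x, HasDerivAt q (q' x) x) (hq' : Continuous q') :
    ∫ x in a..b, q' x * h x = q b * h b - q a * h a - ∫ x in a..b, q x * deriv h x := by
  have hqc : Continuous q := continuous_iff_continuousAt.2 fun x => (hq x).continuousAt
  have hqd : ContDiff ℝ 1 q := contDiff_one_iff_deriv.2
    ⟨fun x => (hq x).differentiableAt, by rwa [show deriv q = q' from funext fun x => (hq x).deriv]⟩
  -- The product is absolutely continuous, so it is the integral of its almost everywhere
  -- derivative, which the product rule computes.
  have hqh : AbsolutelyContinuousOnInterval (fun x => q x • h x) a b :=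
    (hqd.contDiffOn.absolutelyContinuousOnInterval).fun_smul hh
  have h1 : IntervalIntegrable (fun x => q' x * h x) volume a b :=
    (hq'.continuousOn.mul hh.continuousOn).intervalIntegrable
  have h2 : IntervalIntegrable (fun x => q x * deriv h x) volume a b :=
    hh.complex_intervalIntegrable_deriv.continuousOn_mul hqc.continuousOn
  have key : ∫ x in a..b, (q' x * h x + q x * deriv h x) = q b * h b - q a * h a := by
    have := hqh.complex_integral_deriv_eq_sub
    simp only [smul_eq_mul] at this
    rw [← this]
    refine intervalIntegral.integral_congr_ae ?_
    filter_upwards [hh.complex_ae_hasDerivAt] with x hx hxm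
    have hd := (hx (uIoc_subset_uIcc hxm))
    have hm := ((hq x).mul hd).deriv
    rw [hd.deriv]
    exact hm.symm
  rw [intervalIntegral.integral_add h1 h2] at key
  linear_combination key

end AbsolutelyContinuousOnInterval

lemma hasDerivAt_exp_neg_mul_I (θ : ℝ) :
    HasDerivAt (fun θ : ℝ => Complex.exp (-(θ * Complex.I)))
      (-Complex.I * Complex.exp (-(θ * Complex.I))) θ := by
  have h1 : HasDerivAt (fun θ : ℝ => -((θ : ℂ) * Complex.I)) (-Complex.I) θ := by
    simpa using ((hasDerivAt_id θ).ofReal_comp.mul_const Complex.I).fun_neg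
  exact h1.cexp.congr_deriv (by ring)

/-- This identifies -i(z∂_z - z̄∂_z̄) with differentiation in θ of the rotated kernel. -/
lemma HasWirtingerAt.hasDerivAt_rotate {F : ℂ → ℂ} {A B z : ℂ} {θ : ℝ}
    (h : HasWirtingerAt F A B (z * Complex.exp (-(θ * Complex.I)))) :
    HasDerivAt (fun θ : ℝ => F (z * Complex.exp (-(θ * Complex.I))))
      (-Complex.I * (z * Complex.exp (-(θ * Complex.I)) * A -
        starRingEnd ℂ (z * Complex.exp (-(θ * Complex.I))) * B)) θ := by
  have h2 := HasFDerivAt.comp_hasDerivAt (l := F)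
    (f := fun θ : ℝ => z * Complex.exp (-(θ * Complex.I))) θ h ((hasDerivAt_exp_neg_mul_I θ).const_mul z)
  refine h2.congr_deriv ?_
  simp only [wirtingerCLM_apply, map_mul, map_neg, Complex.conj_I]
  ring

lemma exp_neg_two_pi_mul_I :
    Complex.exp (-(((2 * Real.pi : ℝ) : ℂ) * Complex.I)) = 1 := by
  rw [Complex.exp_neg]
  push_cast
  rw [Complex.exp_two_pi_mul_I, inv_one]

/-- Integration by parts in the convolution. -/
lemma circleTransform_angular {F : ℂ → ℂ} (hF : ContDiffOn ℝ 1 F unitDisc) {g : ℝ → ℂ}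
    (hg : AbsolutelyContinuousOnInterval g 0 (2 * Real.pi)) (hper : g 0 = g (2 * Real.pi)) {z : ℂ}
    (hz : z ∈ unitDisc) :
    circleTransform (fun z => z * dz F z - starRingEnd ℂ z * dzbar F z) g z =
      circleTransform F (fun θ => -Complex.I * deriv g θ) z := by
  have hF' : ContDiffOn ℝ ((0 : ℕ) + 1) F unitDisc := by simpa using hF
  have hc : ContinuousOn (fun z => z * dz F z - starRingEnd ℂ z * dzbar F z) unitDisc :=
    (continuousOn_id.mul hF'.dz.continuousOn).sub
      (Complex.continuous_conj.continuousOn.mul hF'.dzbar.continuousOn)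
  have key := hg.complex_integral_deriv_mul
    (q := fun θ : ℝ => F (z * Complex.exp (-(θ * Complex.I))))
    (fun θ => ((hF.differentiableAt_unitDisc one_ne_zero
      (rotate_mem_unitDisc hz θ)).hasWirtingerAt).hasDerivAt_rotate)
    (continuous_const.mul (hc.comp_rotate hz))
  -- Both factors take the same values at 0 and 2π, so the boundary terms cancel.
  rw [exp_neg_two_pi_mul_I] at key
  simp only [Complex.ofReal_zero, zero_mul, neg_zero, Complex.exp_zero, hper, sub_self,
    zero_sub, mul_assoc] at key
  rw [intervalIntegral.integral_const_mul] at key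
  simp only [circleTransform]
  congr 1
  simp only [mul_left_comm _ (-Complex.I)]
  rw [intervalIntegral.integral_const_mul]
  simp only [mul_assoc] at key ⊢
  linear_combination Complex.I * key + (∫ θ in (0 : ℝ)..2 * Real.pi,
    (z * (Complex.exp (-(θ * Complex.I)) * dz F (z * Complex.exp (-(θ * Complex.I)))) -
      starRingEnd ℂ (z * Complex.exp (-(θ * Complex.I))) *
        dzbar F (z * Complex.exp (-(θ * Complex.I)))) * g θ) * Complex.I_sq

lemma norm_circleTransform_le (F : ℂ → ℂ) (g : ℝ → ℂ) (z : ℂ) :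
    ‖circleTransform F g z‖ ≤ (1 / (2 * Real.pi)) * ∫ θ in (0 : ℝ)..(2 * Real.pi),
      ‖F (z * Complex.exp (-(θ * Complex.I)))‖ * ‖g θ‖ := by
  rw [circleTransform, norm_mul]
  have h1 : ‖(1 / (2 * (Real.pi : ℂ)))‖ = 1 / (2 * Real.pi) := by
    rw [show (1 / (2 * (Real.pi : ℂ))) = ((1 / (2 * Real.pi) : ℝ) : ℂ) by push_cast; rfl,
      Complex.norm_real, Real.norm_of_nonneg (by positivity)]
  rw [h1]
  refine mul_le_mul_of_nonneg_left ?_ (by positivity)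
  refine (intervalIntegral.norm_integral_le_integral_norm (by positivity)).trans_eq ?_
  simp only [norm_mul]

lemma continuousOn_majorant (α β : ℝ) : ContinuousOn (majorant α β) unitDisc :=
  ((contDiffOn_kernelQ α β (n := 0)).continuousOn.norm).congr fun _ hz =>
    (norm_kernelQ α β hz).symm

lemma circle_exp_two_pi_eq : Circle.exp (2 * Real.pi) = Circle.exp 0 := by simp

/-- The pointwise estimate behind the mean estimates. -/
lemma norm_mul_dz_abPoissonIntegral_le (α β : ℝ) {f : Circle → ℂ} (hf : CircleAbsCont f) {z : ℂ}
    (hz : z ∈ unitDisc) :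
    ‖z * dz (abPoissonIntegral α β f) z‖ ≤ (1 / (2 * Real.pi)) * ∫ θ in (0 : ℝ)..(2 * Real.pi),
      majorant α β (z * Complex.exp (-(θ * Complex.I))) *
        (‖angularDeriv f θ‖ + |β| * ‖f (Circle.exp θ)‖) := by
  have hfi : IntervalIntegrable (fun θ : ℝ => f (Circle.exp θ)) volume 0 (2 * Real.pi) :=
    hf.continuousOn.intervalIntegrable
  have hdi : IntervalIntegrable (angularDeriv f) volume 0 (2 * Real.pi) :=
    hf.complex_intervalIntegrable_deriv
  have hQ : ContDiffOn ℝ ((0 : ℕ) + 1) (kernelQ α β) unitDisc := contDiffOn_kernelQ α β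
  have hQ1 : ContDiffOn ℝ 1 (kernelQ α β) unitDisc := contDiffOn_kernelQ α β
  have hc : ContinuousOn (fun z => z * dz (kernelQ α β) z -
      starRingEnd ℂ z * dzbar (kernelQ α β) z) unitDisc :=
    (continuousOn_id.mul hQ.dz.continuousOn).sub
      (Complex.continuous_conj.continuousOn.mul hQ.dzbar.continuousOn)
  have hR : ContinuousOn (kernelR α β) unitDisc := (contDiffOn_kernelR α β (n := 0)).continuousOn
  -- The derivative is now the transform of `kernelQ` against -i times the angular derivative, plus
  -- β times the transform of `kernelR` against f.
  rw [abPoissonIntegral_eq_circleTransform,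
    dz_circleTransform (contDiffOn_abPoissonKernel α β) hfi hz, mul_circleTransform,
    circleTransform_congr (fun z hz => mul_dz_abPoissonKernel α β hz) _ hz,
    circleTransform_add hc (hR.const_mul _) hfi hz,
    circleTransform_angular hQ1 hf (by rw [circle_exp_two_pi_eq]) hz,
    circleTransform_const_mul]
  refine (norm_add_le _ _).trans ?_
  rw [norm_mul, Complex.norm_real, Real.norm_eq_abs]
  have hm := (continuousOn_majorant α β).comp_continuous
    (f := fun θ : ℝ => z * Complex.exp (-(θ * Complex.I))) (by fun_prop)
    fun θ => rotate_mem_unitDisc hz θ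
  have i1 : IntervalIntegrable (fun θ : ℝ => majorant α β (z * Complex.exp (-(θ * Complex.I))) *
      ‖angularDeriv f θ‖) volume 0 (2 * Real.pi) := hdi.norm.continuousOn_mul hm.continuousOn
  have i2 : IntervalIntegrable (fun θ : ℝ => majorant α β (z * Complex.exp (-(θ * Complex.I))) *
      ‖f (Circle.exp θ)‖) volume 0 (2 * Real.pi) := hfi.norm.continuousOn_mul hm.continuousOn
  have e1 : (1 / (2 * Real.pi)) * ∫ θ in (0 : ℝ)..(2 * Real.pi),
      majorant α β (z * Complex.exp (-(θ * Complex.I))) *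
        (‖angularDeriv f θ‖ + |β| * ‖f (Circle.exp θ)‖) =
      (1 / (2 * Real.pi)) * (∫ θ in (0 : ℝ)..(2 * Real.pi),
        majorant α β (z * Complex.exp (-(θ * Complex.I))) * ‖angularDeriv f θ‖) +
      |β| * ((1 / (2 * Real.pi)) * ∫ θ in (0 : ℝ)..(2 * Real.pi),
        majorant α β (z * Complex.exp (-(θ * Complex.I))) * ‖f (Circle.exp θ)‖) := by
    simp only [mul_add, mul_left_comm _ |β|]
    rw [intervalIntegral.integral_add i1 (i2.const_mul _), intervalIntegral.integral_const_mul]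
    ring
  rw [e1]
  refine add_le_add ?_ (mul_le_mul_of_nonneg_left ?_ (abs_nonneg β))
  · refine (norm_circleTransform_le _ _ _).trans_eq ?_
    simp only [norm_kernelQ α β (rotate_mem_unitDisc hz _), norm_mul, norm_neg, Complex.norm_I,
      one_mul]
    rfl
  · refine (norm_circleTransform_le _ _ _).trans ?_
    refine mul_le_mul_of_nonneg_left ?_ (by positivity)
    refine intervalIntegral.integral_mono_on (by positivity)
      (hfi.norm.continuousOn_mul (hR.norm.comp_continuous (by fun_prop)
        fun θ => rotate_mem_unitDisc hz θ).continuousOn) i2 fun θ _ => ?_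
    exact mul_le_mul_of_nonneg_right (norm_kernelR_le α β (rotate_mem_unitDisc hz θ))
      (norm_nonneg _)

/-! ### Conjugation symmetry -/

lemma conj_circleTransform (F : ℂ → ℂ) (g : ℝ → ℂ) (z : ℂ) :
    starRingEnd ℂ (circleTransform F g z) =
      circleTransform (fun z => starRingEnd ℂ (F z)) (fun θ => starRingEnd ℂ (g θ)) z := by
  rw [circleTransform, circleTransform, map_mul, ← intervalIntegral.intervalIntegral_conj]
  congr 1
  · simp [Complex.conj_ofNat]
  · simp only [map_mul]

lemma conj_abPoissonIntegral (α β : ℝ) (f : Circle → ℂ) {z : ℂ} (hz : z ∈ unitDisc) :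
    starRingEnd ℂ (abPoissonIntegral α β f z) =
      abPoissonIntegral β α (fun w => starRingEnd ℂ (f w)) z := by
  rw [abPoissonIntegral_eq_circleTransform, conj_circleTransform]
  exact circleTransform_congr (fun z hz => conj_abPoissonKernel α β hz) _ hz

lemma conj_dzbar {u : ℂ → ℂ} {z : ℂ} (hu : DifferentiableAt ℝ u z) :
    starRingEnd ℂ (dzbar u z) = dz (fun z => starRingEnd ℂ (u z)) z :=
  (hu.hasWirtingerAt.conj).dz_eq.symm

lemma conj_dzbar_abPoissonIntegral (α β : ℝ) {f : Circle → ℂ}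
    (hf : IntervalIntegrable (fun θ : ℝ => f (Circle.exp θ)) volume 0 (2 * Real.pi)) {z : ℂ}
    (hz : z ∈ unitDisc) :
    starRingEnd ℂ (dzbar (abPoissonIntegral α β f) z) =
      dz (abPoissonIntegral β α fun w => starRingEnd ℂ (f w)) z := by
  rw [conj_dzbar ((isABHarmonic_abPoissonIntegral α β hf).1.differentiableAt_unitDisc
    two_ne_zero hz)]
  exact dz_congr (fun z hz => conj_abPoissonIntegral α β f hz) hz

lemma CircleAbsCont.conj {f : Circle → ℂ} (hf : CircleAbsCont f) :
    CircleAbsCont fun w => starRingEnd ℂ (f w) :=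
  Complex.isometry_conj.lipschitz.comp_absolutelyContinuousOnInterval hf

lemma angularDeriv_conj (f : Circle → ℂ) (θ : ℝ) :
    angularDeriv (fun w => starRingEnd ℂ (f w)) θ = starRingEnd ℂ (angularDeriv f θ) := by
  exact deriv.star

/-! ### Young's inequality on the circle -/

/-- Schur's test for a positive kernel whose two marginals are constant. -/
lemma eLpNorm_lintegral_kernel_le {X : Type*} [MeasurableSpace X] {μ : Measure X} [SFinite μ]
    {k : X → X → ℝ≥0∞} (hk : Measurable (Function.uncurry k)) {A : ℝ≥0∞}
    (h1 : ∀ x, ∫⁻ y, k x y ∂μ = A) (h2 : ∀ y, ∫⁻ x, k x y ∂μ = A) {g : X → ℝ}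
    (hg : AEStronglyMeasurable g μ) {p : ℝ≥0∞} (hp : 1 ≤ p) :
    eLpNorm (fun x => ∫⁻ y, k x y * ‖g y‖ₑ ∂μ) p μ ≤ A * eLpNorm g p μ := by
  have hkx : ∀ x, Measurable (k x) := fun x => hk.of_uncurry_left
  have hν : ∀ x, (μ.withDensity (k x)) univ = A := fun x => by
    rw [withDensity_apply _ MeasurableSet.univ, Measure.restrict_univ, h1]
  -- Hölder's inequality for the measure with density `k x`, whose total mass is `A`.
  have hF : ∀ x, ∫⁻ y, k x y * ‖g y‖ₑ ∂μ ≤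
      eLpNorm g p (μ.withDensity (k x)) * A ^ (1 - 1 / p.toReal) := by
    intro x
    have hg' : AEStronglyMeasurable g (μ.withDensity (k x)) :=
      hg.mono_ac (withDensity_absolutelyContinuous _ _)
    have := eLpNorm_le_eLpNorm_mul_rpow_measure_univ hp hg'
    rw [hν, ENNReal.toReal_one, div_one, eLpNorm_one_eq_lintegral_enorm,
      lintegral_withDensity_eq_lintegral_mul₀ (hkx x).aemeasurable hg.enorm] at this
    exact this
  rcases eq_or_ne p ∞ with rfl | hptop
  · have hle : ∀ x, ∫⁻ y, k x y * ‖g y‖ₑ ∂μ ≤ A * eLpNorm g ∞ μ := by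
      intro x
      refine (hF x).trans ?_
      -- At p = ∞ the conventions `∞.toReal = 0` and `1 / 0 = 0` make the exponent of `A` equal to
      -- 1, as wanted.
      rw [ENNReal.toReal_top, div_zero, sub_zero, ENNReal.rpow_one, mul_comm,
        eLpNorm_exponent_top, eLpNorm_exponent_top]
      exact mul_le_mul_right (eLpNormEssSup_mono_measure _ (withDensity_absolutelyContinuous _ _)) A
    rw [eLpNorm_exponent_top (f := fun x => ∫⁻ y, k x y * ‖g y‖ₑ ∂μ)]
    exact essSup_le_of_ae_le _ (Filter.Eventually.of_forall hle)
  have hp0 : p ≠ 0 := (zero_lt_one.trans_le hp).ne'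
  have hP : 1 ≤ p.toReal := by
    rw [← ENNReal.toReal_one]; exact ENNReal.toReal_mono hptop hp
  have hP0 : 0 < p.toReal := by linarith
  set P := p.toReal with hPdef
  have hF2 : ∀ x, ‖∫⁻ y, k x y * ‖g y‖ₑ ∂μ‖ₑ ^ P ≤
      A ^ (P - 1) * ∫⁻ y, k x y * ‖g y‖ₑ ^ P ∂μ := by
    intro x
    rw [enorm_eq_self]
    refine (ENNReal.rpow_le_rpow (hF x) hP0.le).trans_eq ?_
    rw [eLpNorm_eq_lintegral_rpow_enorm_toReal hp0 hptop,
      lintegral_withDensity_eq_lintegral_mul₀ (hkx x).aemeasurable (hg.enorm.pow_const _),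
      ENNReal.mul_rpow_of_nonneg _ _ hP0.le, ← ENNReal.rpow_mul, ← ENNReal.rpow_mul, ← hPdef,
      one_div_mul_cancel hP0.ne', ENNReal.rpow_one, mul_comm]
    congr 2
    field_simp
  rw [eLpNorm_eq_lintegral_rpow_enorm_toReal hp0 hptop,
    eLpNorm_eq_lintegral_rpow_enorm_toReal hp0 hptop, ← hPdef]
  have hmeas : AEMeasurable (Function.uncurry fun x y => k x y * ‖g y‖ₑ ^ P) (μ.prod μ) :=
    hk.aemeasurable.mul ((hg.enorm.pow_const P).comp_quasiMeasurePreserving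
      Measure.quasiMeasurePreserving_snd)
  -- After Tonelli the other marginal supplies one more factor `A`, completing `A ^ (P - 1)` to `A ^
  -- P`.
  have hint : ∫⁻ x, ‖∫⁻ y, k x y * ‖g y‖ₑ ∂μ‖ₑ ^ P ∂μ ≤ A ^ P * ∫⁻ y, ‖g y‖ₑ ^ P ∂μ := by
    calc ∫⁻ x, ‖∫⁻ y, k x y * ‖g y‖ₑ ∂μ‖ₑ ^ P ∂μ
        ≤ ∫⁻ x, A ^ (P - 1) * ∫⁻ y, k x y * ‖g y‖ₑ ^ P ∂μ ∂μ := lintegral_mono hF2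
      _ = A ^ (P - 1) * ∫⁻ x, ∫⁻ y, k x y * ‖g y‖ₑ ^ P ∂μ ∂μ :=
          lintegral_const_mul'' _ hmeas.lintegral_prod_right'
      _ = A ^ (P - 1) * ∫⁻ y, ∫⁻ x, k x y * ‖g y‖ₑ ^ P ∂μ ∂μ := by
          rw [lintegral_lintegral_swap hmeas]
      _ = A ^ (P - 1) * ∫⁻ y, A * ‖g y‖ₑ ^ P ∂μ := by
          congr 2
          funext y
          rw [lintegral_mul_const _ hk.of_uncurry_right, h2]
      _ = A ^ P * ∫⁻ y, ‖g y‖ₑ ^ P ∂μ := by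
          rw [lintegral_const_mul'' _ (hg.enorm.pow_const P), ← mul_assoc]
          congr 1
          calc A ^ (P - 1) * A = A ^ (P - 1) * A ^ (1 : ℝ) := by rw [ENNReal.rpow_one]
            _ = A ^ P := by
              rw [← ENNReal.rpow_add_of_nonneg _ _ (by linarith) zero_le_one, sub_add_cancel]
  refine (ENNReal.rpow_le_rpow hint (by positivity)).trans_eq ?_
  rw [ENNReal.mul_rpow_of_nonneg _ _ (by positivity), ← ENNReal.rpow_mul,
    mul_one_div_cancel hP0.ne', ENNReal.rpow_one]

instance : IsFiniteMeasure angleMeasure := by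
  unfold angleMeasure
  exact Measure.smul_finite _ ENNReal.ofReal_ne_top

lemma integral_angleMeasure (h : ℝ → ℝ) :
    ∫ θ, h θ ∂angleMeasure = (1 / (2 * Real.pi)) * ∫ θ in (0 : ℝ)..(2 * Real.pi), h θ := by
  rw [angleMeasure, integral_smul_measure, intervalIntegral.integral_of_le (by positivity),
    ENNReal.toReal_ofReal (by positivity), smul_eq_mul]

lemma integrable_angleMeasure {E : Type*} [NormedAddCommGroup E] {h : ℝ → E}
    (hh : IntervalIntegrable h volume 0 (2 * Real.pi)) :
    Integrable h angleMeasure :=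
  Integrable.smul_measure ((intervalIntegrable_iff_integrableOn_Ioc_of_le (by positivity)).1 hh)
    ENNReal.ofReal_ne_top

lemma lintegral_angleMeasure_ofReal {h : ℝ → ℝ}
    (hh : IntervalIntegrable h volume 0 (2 * Real.pi)) (h0 : ∀ θ, 0 ≤ h θ) :
    ∫⁻ θ, ENNReal.ofReal (h θ) ∂angleMeasure =
      ENNReal.ofReal ((1 / (2 * Real.pi)) * ∫ θ in (0 : ℝ)..(2 * Real.pi), h θ) := by
  rw [← integral_angleMeasure, ofReal_integral_eq_lintegral_ofReal (integrable_angleMeasure hh)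
    (Filter.Eventually.of_forall h0)]

/-- Young's inequality `‖k * g‖_p ≤ ‖k‖_1 ‖g‖_p` for a continuous kernel on the circle. -/
lemma eLpNorm_circle_convolution_le {k : ℝ → ℝ} (hk : Continuous k) (hk0 : ∀ t, 0 ≤ k t)
    (hper : Function.Periodic k (2 * Real.pi)) {g : ℝ → ℝ}
    (hg : AEStronglyMeasurable g angleMeasure) {p : ℝ≥0∞} (hp : 1 ≤ p) :
    eLpNorm (fun φ => ∫⁻ θ, ENNReal.ofReal (k (φ - θ)) * ‖g θ‖ₑ ∂angleMeasure) p angleMeasure ≤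
      ENNReal.ofReal ((1 / (2 * Real.pi)) * ∫ θ in (0 : ℝ)..(2 * Real.pi), k θ) *
        eLpNorm g p angleMeasure := by
  refine eLpNorm_lintegral_kernel_le (k := fun φ θ => ENNReal.ofReal (k (φ - θ))) ?_ ?_ ?_ hg hp
  · exact (ENNReal.continuous_ofReal.comp
      (hk.comp (continuous_fst.sub continuous_snd))).measurable
  · intro φ
    have hc : Continuous fun θ => k (φ - θ) := hk.comp (continuous_const.sub continuous_id)
    rw [lintegral_angleMeasure_ofReal (hc.intervalIntegrable _ _) fun θ => hk0 _,
      intervalIntegral.integral_comp_sub_left]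
    have := hper.intervalIntegral_add_eq (φ - 2 * Real.pi) 0
    simp only [sub_add_cancel, zero_add] at this
    rw [sub_zero, this]
  · intro θ
    have hc : Continuous fun φ => k (φ - θ) := hk.comp (continuous_id.sub continuous_const)
    rw [lintegral_angleMeasure_ofReal (hc.intervalIntegrable _ _) fun θ => hk0 _,
      intervalIntegral.integral_comp_sub_right k]
    have := hper.intervalIntegral_add_eq (0 - θ) 0
    rw [zero_add, show 0 - θ + 2 * Real.pi = 2 * Real.pi - θ by ring] at this
    rw [this]

/-! ### The mean estimates -/

lemma ofReal_mul_exp_mem_unitDisc {r : ℝ} (hr : r ∈ Ico (0 : ℝ) 1) (φ : ℝ) :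
    (r : ℂ) * Complex.exp (φ * Complex.I) ∈ unitDisc := by
  rw [mem_unitDisc, norm_mul, Complex.norm_exp_ofReal_mul_I, mul_one, Complex.norm_real,
    Real.norm_of_nonneg hr.1]
  exact hr.2

lemma norm_ofReal_mul_exp {r : ℝ} (hr : 0 ≤ r) (φ : ℝ) :
    ‖(r : ℂ) * Complex.exp (φ * Complex.I)‖ = r := by
  rw [norm_mul, Complex.norm_exp_ofReal_mul_I, mul_one, Complex.norm_real, Real.norm_of_nonneg hr]

lemma majorant_nonneg (α β : ℝ) {z : ℂ} (hz : z ∈ unitDisc) : 0 ≤ majorant α β z := by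
  rw [← norm_kernelQ α β hz]; exact norm_nonneg _

lemma integral_majorant (α β : ℝ) {r : ℝ} (hr : r ∈ Ico (0 : ℝ) 1) :
    (1 / (2 * Real.pi)) * ∫ t in (0 : ℝ)..(2 * Real.pi),
      majorant α β ((r : ℂ) * Complex.exp (t * Complex.I)) =
      |cAB α β| * integralI (α + β) r := by
  rw [integralI, mul_left_comm |cAB α β|, ← intervalIntegral.integral_const_mul |cAB α β|]
  congr 2
  funext t
  rw [majorant, norm_ofReal_mul_exp hr.1]
  have : ‖1 - (r : ℂ) * Complex.exp (t * Complex.I)‖ =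
      ‖1 - (r : ℂ) * Complex.exp (-(t * Complex.I))‖ := by
    rw [← Complex.norm_conj, map_sub, map_mul, map_one, Complex.conj_ofReal,
      ← conj_exp_neg_mul_I, Complex.conj_conj]
  rw [this]

lemma meanP_mul_dz_le (α β : ℝ) {f : Circle → ℂ} (hf : CircleAbsCont f) {p : ℝ≥0∞} (hp : 1 ≤ p)
    {r : ℝ} (hr : r ∈ Ico (0 : ℝ) 1) :
    meanP p r (fun z => z * dz (abPoissonIntegral α β f) z) ≤
      ENNReal.ofReal (|cAB α β| * integralI (α + β) r) *
        (eLpNorm (angularDeriv f) p angleMeasure + ENNReal.ofReal |β| * circleNorm p f) := by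
  have hfi : IntervalIntegrable (fun θ : ℝ => f (Circle.exp θ)) volume 0 (2 * Real.pi) :=
    hf.continuousOn.intervalIntegrable
  have hdi : IntervalIntegrable (angularDeriv f) volume 0 (2 * Real.pi) :=
    hf.complex_intervalIntegrable_deriv
  set k : ℝ → ℝ := fun t => majorant α β ((r : ℂ) * Complex.exp (t * Complex.I)) with hk
  set g : ℝ → ℝ := fun θ => ‖angularDeriv f θ‖ + |β| * ‖f (Circle.exp θ)‖ with hg
  have hgi : IntervalIntegrable g volume 0 (2 * Real.pi) := hdi.norm.add (hfi.norm.const_mul _)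
  have hkc : Continuous k := (continuousOn_majorant α β).comp_continuous (by fun_prop)
    fun t => ofReal_mul_exp_mem_unitDisc hr t
  have hk0 : ∀ t, 0 ≤ k t := fun t => majorant_nonneg α β (ofReal_mul_exp_mem_unitDisc hr t)
  have hper : Function.Periodic k (2 * Real.pi) := by
    intro t
    simp only [hk]
    push_cast
    rw [add_mul, Complex.exp_add, Complex.exp_two_pi_mul_I, mul_one]
  have hpt : ∀ φ : ℝ, ‖(r : ℂ) * Complex.exp (φ * Complex.I) *
      dz (abPoissonIntegral α β f) ((r : ℂ) * Complex.exp (φ * Complex.I))‖ₑ ≤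
      ∫⁻ θ, ENNReal.ofReal (k (φ - θ)) * ‖g θ‖ₑ ∂angleMeasure := by
    intro φ
    have h1 := norm_mul_dz_abPoissonIntegral_le α β hf (ofReal_mul_exp_mem_unitDisc hr φ)
    -- On a fixed circle the rotated argument depends only on φ - θ, so the pointwise estimate is a
    -- convolution.
    have h2 : ∀ θ : ℝ, (r : ℂ) * Complex.exp (φ * Complex.I) * Complex.exp (-(θ * Complex.I)) =
        (r : ℂ) * Complex.exp ((φ - θ : ℝ) * Complex.I) := by
      intro θ
      rw [mul_assoc, ← Complex.exp_add]
      congr 2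
      push_cast
      ring
    simp only [h2] at h1
    have h3 : IntervalIntegrable (fun θ => k (φ - θ) * g θ) volume 0 (2 * Real.pi) :=
      hgi.continuousOn_mul (hkc.comp (continuous_const.sub continuous_id)).continuousOn
    have h4 : ∀ θ, 0 ≤ g θ := fun θ => by positivity
    rw [← ofReal_norm]
    refine (ENNReal.ofReal_le_ofReal h1).trans_eq ?_
    rw [← lintegral_angleMeasure_ofReal h3 fun θ => mul_nonneg (hk0 _) (h4 θ)]
    refine lintegral_congr fun θ => ?_
    rw [ENNReal.ofReal_mul (hk0 _), Real.enorm_eq_ofReal (h4 θ)]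
  have hgle : eLpNorm g p angleMeasure ≤
      eLpNorm (angularDeriv f) p angleMeasure + ENNReal.ofReal |β| * circleNorm p f := by
    have hd := (integrable_angleMeasure hdi).aestronglyMeasurable
    have hff := (integrable_angleMeasure hfi).aestronglyMeasurable
    refine (eLpNorm_add_le hd.norm (hff.norm.const_mul _) hp).trans_eq ?_
    rw [eLpNorm_norm, circleNorm]
    congr 1
    have := eLpNorm_const_smul |β| (fun θ : ℝ => ‖f (Circle.exp θ)‖) p angleMeasure
    rw [eLpNorm_norm, Real.enorm_eq_ofReal (abs_nonneg β)] at this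
    exact this
  rw [meanP]
  refine (eLpNorm_mono_enorm (fun φ => (hpt φ).trans_eq (enorm_eq_self _).symm)).trans ?_
  refine (eLpNorm_circle_convolution_le hkc hk0 hper
    (integrable_angleMeasure hgi).aestronglyMeasurable hp).trans ?_
  rw [integral_majorant α β hr]
  gcongr

lemma eLpNorm_starRingEnd {X : Type*} [MeasurableSpace X] (h : X → ℂ) (p : ℝ≥0∞) (μ : Measure X) :
    eLpNorm (fun x => starRingEnd ℂ (h x)) p μ = eLpNorm h p μ :=
  eLpNorm_congr_norm_ae (Filter.Eventually.of_forall fun _ => Complex.norm_conj _)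

lemma meanP_congr_norm {p : ℝ≥0∞} {r : ℝ} (hr : r ∈ Ico (0 : ℝ) 1) {u v : ℂ → ℂ}
    (h : ∀ z ∈ unitDisc, ‖u z‖ = ‖v z‖) : meanP p r u = meanP p r v :=
  eLpNorm_congr_norm_ae (Filter.Eventually.of_forall fun φ =>
    h _ (ofReal_mul_exp_mem_unitDisc hr φ))

lemma norm_dzbar_abPoissonIntegral (α β : ℝ) {f : Circle → ℂ} (hf : CircleAbsCont f) {z : ℂ}
    (hz : z ∈ unitDisc) :
    ‖dzbar (abPoissonIntegral α β f) z‖ =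
      ‖dz (abPoissonIntegral β α fun w => starRingEnd ℂ (f w)) z‖ := by
  rw [← conj_dzbar_abPoissonIntegral α β hf.continuousOn.intervalIntegrable hz, Complex.norm_conj]

lemma cAB_comm (α β : ℝ) : cAB α β = cAB β α := by
  rw [cAB, cAB, mul_comm (Real.Gamma (β + 1)), add_comm α β]

lemma eLpNorm_angularDeriv_conj (f : Circle → ℂ) (p : ℝ≥0∞) :
    eLpNorm (angularDeriv fun w => starRingEnd ℂ (f w)) p angleMeasure =
      eLpNorm (angularDeriv f) p angleMeasure := by
  rw [show angularDeriv (fun w => starRingEnd ℂ (f w)) = fun θ => starRingEnd ℂ (angularDeriv f θ)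
    from funext (angularDeriv_conj f), eLpNorm_starRingEnd]

lemma circleNorm_conj (f : Circle → ℂ) (p : ℝ≥0∞) :
    circleNorm p (fun w => starRingEnd ℂ (f w)) = circleNorm p f :=
  eLpNorm_starRingEnd _ _ _

lemma meanP_conj_mul_dzbar_le (α β : ℝ) {f : Circle → ℂ} (hf : CircleAbsCont f) {p : ℝ≥0∞}
    (hp : 1 ≤ p) {r : ℝ} (hr : r ∈ Ico (0 : ℝ) 1) :
    meanP p r (fun z => starRingEnd ℂ z * dzbar (abPoissonIntegral α β f) z) ≤
      ENNReal.ofReal (|cAB α β| * integralI (α + β) r) *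
        (eLpNorm (angularDeriv f) p angleMeasure + ENNReal.ofReal |α| * circleNorm p f) := by
  rw [meanP_congr_norm (v := fun z => z * dz (abPoissonIntegral β α
    fun w => starRingEnd ℂ (f w)) z) hr fun z hz => by
      rw [norm_mul, norm_mul, Complex.norm_conj, norm_dzbar_abPoissonIntegral α β hf hz],
    ← circleNorm_conj, ← eLpNorm_angularDeriv_conj, cAB_comm, add_comm α β]
  exact meanP_mul_dz_le β α hf.conj hp hr

/-! ### The integral `I_λ` -/

/-- `|1 - r e^{it}|²`. -/
noncomputable def chordSq (r t : ℝ) : ℝ := 1 - 2 * r * Real.cos t + r ^ 2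

lemma continuous_chordSq : Continuous fun p : ℝ × ℝ => chordSq p.1 p.2 := by
  unfold chordSq; fun_prop

lemma chordSq_pos {r : ℝ} (h0 : -1 < r) (h1 : r < 1) (t : ℝ) : 0 < chordSq r t := by
  unfold chordSq
  have := Real.cos_le_one t
  have := Real.neg_one_le_cos t
  by_cases h : 0 ≤ r <;> nlinarith [sq_pos_of_pos (sub_pos.2 h1), sq_pos_of_pos (neg_lt_iff_pos_add'.1 h0)]

lemma chordSq_pos' (r : ℝ) {t : ℝ} (ht : t ∈ Ioo 0 Real.pi) : 0 < chordSq r t := by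
  unfold chordSq
  have := Real.sin_pos_of_mem_Ioo ht
  nlinarith [Real.sin_sq_add_cos_sq t, sq_nonneg (r - Real.cos t), sq_pos_of_pos this]

lemma norm_one_sub_mul_exp_sq (r t : ℝ) :
    ‖1 - (r : ℂ) * Complex.exp (-(t * Complex.I))‖ ^ 2 = chordSq r t := by
  rw [← Complex.normSq_eq_norm_sq, ← neg_mul, ← Complex.ofReal_neg, Complex.exp_mul_I,
    ← Complex.ofReal_cos, ← Complex.ofReal_sin, Complex.normSq_apply, chordSq]
  simp [-Complex.ofReal_cos, -Complex.ofReal_sin]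
  nlinarith [Real.sin_sq_add_cos_sq t]

/-- The substitution exchanging `|1 - r e^{it}|²` and `(1 - r²)² / |1 - r e^{it}|²`. -/
lemma integral_chordSq_inversion {r : ℝ} (h0 : -1 < r) (h1 : r < 1) (F : ℝ → ℝ) :
    ∫ t in Ioo 0 Real.pi, F (chordSq r t) =
      ∫ t in Ioo 0 Real.pi, (1 - r ^ 2) / chordSq r t * F ((1 - r ^ 2) ^ 2 / chordSq r t) := by
  have hd : 0 < 1 - r ^ 2 := by nlinarith
  -- `X t` is the real part of (r - e^{it})/(1 - re^{it}), the involutive automorphism of the disc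
  -- exchanging 0 and r. The angle `τ` is thus an involution of (0, π), and its derivative is minus
  -- the Poisson kernel (1-r²)/|1-re^{it}|².
  set X : ℝ → ℝ := fun t => (2 * r - (1 + r ^ 2) * Real.cos t) / chordSq r t with hX
  have hq : ∀ t, 0 < chordSq r t := chordSq_pos h0 h1
  have hX2 : ∀ t, 1 - X t ^ 2 = ((1 - r ^ 2) * Real.sin t / chordSq r t) ^ 2 := by
    intro t
    have := (hq t).ne'
    rw [hX, div_pow, div_pow, mul_pow, Real.sin_sq]
    field_simp
    unfold chordSq
    ring
  have hXm : ∀ t ∈ Ioo 0 Real.pi, -1 < X t ∧ X t < 1 := by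
    intro t ht
    have hs := Real.sin_pos_of_mem_Ioo ht
    have h2 : 0 < 1 - X t ^ 2 := by
      rw [hX2]
      have := hq t
      positivity
    constructor <;> nlinarith
  set τ : ℝ → ℝ := fun t => Real.arccos (X t) with hτ
  have hcos : ∀ t ∈ Ioo 0 Real.pi, Real.cos (τ t) = X t := fun t ht =>
    Real.cos_arccos (hXm t ht).1.le (hXm t ht).2.le
  have hmaps : MapsTo τ (Ioo 0 Real.pi) (Ioo 0 Real.pi) := by
    intro t ht
    refine ⟨Real.arccos_pos.2 (hXm t ht).2, lt_of_le_of_ne (Real.arccos_le_pi _) fun h => ?_⟩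
    rw [Real.arccos_eq_pi] at h
    linarith [(hXm t ht).1]
  have hqτ : ∀ t ∈ Ioo 0 Real.pi, chordSq r (τ t) = (1 - r ^ 2) ^ 2 / chordSq r t := by
    intro t ht
    have := (hq t).ne'
    rw [chordSq, hcos t ht, hX]
    field_simp
    unfold chordSq
    ring
  have hinv : ∀ t ∈ Ioo 0 Real.pi, τ (τ t) = t := by
    intro t ht
    have : X (τ t) = Real.cos t := by
      have h1 := (hq t).ne'
      simp only [hX]
      rw [hqτ t ht, hcos t ht]
      simp only [hX]
      have h2 := hd.ne'
      field_simp
      unfold chordSq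
      ring
    rw [hτ]
    simp only
    rw [this, Real.arccos_cos ht.1.le ht.2.le]
  have hinj : InjOn τ (Ioo 0 Real.pi) := fun s hs t ht h => by
    rw [← hinv s hs, ← hinv t ht, h]
  have himg : τ '' Ioo 0 Real.pi = Ioo 0 Real.pi :=
    Subset.antisymm hmaps.image_subset fun t ht => ⟨τ t, hmaps ht, hinv t ht⟩
  have hderiv : ∀ t ∈ Ioo 0 Real.pi,
      HasDerivWithinAt τ (-((1 - r ^ 2) / chordSq r t)) (Ioo 0 Real.pi) t := by
    intro t ht
    have hs := Real.sin_pos_of_mem_Ioo ht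
    have hqt := hq t
    have hqd : HasDerivAt (fun t => chordSq r t) (2 * r * Real.sin t) t := by
      unfold chordSq
      refine (((Real.hasDerivAt_cos t).const_mul (2 * r)).const_sub 1).add_const (r ^ 2)
        |>.congr_deriv ?_
      ring
    have hXd := (((Real.hasDerivAt_cos t).const_mul (1 + r ^ 2)).const_sub (2 * r)).fun_div hqd
      hqt.ne'
    have h := (Real.hasDerivAt_arccos (hXm t ht).1.ne' (hXm t ht).2.ne).comp t hXd
    refine (h.congr_deriv ?_).hasDerivWithinAt
    rw [hX2, Real.sqrt_sq (by positivity)]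
    field_simp
    unfold chordSq
    ring
  have key := integral_image_eq_integral_abs_deriv_smul measurableSet_Ioo hderiv hinj
    fun t => F (chordSq r t)
  rw [himg] at key
  rw [key]
  refine setIntegral_congr_fun measurableSet_Ioo fun t ht => ?_
  have hqt := hq t
  simp only [smul_eq_mul]
  rw [hqτ t ht, abs_neg, abs_of_nonneg (by positivity)]

/-- `∫_0^π |1 - r e^{it}|^{2m} dt`. -/
noncomputable def chordMean (m r : ℝ) : ℝ := ∫ t in (0 : ℝ)..Real.pi, chordSq r t ^ m

lemma continuous_chordSq_rpow {r : ℝ} (h0 : -1 < r) (h1 : r < 1) (m : ℝ) :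
    Continuous fun t => chordSq r t ^ m :=
  (continuous_chordSq.comp (Continuous.prodMk_right r)).rpow_const fun t =>
    Or.inl (chordSq_pos h0 h1 t).ne'

/-- The radial derivative of the means of `|1 - z|^{2m}` is non-negative. -/
lemma integral_chordSq_radial_nonneg {r : ℝ} (h0 : -1 < r) (h1 : r < 1) (m : ℝ) :
    0 ≤ ∫ t in Ioo 0 Real.pi, m * (chordSq r t ^ m * (1 - (1 - r ^ 2) / chordSq r t)) := by
  have hd : 0 < 1 - r ^ 2 := by nlinarith
  have hq : ∀ t, 0 < chordSq r t := chordSq_pos h0 h1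
  set d := 1 - r ^ 2 with hdd
  have e1 := integral_chordSq_inversion h0 h1 fun x => m * (x ^ m * (1 - d / x))
  simp only [← hdd] at e1
  have hc : ∀ n : ℝ, Continuous fun t => chordSq r t ^ n := continuous_chordSq_rpow h0 h1
  have hc1 : Continuous fun t => chordSq r t := by
    simpa using hc 1
  have hc2 : Continuous fun t => 1 - d / chordSq r t :=
    continuous_const.sub (continuous_const.div hc1 fun t => (hq t).ne')
  have hint : ∀ h : ℝ → ℝ, Continuous h → IntegrableOn h (Ioo 0 Real.pi) := fun h hh =>
    (hh.integrableOn_Icc (a := 0) (b := Real.pi)).mono_set Ioo_subset_Icc_self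
  -- With q = |1-re^{it}|² and d = 1-r², the inversion sends q to d²/q with weight d/q. It reverses
  -- the sign of 1 - d/q and replaces q^m by d^(2m) q^(-m).
  have e2 : ∫ t in Ioo 0 Real.pi, m * (chordSq r t ^ m * (1 - d / chordSq r t)) =
      ∫ t in Ioo 0 Real.pi,
        -(m * (d ^ (2 * m) * chordSq r t ^ (-m) * (1 - d / chordSq r t))) := by
    rw [e1]
    refine setIntegral_congr_fun measurableSet_Ioo fun t _ => ?_
    have := hq t
    rw [Real.div_rpow (by positivity) this.le, Real.rpow_neg this.le, Real.rpow_mul hd.le,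
      show d ^ (2 : ℝ) = d ^ 2 by norm_cast]
    have h3 : 0 < chordSq r t ^ m := Real.rpow_pos_of_pos this m
    field_simp
    ring
  -- The sum of the two forms is twice the original integral. It is pointwise non-negative, since
  -- m(q^m - d^(2m) q^(-m)) and 1 - d/q have the same sign, both vanishing at q = d.
  have e3 : 0 ≤ ∫ t in Ioo 0 Real.pi, (m * (chordSq r t ^ m * (1 - d / chordSq r t)) +
      -(m * (d ^ (2 * m) * chordSq r t ^ (-m) * (1 - d / chordSq r t)))) := by
    refine setIntegral_nonneg measurableSet_Ioo fun t _ => ?_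
    have hqt := hq t
    have h3 : 0 < chordSq r t ^ m := Real.rpow_pos_of_pos hqt m
    have e : m * (chordSq r t ^ m * (1 - d / chordSq r t)) +
      -(m * (d ^ (2 * m) * chordSq r t ^ (-m) * (1 - d / chordSq r t))) =
      (m * ((chordSq r t ^ m) ^ 2 - (d ^ m) ^ 2)) * (chordSq r t - d) *
        (chordSq r t ^ m * chordSq r t)⁻¹ := by
      rw [Real.rpow_neg hqt.le, mul_comm 2 m, Real.rpow_mul hd.le,
        show (d ^ m) ^ (2 : ℝ) = (d ^ m) ^ 2 by norm_cast]
      field_simp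
      ring
    rw [e]
    refine mul_nonneg ?_ (by positivity)
    have h4 : 0 < d ^ m := Real.rpow_pos_of_pos hd m
    have e4 : m * ((chordSq r t ^ m) ^ 2 - (d ^ m) ^ 2) * (chordSq r t - d) =
      (m * (chordSq r t ^ m - d ^ m) * (chordSq r t - d)) * (chordSq r t ^ m + d ^ m) := by ring
    rw [e4]
    refine mul_nonneg ?_ (by positivity)
    rcases le_total 0 m with hm | hm
    · rcases le_total d (chordSq r t) with h | h
      · exact mul_nonneg (mul_nonneg hm (sub_nonneg.2 (Real.rpow_le_rpow hd.le h hm)))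
          (sub_nonneg.2 h)
      · exact mul_nonneg_of_nonpos_of_nonpos (mul_nonpos_of_nonneg_of_nonpos hm
          (sub_nonpos.2 (Real.rpow_le_rpow hqt.le h hm))) (sub_nonpos.2 h)
    · rcases le_total d (chordSq r t) with h | h
      · exact mul_nonneg (mul_nonneg_of_nonpos_of_nonpos hm
          (sub_nonpos.2 (Real.rpow_le_rpow_of_nonpos hd h hm))) (sub_nonneg.2 h)
      · exact mul_nonneg_of_nonpos_of_nonpos (mul_nonpos_of_nonpos_of_nonneg hm
          (sub_nonneg.2 (Real.rpow_le_rpow_of_nonpos hqt h hm))) (sub_nonpos.2 h)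
  have c1 : Continuous fun t => m * (chordSq r t ^ m * (1 - d / chordSq r t)) :=
    continuous_const.mul ((hc m).mul hc2)
  have c2 : Continuous fun t =>
      -(m * (d ^ (2 * m) * chordSq r t ^ (-m) * (1 - d / chordSq r t))) :=
    (continuous_const.mul ((continuous_const.mul (hc (-m))).mul hc2)).neg
  rw [integral_add (hint _ c1) (hint _ c2), ← e2] at e3
  linarith

lemma hasDerivAt_chordMean (m : ℝ) {r : ℝ} (h0 : -1 < r) (h1 : r < 1) :
    HasDerivAt (chordMean m)
      (∫ t in (0 : ℝ)..Real.pi, m * chordSq r t ^ (m - 1) * (2 * r - 2 * Real.cos t)) r := by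
  obtain ⟨a, ha0, har⟩ := exists_between h0
  obtain ⟨b, hrb, hb1⟩ := exists_between h1
  have hcont : ContinuousOn (fun p : ℝ × ℝ =>
      m * chordSq p.1 p.2 ^ (m - 1) * (2 * p.1 - 2 * Real.cos p.2))
      (Icc a b ×ˢ Icc 0 Real.pi) := by
    refine ContinuousOn.mul (continuousOn_const.mul
      (continuous_chordSq.continuousOn.rpow_const fun p hp => Or.inl ?_)) (by fun_prop)
    exact (chordSq_pos (ha0.trans_le hp.1.1) (hp.1.2.trans_lt hb1) _).ne'
  obtain ⟨C, hC⟩ := (isCompact_Icc.prod isCompact_Icc).exists_bound_of_continuousOn hcont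
  have hcr : ∀ x ∈ Ioo a b, Continuous fun t => chordSq x t ^ m := fun x hx =>
    continuous_chordSq_rpow (ha0.trans hx.1) (hx.2.trans hb1) m
  refine (intervalIntegral.hasDerivAt_integral_of_dominated_loc_of_deriv_le (μ := volume)
    (F := fun x t => chordSq x t ^ m)
    (F' := fun x t => m * chordSq x t ^ (m - 1) * (2 * x - 2 * Real.cos t))
    (bound := fun _ => C) (Ioo_mem_nhds har hrb) ?_
    ((hcr r ⟨har, hrb⟩).intervalIntegrable _ _) ?_ ?_ intervalIntegrable_const ?_).2
  · filter_upwards [Ioo_mem_nhds har hrb] with x hx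
    exact (hcr x hx).aestronglyMeasurable
  · exact ((continuous_const.mul (continuous_chordSq_rpow h0 h1 _)).mul
      (by fun_prop)).aestronglyMeasurable
  · refine Filter.Eventually.of_forall fun t ht x hx => ?_
    rw [uIoc_of_le Real.pi_pos.le] at ht
    exact hC (x, t) ⟨Ioo_subset_Icc_self hx, Ioc_subset_Icc_self ht⟩
  · refine Filter.Eventually.of_forall fun t ht x hx => ?_
    have hq : HasDerivAt (fun x => chordSq x t) (2 * x - 2 * Real.cos t) x := by
      unfold chordSq
      have h2 := (((hasDerivAt_id x).const_mul 2).mul_const (Real.cos t)).const_sub 1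
      refine (h2.add (hasDerivAt_pow 2 x)).congr_deriv ?_
      simp
      ring
    refine (hq.rpow_const (p := m)
      (Or.inl (chordSq_pos (ha0.trans hx.1) (hx.2.trans hb1) t).ne')).congr_deriv ?_
    ring

/-! #### The value at `r = 1` -/

lemma betaIntegral_ofReal_eq (a b : ℝ) :
    Complex.betaIntegral a b =
      ((∫ x in (0 : ℝ)..1, x ^ (a - 1) * (1 - x) ^ (b - 1) : ℝ) : ℂ) := by
  rw [Complex.betaIntegral, ← intervalIntegral.integral_ofReal]
  refine intervalIntegral.integral_congr fun x hx => ?_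
  rw [uIcc_of_le zero_le_one] at hx
  simp only [Complex.ofReal_mul, Complex.ofReal_cpow hx.1,
    Complex.ofReal_cpow (sub_nonneg.2 hx.2)]
  push_cast
  rfl

lemma intervalIntegral_beta {a b : ℝ} (ha : 0 < a) (hb : 0 < b) :
    ∫ x in (0 : ℝ)..1, x ^ (a - 1) * (1 - x) ^ (b - 1) =
      Real.Gamma a * Real.Gamma b / Real.Gamma (a + b) := by
  have h := Complex.Gamma_mul_Gamma_eq_betaIntegral (s := a) (t := b) (by simpa) (by simpa)
  rw [betaIntegral_ofReal_eq, ← Complex.ofReal_add, Complex.Gamma_ofReal, Complex.Gamma_ofReal,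
    Complex.Gamma_ofReal] at h
  have h2 : Real.Gamma a * Real.Gamma b = Real.Gamma (a + b) *
      ∫ x in (0 : ℝ)..1, x ^ (a - 1) * (1 - x) ^ (b - 1) := by exact_mod_cast h
  rw [h2, mul_div_cancel_left₀ _ (Real.Gamma_pos_of_pos (add_pos ha hb)).ne']

lemma integrableOn_beta {a b : ℝ} (ha : 0 < a) (hb : 0 < b) :
    IntegrableOn (fun x : ℝ => x ^ (a - 1) * (1 - x) ^ (b - 1)) (Ioo 0 1) := by
  have h := (Complex.betaIntegral_convergent (u := a) (v := b) (by simpa) (by simpa)).norm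
  rw [intervalIntegrable_iff_integrableOn_Ioo_of_le zero_le_one] at h
  refine h.congr_fun (fun x hx => ?_) measurableSet_Ioo
  have h1 : ‖(x : ℂ) ^ ((a : ℂ) - 1)‖ = x ^ (a - 1) := by
    rw [Complex.norm_cpow_eq_rpow_re_of_pos hx.1]; simp
  have h2 : ‖(1 - (x : ℂ)) ^ ((b : ℂ) - 1)‖ = (1 - x) ^ (b - 1) := by
    rw [← Complex.ofReal_one, ← Complex.ofReal_sub,
      Complex.norm_cpow_eq_rpow_re_of_pos (sub_pos.2 hx.2)]; simp
  simp only [norm_mul, h1, h2]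

lemma half_one_sub_cos_mem {t : ℝ} (ht : t ∈ Ioo 0 Real.pi) :
    (1 - Real.cos t) / 2 ∈ Ioo (0 : ℝ) 1 := by
  have hs := Real.sin_pos_of_mem_Ioo ht
  have := Real.sin_sq_add_cos_sq t
  constructor <;> nlinarith

lemma image_half_one_sub_cos :
    (fun t => (1 - Real.cos t) / 2) '' Ioo 0 Real.pi = Ioo (0 : ℝ) 1 := by
  refine Subset.antisymm (fun x ⟨t, ht, h⟩ => h ▸ half_one_sub_cos_mem ht) fun x hx => ?_
  refine ⟨Real.arccos (1 - 2 * x), ⟨Real.arccos_pos.2 (by linarith [hx.1]), ?_⟩, ?_⟩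
  · refine lt_of_le_of_ne (Real.arccos_le_pi _) fun h => ?_
    rw [Real.arccos_eq_pi] at h
    linarith [hx.2]
  · simp only
    rw [Real.cos_arccos (by linarith [hx.2]) (by linarith [hx.1])]
    ring

lemma injOn_half_one_sub_cos : InjOn (fun t => (1 - Real.cos t) / 2) (Ioo 0 Real.pi) := by
  intro s hs t ht h
  refine Real.injOn_cos ⟨hs.1.le, hs.2.le⟩ ⟨ht.1.le, ht.2.le⟩ ?_
  simp only at h
  linarith

lemma hasDerivWithinAt_half_one_sub_cos (t : ℝ) (s : Set ℝ) :
    HasDerivWithinAt (fun t => (1 - Real.cos t) / 2) (Real.sin t / 2) s t := by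
  refine ((((Real.hasDerivAt_cos t).const_sub 1).div_const 2).congr_deriv ?_).hasDerivWithinAt
  ring

/-- Under x = (1 - cos t)/2 one has sin t / 2 = √(x(1-x)), so the beta integrand with parameters m +
1/2 and 1/2 becomes x^m; the condition m > -1/2 below is convergence of that beta integral. -/
lemma abs_sin_mul_beta_integrand (m : ℝ) {t : ℝ} (ht : t ∈ Ioo 0 Real.pi) :
    |Real.sin t / 2| * (((1 - Real.cos t) / 2) ^ (m + 1 / 2 - 1) *
      (1 - (1 - Real.cos t) / 2) ^ ((1 / 2 : ℝ) - 1)) = ((1 - Real.cos t) / 2) ^ m := by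
  have hs := Real.sin_pos_of_mem_Ioo ht
  obtain ⟨h0, h1⟩ := half_one_sub_cos_mem ht
  have h1' := sub_pos.2 h1
  set x := (1 - Real.cos t) / 2 with hx
  have hsin : Real.sin t / 2 = x ^ (1 / 2 : ℝ) * (1 - x) ^ (1 / 2 : ℝ) := by
    rw [← Real.mul_rpow h0.le h1'.le, ← Real.sqrt_eq_rpow]
    symm
    rw [Real.sqrt_eq_iff_mul_self_eq (by positivity) (by positivity)]
    nlinarith [Real.sin_sq_add_cos_sq t]
  rw [abs_of_pos (by positivity), hsin]
  calc x ^ (1 / 2 : ℝ) * (1 - x) ^ (1 / 2 : ℝ) * (x ^ (m + 1 / 2 - 1) *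
        (1 - x) ^ ((1 / 2 : ℝ) - 1))
      = (x ^ (1 / 2 : ℝ) * x ^ (m + 1 / 2 - 1)) *
        ((1 - x) ^ (1 / 2 : ℝ) * (1 - x) ^ ((1 / 2 : ℝ) - 1)) := by ring
    _ = x ^ m := by
      rw [← Real.rpow_add h0, ← Real.rpow_add h1', show (1 / 2 : ℝ) + (m + 1 / 2 - 1) = m by ring,
        show (1 / 2 : ℝ) + (1 / 2 - 1) = 0 by norm_num, Real.rpow_zero, mul_one]

lemma integrableOn_half_one_sub_cos_rpow {m : ℝ} (hm : -1 / 2 < m) :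
    IntegrableOn (fun t => ((1 - Real.cos t) / 2) ^ m) (Ioo 0 Real.pi) := by
  have h := integrableOn_beta (a := m + 1 / 2) (b := 1 / 2) (by linarith) (by norm_num)
  rw [← image_half_one_sub_cos, integrableOn_image_iff_integrableOn_abs_deriv_smul
    measurableSet_Ioo (fun t _ => hasDerivWithinAt_half_one_sub_cos t _)
    injOn_half_one_sub_cos] at h
  exact h.congr_fun (fun t ht => abs_sin_mul_beta_integrand m ht) measurableSet_Ioo

lemma integral_half_one_sub_cos_rpow {m : ℝ} (hm : -1 / 2 < m) :
    ∫ t in (0 : ℝ)..Real.pi, ((1 - Real.cos t) / 2) ^ m =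
      Real.Gamma (m + 1 / 2) * Real.Gamma (1 / 2) / Real.Gamma (m + 1) := by
  have h := intervalIntegral_beta (a := m + 1 / 2) (b := 1 / 2) (by linarith) (by norm_num)
  rw [intervalIntegral.integral_of_le zero_le_one, integral_Ioc_eq_integral_Ioo,
    ← image_half_one_sub_cos, integral_image_eq_integral_abs_deriv_smul
    measurableSet_Ioo (fun t _ => hasDerivWithinAt_half_one_sub_cos t _)
    injOn_half_one_sub_cos, show m + 1 / 2 + 1 / 2 = m + 1 by ring] at h
  rw [← h, intervalIntegral.integral_of_le Real.pi_pos.le, integral_Ioc_eq_integral_Ioo]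
  exact setIntegral_congr_fun measurableSet_Ioo fun t ht => (abs_sin_mul_beta_integrand m ht).symm

lemma chordMean_one {m : ℝ} (hm : -1 / 2 < m) :
    chordMean m 1 = Real.pi * cConst (2 * m + 1) := by
  have h1 : ∀ t, chordSq 1 t ^ m = 4 ^ m * ((1 - Real.cos t) / 2) ^ m := by
    intro t
    rw [← Real.mul_rpow (by norm_num) (by linarith [Real.cos_le_one t]), chordSq]
    congr 1
    ring
  -- Legendre duplication converts the quotient of Gamma values from the beta integral into
  -- `cConst`.
  have h2 := Real.Gamma_mul_Gamma_add_half (m + 1 / 2)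
  have h3 : 0 < Real.Gamma (m + 1) := Real.Gamma_pos_of_pos (by linarith)
  have h4 : (2 : ℝ) ^ (1 - 2 * (m + 1 / 2)) = (4 ^ m)⁻¹ := by
    rw [← Real.rpow_neg (by norm_num), show (4 : ℝ) = 2 ^ (2 : ℝ) by norm_num,
      ← Real.rpow_mul (by norm_num)]
    congr 1
    ring
  rw [show m + 1 / 2 + 1 / 2 = m + 1 by ring, h4, show 2 * (m + 1 / 2) = 2 * m + 1 by ring] at h2
  have h5 : (0 : ℝ) < 4 ^ m := by positivity
  have h6 := Real.mul_self_sqrt Real.pi_pos.le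
  rw [chordMean]
  simp only [h1]
  rw [intervalIntegral.integral_const_mul, integral_half_one_sub_cos_rpow hm,
    Real.Gamma_one_half_eq, cConst, show (2 * m + 1) / 2 + 1 / 2 = m + 1 by ring]
  generalize Real.Gamma (2 * m + 1) = G at *
  generalize Real.Gamma (m + 1 / 2) = H at *
  generalize (4 : ℝ) ^ m = K at *
  field_simp at h2 ⊢
  linear_combination (Real.sqrt Real.pi) * h2 + G * h6

/-! #### Monotonicity -/

/-- A bound uniform in r up to and including 1. The term `4 ^ m` serves m ≥ 0 and the other serves m
≤ 0. -/
lemma chordSq_rpow_le (m : ℝ) {r : ℝ} (hr : r ∈ Icc (0 : ℝ) 1) {t : ℝ}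
    (ht : t ∈ Ioo 0 Real.pi) :
    chordSq r t ^ m ≤ 4 ^ m + ((1 - Real.cos t) / 2) ^ m := by
  have hx := (half_one_sub_cos_mem ht).1
  have hq := chordSq_pos' r ht
  have hlow : (1 - Real.cos t) / 2 ≤ chordSq r t := by
    unfold chordSq
    have h1 := Real.cos_le_one t
    have h2 := Real.neg_one_le_cos t
    nlinarith [hr.1, hr.2, sq_nonneg (1 - r), mul_nonneg hr.1 (sub_nonneg.2 hr.2),
      mul_nonneg (sub_nonneg.2 h1) hr.1, mul_nonneg (sub_nonneg.2 h2) hr.1,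
      mul_nonneg (sub_nonneg.2 h1) (sq_nonneg r)]
  have hup : chordSq r t ≤ 4 := by
    unfold chordSq
    have h2 := Real.neg_one_le_cos t
    nlinarith [hr.1, hr.2]
  have p1 : 0 ≤ (4 : ℝ) ^ m := by positivity
  have p2 : 0 ≤ ((1 - Real.cos t) / 2) ^ m := by positivity
  rcases le_total 0 m with hm | hm
  · linarith [Real.rpow_le_rpow hq.le hup hm]
  · linarith [Real.rpow_le_rpow_of_nonpos hx hlow hm]

lemma continuousOn_chordMean {m : ℝ} (hm : -1 / 2 < m) :
    ContinuousOn (chordMean m) (Icc 0 1) := by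
  intro r hr
  unfold chordMean
  simp only [intervalIntegral.integral_of_le Real.pi_pos.le, integral_Ioc_eq_integral_Ioo]
  refine continuousWithinAt_of_dominated
    (bound := fun t => 4 ^ m + ((1 - Real.cos t) / 2) ^ m) ?_ ?_ ?_ ?_
  · refine Filter.Eventually.of_forall fun x => Measurable.aestronglyMeasurable ?_
    exact ((continuous_chordSq.comp (Continuous.prodMk_right x)).measurable).pow_const m
  · filter_upwards [self_mem_nhdsWithin] with x hx
    filter_upwards [ae_restrict_mem measurableSet_Ioo] with t ht
    rw [Real.norm_of_nonneg (Real.rpow_nonneg (chordSq_pos' x ht).le _)]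
    exact chordSq_rpow_le m hx ht
  · exact (integrableOn_const (by simp)).add (integrableOn_half_one_sub_cos_rpow hm)
  · filter_upwards [ae_restrict_mem measurableSet_Ioo] with t ht
    refine ContinuousAt.continuousWithinAt (ContinuousAt.rpow_const ?_
      (Or.inl (chordSq_pos' r ht).ne'))
    exact (continuous_chordSq.comp (Continuous.prodMk_left t)).continuousAt

lemma monotoneOn_chordMean {m : ℝ} (hm : -1 / 2 < m) : MonotoneOn (chordMean m) (Icc 0 1) := by
  refine monotoneOn_of_deriv_nonneg (convex_Icc 0 1) (continuousOn_chordMean hm) ?_ ?_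
  · intro r hr
    rw [interior_Icc] at hr
    exact (hasDerivAt_chordMean m (by linarith [hr.1]) hr.2).differentiableAt.differentiableWithinAt
  · intro r hr
    rw [interior_Icc] at hr
    have h0 : -1 < r := by linarith [hr.1]
    rw [(hasDerivAt_chordMean m h0 hr.2).deriv]
    have h := integral_chordSq_radial_nonneg h0 hr.2 m
    rw [← integral_Ioc_eq_integral_Ioo, ← intervalIntegral.integral_of_le Real.pi_pos.le] at h
    -- The identity |1-re^{it}|² - (1-r²) = r(2r - 2cos t) turns the radial integrand into r times
    -- the differentiated one.
    have e : ∀ t, m * (chordSq r t ^ m * (1 - (1 - r ^ 2) / chordSq r t)) =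
        r * (m * chordSq r t ^ (m - 1) * (2 * r - 2 * Real.cos t)) := by
      intro t
      have hq := chordSq_pos h0 hr.2 t
      rw [Real.rpow_sub hq, Real.rpow_one]
      have hq' := hq.ne'
      field_simp
      unfold chordSq
      ring
    simp only [e] at h
    rw [intervalIntegral.integral_const_mul] at h
    exact nonneg_of_mul_nonneg_right h hr.1

lemma chordMean_le {m : ℝ} (hm : -1 / 2 < m) {r : ℝ} (hr : r ∈ Ico (0 : ℝ) 1) :
    chordMean m r ≤ Real.pi * cConst (2 * m + 1) := by
  rw [← chordMean_one hm]
  exact monotoneOn_chordMean hm ⟨hr.1, hr.2.le⟩ ⟨zero_le_one, le_rfl⟩ hr.2.le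

lemma integral_two_pi_comp_cos {F : ℝ → ℝ} (hF : Continuous fun t => F (Real.cos t)) :
    ∫ t in (0 : ℝ)..(2 * Real.pi), F (Real.cos t) =
      2 * ∫ t in (0 : ℝ)..Real.pi, F (Real.cos t) := by
  rw [← intervalIntegral.integral_add_adjacent_intervals (hF.intervalIntegrable 0 Real.pi)
    (hF.intervalIntegrable _ _)]
  have h := intervalIntegral.integral_comp_sub_left (fun t => F (Real.cos t)) (2 * Real.pi)
    (a := 0) (b := Real.pi)
  simp only [Real.cos_two_pi_sub, sub_zero] at h
  rw [show 2 * Real.pi - Real.pi = Real.pi by ring] at h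
  rw [← h]
  ring

lemma integralI_eq_chordMean (l : ℝ) {r : ℝ} (hr : r ∈ Ico (0 : ℝ) 1) :
    integralI l r = (1 / Real.pi) * ((1 - r ^ 2) ^ l * chordMean (-((l + 1) / 2)) r) := by
  have h0 : -1 < r := by linarith [hr.1]
  have e : ∀ t : ℝ, (1 - r ^ 2) ^ l / ‖1 - (r : ℂ) * Complex.exp (-(t * Complex.I))‖ ^ (l + 1) =
      (1 - r ^ 2) ^ l * chordSq r t ^ (-((l + 1) / 2)) := by
    intro t
    rw [Real.rpow_neg (chordSq_pos h0 hr.2 t).le, ← norm_one_sub_mul_exp_sq,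
      ← Real.rpow_natCast ‖_‖, ← Real.rpow_mul (norm_nonneg _), div_eq_mul_inv]
    congr 3
    push_cast
    ring
  rw [integralI]
  simp only [e]
  rw [intervalIntegral.integral_const_mul, chordMean]
  have := integral_two_pi_comp_cos (F := fun c => (1 - 2 * r * c + r ^ 2) ^ (-((l + 1) / 2)))
    (continuous_chordSq_rpow h0 hr.2 _)
  simp only [chordSq]
  rw [this]
  field_simp

/-- The inversion trades the weight (1-r²)^l for a change of exponent. The new exponent (l-1)/2
exceeds -1/2 exactly when l > 0. -/
lemma chordMean_inversion (l : ℝ) {r : ℝ} (hr : r ∈ Ico (0 : ℝ) 1) :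
    (1 - r ^ 2) ^ l * chordMean (-((l + 1) / 2)) r = chordMean ((l - 1) / 2) r := by
  have h0 : -1 < r := by linarith [hr.1]
  have hd : 0 < 1 - r ^ 2 := by nlinarith [hr.1, hr.2]
  rw [chordMean, chordMean, intervalIntegral.integral_of_le Real.pi_pos.le,
    intervalIntegral.integral_of_le Real.pi_pos.le, integral_Ioc_eq_integral_Ioo,
    integral_Ioc_eq_integral_Ioo,
    integral_chordSq_inversion h0 hr.2 fun x => x ^ (-((l + 1) / 2)), ← integral_const_mul]
  refine setIntegral_congr_fun measurableSet_Ioo fun t _ => ?_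
  have hq := chordSq_pos h0 hr.2 t
  rw [Real.div_rpow (by positivity) hq.le, Real.rpow_neg hq.le, ← Real.rpow_natCast (1 - r ^ 2) 2,
    ← Real.rpow_mul hd.le, show ((2 : ℕ) : ℝ) * -((l + 1) / 2) = -l - 1 by push_cast; ring,
    Real.rpow_sub hd, Real.rpow_neg hd.le, Real.rpow_one,
    show (l - 1) / 2 = (l + 1) / 2 - 1 by ring, Real.rpow_sub hq, Real.rpow_one]
  have h3 : 0 < (1 - r ^ 2) ^ l := Real.rpow_pos_of_pos hd l
  have h4 : 0 < chordSq r t ^ ((l + 1) / 2) := Real.rpow_pos_of_pos hq _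
  field_simp

theorem integralI_le_cConst {l : ℝ} (hl : 0 < l) {r : ℝ} (hr : r ∈ Ico (0 : ℝ) 1) :
    integralI l r ≤ cConst l := by
  rw [integralI_eq_chordMean l hr, chordMean_inversion l hr, one_div, inv_mul_le_iff₀ Real.pi_pos]
  have := chordMean_le (m := (l - 1) / 2) (by linarith) hr
  rwa [show 2 * ((l - 1) / 2) + 1 = l by ring] at this

/-- No inversion is needed here: for l < 0 the original exponent -(l+1)/2 already exceeds -1/2. -/
lemma integralI_le_of_neg {l : ℝ} (hl : l < 0) {r : ℝ} (hr : r ∈ Ico (0 : ℝ) 1) :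
    integralI l r ≤ cConst (-l) * (1 - r ^ 2) ^ l := by
  have hd : 0 < 1 - r ^ 2 := by nlinarith [hr.1, hr.2]
  rw [integralI_eq_chordMean l hr, one_div, inv_mul_le_iff₀ Real.pi_pos]
  have h := chordMean_le (m := -((l + 1) / 2)) (by linarith) hr
  rw [show 2 * -((l + 1) / 2) + 1 = -l by ring] at h
  have h3 : 0 < (1 - r ^ 2) ^ l := Real.rpow_pos_of_pos hd l
  nlinarith

/-! ### Hardy and Lebesgue norms of the derivatives -/

lemma measurable_dz (u : ℂ → ℂ) : Measurable (dz u) := by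
  unfold dz
  exact measurable_const.mul ((measurable_fderiv_apply_const ℝ u 1).sub
    (measurable_const.mul (measurable_fderiv_apply_const ℝ u Complex.I)))

lemma measurable_dzbar (u : ℂ → ℂ) : Measurable (dzbar u) := by
  unfold dzbar
  exact measurable_const.mul ((measurable_fderiv_apply_const ℝ u 1).add
    (measurable_const.mul (measurable_fderiv_apply_const ℝ u Complex.I)))

lemma IsABHarmonic.continuousOn_dz {α β : ℝ} {u : ℂ → ℂ} (hu : IsABHarmonic α β u) :
    ContinuousOn (dz u) unitDisc := by
  have : ContDiffOn ℝ ((1 : ℕ) + 1) u unitDisc := by norm_num; exact hu.1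
  exact this.dz.continuousOn

lemma IsABHarmonic.continuousOn_dzbar {α β : ℝ} {u : ℂ → ℂ} (hu : IsABHarmonic α β u) :
    ContinuousOn (dzbar u) unitDisc := by
  have : ContDiffOn ℝ ((1 : ℕ) + 1) u unitDisc := by norm_num; exact hu.1
  exact this.dzbar.continuousOn

lemma angleMeasure_univ : angleMeasure univ = 1 := by
  rw [angleMeasure, Measure.smul_apply, Measure.restrict_apply MeasurableSet.univ, univ_inter,
    Real.volume_Ioc, sub_zero, smul_eq_mul, ← ENNReal.ofReal_mul (by positivity),
    one_div_mul_cancel (by positivity), ENNReal.ofReal_one]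

/-- For a continuous function the essential supremum bounds every value, since non-empty open sets
have positive measure. Endpoints are reached through the closure of the open interval. -/
lemma enorm_le_eLpNorm_top_angleMeasure {h : ℝ → ℂ} (hh : Continuous h) {θ : ℝ}
    (hθ : θ ∈ Icc 0 (2 * Real.pi)) : ‖h θ‖ₑ ≤ eLpNorm h ∞ angleMeasure := by
  by_contra! hlt
  set U : Set ℝ := {t | eLpNorm h ∞ angleMeasure < ‖h t‖ₑ} with hU
  have hUo : IsOpen U := isOpen_lt continuous_const hh.enorm
  have hne : (U ∩ Ioo 0 (2 * Real.pi)).Nonempty := by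
    have hcl : θ ∈ closure (Ioo 0 (2 * Real.pi)) := by
      rwa [closure_Ioo (by positivity)]
    exact mem_closure_iff.1 hcl U hUo hlt
  have hpos : 0 < volume (U ∩ Ioo 0 (2 * Real.pi)) := (hUo.inter isOpen_Ioo).measure_pos _ hne
  have hae : ∀ᵐ t ∂angleMeasure, ‖h t‖ₑ ≤ eLpNorm h ∞ angleMeasure := by
    rw [eLpNorm_exponent_top]; exact ae_le_eLpNormEssSup
  have hz : angleMeasure U = 0 := by
    rw [ae_iff] at hae
    simpa [hU] using hae
  rw [angleMeasure, Measure.smul_apply, smul_eq_mul, mul_eq_zero] at hz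
  rcases hz with hz | hz
  · rw [ENNReal.ofReal_eq_zero] at hz
    exact absurd hz (not_le.2 (by positivity))
  · rw [Measure.restrict_apply hUo.measurableSet] at hz
    have : volume (U ∩ Ioo 0 (2 * Real.pi)) ≤ volume (U ∩ Ioc 0 (2 * Real.pi)) :=
      measure_mono (inter_subset_inter_right _ Ioo_subset_Ioc_self)
    rw [hz] at this
    exact absurd hpos (not_lt.2 this)

lemma exists_angle (z : ℂ) :
    ∃ θ ∈ Icc 0 (2 * Real.pi), z = (‖z‖ : ℂ) * Complex.exp (θ * Complex.I) := by
  have h := Complex.norm_mul_exp_arg_mul_I z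
  rcases le_or_gt 0 z.arg with h0 | h0
  · exact ⟨z.arg, ⟨h0, (Complex.arg_le_pi z).trans (by linarith [Real.pi_pos])⟩, h.symm⟩
  · refine ⟨z.arg + 2 * Real.pi, ⟨by linarith [Complex.neg_pi_lt_arg z, Real.pi_pos],
      by linarith⟩, ?_⟩
    push_cast
    rw [add_mul, Complex.exp_add, Complex.exp_two_pi_mul_I, mul_one, h]

lemma ContinuousOn.comp_circle {v : ℂ → ℂ} (hv : ContinuousOn v unitDisc) {r : ℝ}
    (hr : r ∈ Ico (0 : ℝ) 1) :
    Continuous fun θ : ℝ => v ((r : ℂ) * Complex.exp (θ * Complex.I)) :=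
  hv.comp_continuous (by fun_prop) fun θ => ofReal_mul_exp_mem_unitDisc hr θ

/-- The radius 0 is included in the hypothesis because for p = ∞ the Hardy norm also sees the value
at the origin. -/
lemma hardyNorm_le_of_meanP_le {v : ℂ → ℂ} (hv : ContinuousOn v unitDisc) {p C : ℝ≥0∞}
    (h : ∀ r ∈ Ico (0 : ℝ) 1, meanP p r v ≤ C) : hardyNorm p v ≤ C := by
  rw [hardyNorm]
  split_ifs with hp
  · refine iSup₂_le fun z hz => ?_
    have hr : ‖z‖ ∈ Ico (0 : ℝ) 1 := ⟨norm_nonneg z, mem_unitDisc.1 hz⟩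
    obtain ⟨θ, hθ, hzθ⟩ := exists_angle z
    have h1 := enorm_le_eLpNorm_top_angleMeasure (hv.comp_circle hr) hθ
    rw [← hzθ] at h1
    refine h1.trans ?_
    have := h _ hr
    rwa [hp] at this
  · exact iSup₂_le fun r hr => h r ⟨hr.1.le, hr.2⟩

/-- Comparison of the means of `v` and of `z v`. -/
lemma exists_meanP_le {v w : ℂ → ℂ} (hv : ContinuousOn v unitDisc)
    (hw : ∀ z ∈ unitDisc, ‖w z‖ = ‖z‖ * ‖v z‖) (p : ℝ≥0∞) :
    ∃ B : ℝ, 0 ≤ B ∧ ∀ r ∈ Ico (0 : ℝ) 1, meanP p r v ≤ ENNReal.ofReal B + 2 * meanP p r w := by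
  have hsub : Metric.closedBall (0 : ℂ) (1 / 2) ⊆ unitDisc :=
    Metric.closedBall_subset_ball (by norm_num)
  obtain ⟨B, hB⟩ := (isCompact_closedBall (0 : ℂ) (1 / 2)).exists_bound_of_continuousOn
    (hv.mono hsub)
  refine ⟨|B|, abs_nonneg B, fun r hr => ?_⟩
  -- Division by z is harmless: `v` is bounded on |z| ≤ 1/2 by compactness, and |v| ≤ 2|w| beyond.
  rcases le_total r (1 / 2) with h | h
  · refine le_trans ?_ (self_le_add_right _ _)
    have hb : ∀ᵐ θ : ℝ ∂angleMeasure, ‖v ((r : ℂ) * Complex.exp (θ * Complex.I))‖ ≤ |B| := by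
      refine Filter.Eventually.of_forall fun θ => (hB _ ?_).trans (le_abs_self B)
      rw [mem_closedBall_zero_iff, norm_ofReal_mul_exp hr.1]
      exact h
    have := eLpNorm_le_of_ae_bound (p := p) hb
    rwa [angleMeasure_univ, ENNReal.one_rpow, one_mul] at this
  · refine le_trans ?_ (self_le_add_left _ _)
    have := eLpNorm_const_smul (2 : ℝ)
      (fun θ : ℝ => w ((r : ℂ) * Complex.exp (θ * Complex.I))) p angleMeasure
    rw [Real.enorm_eq_ofReal (by norm_num), ENNReal.ofReal_ofNat] at this
    rw [meanP, meanP, ← this]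
    refine eLpNorm_mono fun θ => ?_
    rw [Pi.smul_apply, norm_smul, hw _ (ofReal_mul_exp_mem_unitDisc hr θ),
      norm_ofReal_mul_exp hr.1, Real.norm_of_nonneg (by norm_num : (0 : ℝ) ≤ 2), ← mul_assoc]
    exact le_mul_of_one_le_left (norm_nonneg _) (by linarith)

lemma memHardy_of_meanP_le {v w : ℂ → ℂ} (hv : ContinuousOn v unitDisc) (hvm : Measurable v)
    (hw : ∀ z ∈ unitDisc, ‖w z‖ = ‖z‖ * ‖v z‖) {p C : ℝ≥0∞} (hC : C < ∞)
    (h : ∀ r ∈ Ico (0 : ℝ) 1, meanP p r w ≤ C) : MemHardy p v := by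
  refine ⟨hvm.aemeasurable, fun r hr =>
    (hv.comp_circle ⟨hr.1.le, hr.2⟩).measurable.aemeasurable, ?_⟩
  obtain ⟨B, -, hB⟩ := exists_meanP_le hv hw p
  refine (hardyNorm_le_of_meanP_le hv (C := ENNReal.ofReal B + 2 * C)
    fun r hr => (hB r hr).trans ?_).trans_lt
    (ENNReal.add_lt_top.2 ⟨ENNReal.ofReal_lt_top, ENNReal.mul_lt_top (by simp) hC⟩)
  gcongr
  exact h r hr

lemma circleNorm_lt_top {f : Circle → ℂ} (hf : CircleAbsCont f) (p : ℝ≥0∞) :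
    circleNorm p f < ∞ := by
  obtain ⟨C, hC⟩ := hf.exists_bound
  have hae : ∀ᵐ θ ∂angleMeasure, ‖f (Circle.exp θ)‖ ≤ C := by
    refine Measure.ae_smul_measure ?_ _
    filter_upwards [ae_restrict_mem measurableSet_Ioc] with θ hθ
    exact hC θ (by rw [uIcc_of_le (by positivity)]; exact Ioc_subset_Icc_self hθ)
  refine (eLpNorm_le_of_ae_bound hae).trans_lt ?_
  rw [angleMeasure_univ, ENNReal.one_rpow, one_mul]
  exact ENNReal.ofReal_lt_top

/-! #### Polar coordinates in the disc -/

/-- Polar coordinates use angles in (-π, π), the circle means use (0, 2π]. -/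
lemma setLIntegral_periodic {H : ℝ → ℝ≥0∞} (hH : Function.Periodic H (2 * Real.pi)) :
    ∫⁻ φ in Ioo (-Real.pi) Real.pi, H φ = ∫⁻ φ in Ioc 0 (2 * Real.pi), H φ := by
  rw [setLIntegral_congr Ioo_ae_eq_Ioc]
  have h := (isAddFundamentalDomain_Ioc Real.two_pi_pos (-Real.pi)).setLIntegral_eq
    (isAddFundamentalDomain_Ioc Real.two_pi_pos 0) H ?_
  · rw [zero_add, show -Real.pi + 2 * Real.pi = Real.pi by ring] at h
    exact h
  · rintro ⟨_, n, rfl⟩ x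
    have := hH.int_mul n x
    simpa [add_comm] using this

lemma lintegral_unitDisc_polar {G : ℂ → ℝ≥0∞} (hG : Measurable G) :
    ∫⁻ z in unitDisc, G z = ∫⁻ r in Ioo (0 : ℝ) 1, ENNReal.ofReal r *
      ∫⁻ φ in Ioc 0 (2 * Real.pi), G ((r : ℂ) * Complex.exp (φ * Complex.I)) := by
  have hm : Measurable fun p : ℝ × ℝ => (p.1 : ℂ) * Complex.exp (p.2 * Complex.I) := by fun_prop
  rw [← lintegral_indicator isOpen_unitDisc.measurableSet, ← Complex.lintegral_comp_polarCoord_symm]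
  have hsymm : ∀ p : ℝ × ℝ, Complex.polarCoord.symm p =
      (p.1 : ℂ) * Complex.exp (p.2 * Complex.I) := by
    intro p
    rw [Complex.polarCoord_symm_apply, Complex.exp_mul_I]
    push_cast
    rfl
  simp only [hsymm, smul_eq_mul]
  rw [polarCoord_target, Measure.volume_eq_prod, setLIntegral_prod]
  swap
  · exact ((ENNReal.measurable_ofReal.comp measurable_fst).mul
      ((hG.indicator isOpen_unitDisc.measurableSet).comp hm)).aemeasurable
  have hIoo : Ioo (0 : ℝ) 1 = Iio 1 ∩ Ioi 0 := by ext; simp [and_comm]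
  rw [hIoo, ← Measure.restrict_restrict measurableSet_Iio, ← lintegral_indicator measurableSet_Iio]
  refine setLIntegral_congr_fun measurableSet_Ioi fun r hr => ?_
  have hr0 : (0 : ℝ) < r := hr
  simp only
  by_cases h1 : r < 1
  · rw [indicator_of_mem (show r ∈ Iio (1 : ℝ) from h1), ← setLIntegral_periodic]
    · rw [lintegral_const_mul]
      · congr 1
        refine lintegral_congr fun φ => ?_
        rw [indicator_of_mem (ofReal_mul_exp_mem_unitDisc ⟨hr0.le, h1⟩ φ)]
      · exact (hG.indicator isOpen_unitDisc.measurableSet).comp (by fun_prop)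
    · intro φ
      push_cast
      rw [add_mul, Complex.exp_add, Complex.exp_two_pi_mul_I, mul_one]
  · rw [indicator_of_notMem (show r ∉ Iio (1 : ℝ) from h1)]
    have : ∀ φ : ℝ, unitDisc.indicator G ((r : ℂ) * Complex.exp (φ * Complex.I)) = 0 := by
      intro φ
      rw [indicator_of_notMem]
      rw [mem_unitDisc, norm_ofReal_mul_exp hr0.le]
      exact h1
    simp [this]

lemma lintegral_circle_rpow {p : ℝ≥0∞} (hp0 : p ≠ 0) (hp : p ≠ ∞) (r : ℝ) (v : ℂ → ℂ) :
    ENNReal.ofReal (1 / (2 * Real.pi)) * ∫⁻ φ in Ioc 0 (2 * Real.pi),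
      ‖v ((r : ℂ) * Complex.exp (φ * Complex.I))‖ₑ ^ p.toReal = meanP p r v ^ p.toReal := by
  rw [meanP, eLpNorm_eq_lintegral_rpow_enorm_toReal hp0 hp, ← ENNReal.rpow_mul,
    one_div_mul_cancel (ENNReal.toReal_pos hp0 hp).ne', ENNReal.rpow_one, angleMeasure,
    lintegral_smul_measure, smul_eq_mul]

lemma memLpDisc_of_meanP_le {v : ℂ → ℂ} (hv : Measurable v) {p C : ℝ≥0∞} (hC : C ≠ ∞)
    (hp1 : 1 ≤ p) {l : ℝ} (hl : l < 0) (hp : p < ENNReal.ofReal (-1 / l))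
    (h : ∀ r ∈ Ico (0 : ℝ) 1, meanP p r v ≤ C * ENNReal.ofReal ((1 - r ^ 2) ^ l)) :
    MemLpDisc p v := by
  have hp0 : p ≠ 0 := (zero_lt_one.trans_le hp1).ne'
  have hptop : p ≠ ∞ := (hp.trans_le le_top).ne
  have hP0 := ENNReal.toReal_pos hp0 hptop
  -- Since l < 0, the condition p < -1/l says lp > -1, which is integrability of (1-r)^(lp) at 1.
  have hlP : -1 < l * p.toReal := by
    have := (ENNReal.lt_ofReal_iff_toReal_lt hptop).1 hp
    rw [lt_div_iff_of_neg hl] at this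
    linarith
  refine ⟨hv.aestronglyMeasurable, ?_⟩
  rw [eLpNorm_lt_top_iff_lintegral_rpow_enorm_lt_top hp0 hptop,
    lintegral_unitDisc_polar (hv.enorm.pow_const _)]
  have hint : IntegrableOn (fun r : ℝ => (1 - r) ^ (l * p.toReal)) (Ioo 0 1) := by
    have := (intervalIntegral.intervalIntegrable_rpow' (a := 0) (b := 1) hlP).comp_sub_left 1
    rw [sub_zero, sub_self] at this
    exact (intervalIntegrable_iff_integrableOn_Ioo_of_le zero_le_one).1 this.symm
  have hbound : ∀ r ∈ Ioo (0 : ℝ) 1, ENNReal.ofReal r * ∫⁻ φ in Ioc 0 (2 * Real.pi),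
      ‖v ((r : ℂ) * Complex.exp (φ * Complex.I))‖ₑ ^ p.toReal ≤
      ENNReal.ofReal (2 * Real.pi) * C ^ p.toReal *
        ENNReal.ofReal ((1 - r) ^ (l * p.toReal)) := by
    intro r hr
    have hr1 : 0 < 1 - r := sub_pos.2 hr.2
    have e : ∫⁻ φ in Ioc 0 (2 * Real.pi),
        ‖v ((r : ℂ) * Complex.exp (φ * Complex.I))‖ₑ ^ p.toReal =
        ENNReal.ofReal (2 * Real.pi) * meanP p r v ^ p.toReal := by
      rw [← lintegral_circle_rpow hp0 hptop, ← mul_assoc, ← ENNReal.ofReal_mul (by positivity),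
        mul_one_div_cancel (by positivity), ENNReal.ofReal_one, one_mul]
    have h2 : (1 - r ^ 2) ^ l ≤ (1 - r) ^ l :=
      Real.rpow_le_rpow_of_nonpos hr1 (by nlinarith [mul_pos hr.1 hr1]) hl.le
    have h3 : meanP p r v ≤ C * ENNReal.ofReal ((1 - r) ^ l) := by
      refine (h r ⟨hr.1.le, hr.2⟩).trans ?_
      gcongr
    rw [e]
    calc ENNReal.ofReal r * (ENNReal.ofReal (2 * Real.pi) * meanP p r v ^ p.toReal)
        ≤ 1 * (ENNReal.ofReal (2 * Real.pi) * (C * ENNReal.ofReal ((1 - r) ^ l)) ^ p.toReal) := by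
          gcongr
          exact ENNReal.ofReal_le_one.2 hr.2.le
      _ = _ := by
          rw [one_mul, ENNReal.mul_rpow_of_nonneg _ _ hP0.le,
            ENNReal.ofReal_rpow_of_nonneg (by positivity) hP0.le, ← Real.rpow_mul hr1.le, mul_assoc]
  refine (setLIntegral_mono' measurableSet_Ioo hbound).trans_lt ?_
  rw [lintegral_const_mul' _ _ (ENNReal.mul_ne_top ENNReal.ofReal_ne_top
    (ENNReal.rpow_ne_top_of_nonneg hP0.le hC))]
  refine ENNReal.mul_lt_top (ENNReal.mul_lt_top ENNReal.ofReal_lt_top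
    (ENNReal.rpow_lt_top_of_nonneg hP0.le hC)) ?_
  have := hint.lintegral_lt_top
  exact this

lemma one_le_rpow_of_neg {l : ℝ} (hl : l < 0) {r : ℝ} (hr : r ∈ Ico (0 : ℝ) 1) :
    1 ≤ (1 - r ^ 2) ^ l :=
  Real.one_le_rpow_of_pos_of_le_one_of_nonpos (by nlinarith [hr.1, hr.2]) (by nlinarith [hr.1]) hl.le

/-- `L^p` membership of a derivative whose means are controlled by `I_λ` with `λ < 0`. -/
lemma memLpDisc_of_meanP_le_integralI {v w : ℂ → ℂ} (hv : ContinuousOn v unitDisc)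
    (hvm : Measurable v) (hw : ∀ z ∈ unitDisc, ‖w z‖ = ‖z‖ * ‖v z‖) {p N : ℝ≥0∞} (hN : N ≠ ∞)
    {c l : ℝ} (hc : 0 ≤ c) (hp1 : 1 ≤ p) (hl : l < 0) (hp : p < ENNReal.ofReal (-1 / l))
    (h : ∀ r ∈ Ico (0 : ℝ) 1, meanP p r w ≤ ENNReal.ofReal (c * integralI l r) * N) :
    MemLpDisc p v := by
  obtain ⟨B, hB0, hB⟩ := exists_meanP_le hv hw p
  refine memLpDisc_of_meanP_le hvm (C := ENNReal.ofReal B +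
    2 * (ENNReal.ofReal (c * |cConst (-l)|) * N)) ?_ hp1 hl hp fun r hr => (hB r hr).trans ?_
  · exact ENNReal.add_ne_top.2 ⟨ENNReal.ofReal_ne_top, ENNReal.mul_ne_top (by simp)
      (ENNReal.mul_ne_top ENNReal.ofReal_ne_top hN)⟩
  -- The bounded contribution near the origin is absorbed into the growing one, as (1-r²)^l ≥ 1.
  · have h1 := one_le_rpow_of_neg hl hr
    rw [add_mul]
    refine add_le_add ?_ ?_
    · exact le_mul_of_one_le_right' (ENNReal.one_le_ofReal.2 h1)
    · rw [mul_assoc, mul_right_comm (ENNReal.ofReal _),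
        ← ENNReal.ofReal_mul (by positivity)]
      gcongr
      refine (h r hr).trans ?_
      gcongr ENNReal.ofReal ?_ * _
      rw [mul_assoc]
      gcongr
      refine (integralI_le_of_neg hl hr).trans ?_
      gcongr
      exact le_abs_self _

/-! ### Sharpness: a Lipschitz function whose Poisson integral has large derivatives -/

/-- `∂_z` of the rotated kernel divided by `c_{α,β} (1 - |z|²)^{α+β}`. -/
noncomputable def rescaledDz (α β : ℝ) (z w : ℂ) : ℂ :=
  ((1 - z * w) ^ ((α : ℂ) + 1))⁻¹ * ((1 - starRingEnd ℂ (z * w)) ^ ((β : ℂ) + 1))⁻¹ *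
    (-(α + β + 1) * starRingEnd ℂ (z * w) +
      (α + 1) * (1 - z * w * starRingEnd ℂ (z * w)) / (1 - z * w)) * w

/-- Extracting (1-|z|²)^(α+β) removes all negative powers of 1-|z|². The remaining factor is regular
up to |z| = 1 away from zw = 1, in particular at (1, -1). -/
lemma dz_abPoissonKernel_rotate (α β : ℝ) {z w : ℂ} (hz : z ∈ unitDisc) (hw : ‖w‖ = 1) :
    dz (abPoissonKernel α β) (z * w) * w =
      ((cAB α β * (1 - ‖z‖ ^ 2) ^ (α + β) : ℝ) : ℂ) * rescaledDz α β z w := by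
  have hzw : z * w ∈ unitDisc := by
    rw [mem_unitDisc, norm_mul, hw, mul_one]; exact mem_unitDisc.1 hz
  have hn : ‖z * w‖ = ‖z‖ := by rw [norm_mul, hw, mul_one]
  have hpos := one_sub_norm_sq_pos hz
  have hD := ofReal_one_sub_norm_sq (z * w)
  have h1 := one_sub_ne_zero hzw
  rw [dz_abPoissonKernel α β hzw, abPoissonKernel_eq, logDz, rescaledDz, ← hD, hn,
    Real.rpow_add hpos, Real.rpow_one]
  have hne : ((1 - ‖z‖ ^ 2 : ℝ) : ℂ) ≠ 0 := by exact_mod_cast hpos.ne'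
  generalize ((1 - z * w) ^ ((α : ℂ) + 1))⁻¹ = X
  generalize ((1 - starRingEnd ℂ (z * w)) ^ ((β : ℂ) + 1))⁻¹ = Y
  rw [Complex.ofReal_mul, Complex.ofReal_mul]
  generalize (((1 - ‖z‖ ^ 2) ^ (α + β) : ℝ) : ℂ) = P
  generalize ((1 - ‖z‖ ^ 2 : ℝ) : ℂ) = D at *
  field_simp

lemma continuousAt_rescaledDz (α β : ℝ) :
    ContinuousAt (fun p : ℂ × ℂ => rescaledDz α β p.1 p.2) (1, -1) := by
  have c1 : ContinuousAt (fun p : ℂ × ℂ => 1 - p.1 * p.2) (1, -1) := by fun_prop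
  have c2 : ContinuousAt (fun p : ℂ × ℂ => 1 - starRingEnd ℂ (p.1 * p.2)) (1, -1) :=
    continuousAt_const.sub
      (Complex.continuous_conj.continuousAt.comp (continuousAt_fst.mul continuousAt_snd))
  have h2 : (2 : ℂ) ∈ Complex.slitPlane := by simp
  have v1 : (fun p : ℂ × ℂ => 1 - p.1 * p.2) (1, -1) = 2 := by norm_num
  have v2 : (fun p : ℂ × ℂ => 1 - starRingEnd ℂ (p.1 * p.2)) (1, -1) = 2 := by
    simp; norm_num
  have d1 : ContinuousAt (fun p : ℂ × ℂ => ((1 - p.1 * p.2) ^ ((α : ℂ) + 1))⁻¹) (1, -1) :=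
    ContinuousAt.inv₀ (c1.cpow continuousAt_const (show (fun p : ℂ × ℂ => 1 - p.1 * p.2) (1, -1) ∈ _ by rw [v1]; exact h2))
      (by rw [Complex.cpow_ne_zero_iff]; left; norm_num)
  have d2 : ContinuousAt (fun p : ℂ × ℂ =>
      ((1 - starRingEnd ℂ (p.1 * p.2)) ^ ((β : ℂ) + 1))⁻¹) (1, -1) :=
    ContinuousAt.inv₀ (c2.cpow continuousAt_const (show (fun p : ℂ × ℂ => 1 - starRingEnd ℂ (p.1 * p.2)) (1, -1) ∈ _ by rw [v2]; exact h2))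
      (by rw [Complex.cpow_ne_zero_iff]; left; simp)
  have c3 : ContinuousAt (fun p : ℂ × ℂ => starRingEnd ℂ (p.1 * p.2)) (1, -1) :=
    Complex.continuous_conj.continuousAt.comp (continuousAt_fst.mul continuousAt_snd)
  have c4 : ContinuousAt (fun p : ℂ × ℂ => p.1 * p.2) (1, -1) :=
    continuousAt_fst.mul continuousAt_snd
  unfold rescaledDz
  refine ((d1.mul d2).mul ((continuousAt_const.mul c3).add
    ((continuousAt_const.mul (continuousAt_const.sub (c4.mul c3))).div c1 ?_))).mul
    continuousAt_snd
  norm_num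

lemma rescaledDz_one_neg_one (α β : ℝ) :
    rescaledDz α β 1 (-1) =
      ((-((α + β + 1) * ((2 ^ (α + 1))⁻¹ * (2 ^ (β + 1))⁻¹)) : ℝ) : ℂ) := by
  have h : ∀ a : ℝ, (2 : ℂ) ^ ((a : ℂ) + 1) = ((2 ^ (a + 1) : ℝ) : ℂ) := by
    intro a
    rw [Complex.ofReal_cpow (by norm_num)]
    push_cast
    rfl
  rw [rescaledDz]
  have e : (1 : ℂ) - 1 * -1 = 2 := by norm_num
  have e' : (1 : ℂ) - starRingEnd ℂ (1 * -1) = 2 := by simp; norm_num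
  rw [e, e', h, h]
  push_cast
  simp
  ring

/-- At (1, -1) the rescaled derivative equals -(α+β+1)/2^(α+β+2), negative because α + β > -1.
Continuity keeps its real part below half that value nearby. -/
lemma exists_re_rescaledDz_le {α β : ℝ} (hs : -1 < α + β) :
    ∃ ε m : ℝ, 0 < ε ∧ 0 < m ∧ ∀ z w : ℂ, ‖z - 1‖ < ε → ‖w + 1‖ < ε →
      (rescaledDz α β z w).re ≤ -m := by
  set M := (α + β + 1) * ((2 ^ (α + 1))⁻¹ * (2 ^ (β + 1))⁻¹ : ℝ) with hM
  have hM0 : 0 < M := mul_pos (by linarith) (by positivity)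
  have hc := Complex.continuous_re.continuousAt.comp (continuousAt_rescaledDz α β)
  have hlt : (Complex.re ∘ fun p : ℂ × ℂ => rescaledDz α β p.1 p.2) (1, -1) < -(M / 2) := by
    simp only [Function.comp_apply, rescaledDz_one_neg_one, Complex.ofReal_re]
    linarith
  obtain ⟨ε, hε, hball⟩ := Metric.eventually_nhds_iff.1 (hc.eventually_lt continuousAt_const hlt)
  refine ⟨ε, M / 2, hε, by linarith, fun z w hz hw => (hball (y := (z, w)) ?_).le⟩
  rw [Prod.dist_eq, max_lt_iff, dist_eq_norm, dist_eq_norm]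
  exact ⟨hz, by simpa using hw⟩

/-! ### The bump datum and the lower bound it forces -/

/-- A Lipschitz bump on the circle concentrated near `-1`. -/
noncomputable def circleBump (ε : ℝ) (w : Circle) : ℂ :=
  ((max 0 (ε - ‖(w : ℂ) + 1‖) : ℝ) : ℂ)

lemma norm_exp_mul_I_sub_exp_mul_I_le (s t : ℝ) :
    ‖Complex.exp (s * Complex.I) - Complex.exp (t * Complex.I)‖ ≤ |s - t| := by
  have e : Complex.exp (s * Complex.I) - Complex.exp (t * Complex.I) =
      Complex.exp (t * Complex.I) * (Complex.exp (Complex.I * (s - t : ℝ)) - 1) := by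
    rw [mul_sub, ← Complex.exp_add, mul_one]
    congr 2
    push_cast
    ring
  rw [e, norm_mul, Complex.norm_exp_ofReal_mul_I, one_mul]
  exact Real.norm_exp_I_mul_ofReal_sub_one_le

lemma lipschitzWith_circleBump (ε : ℝ) :
    LipschitzWith 1 fun t : ℝ => circleBump ε (Circle.exp t) := by
  refine LipschitzWith.of_dist_le_mul fun s t => ?_
  rw [NNReal.coe_one, one_mul, dist_eq_norm, circleBump, circleBump, ← Complex.ofReal_sub,
    Complex.norm_real, Real.norm_eq_abs, Real.dist_eq]
  rw [max_comm 0, max_comm 0]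
  refine (abs_max_sub_max_le_abs _ _ _).trans ?_
  rw [sub_sub_sub_cancel_left, abs_sub_comm]
  refine (abs_norm_sub_norm_le _ _).trans ?_
  rw [add_sub_add_right_eq_sub, Circle.coe_exp, Circle.coe_exp]
  exact norm_exp_mul_I_sub_exp_mul_I_le s t

lemma circleAbsCont_circleBump (ε : ℝ) : CircleAbsCont (circleBump ε) :=
  (lipschitzWith_circleBump ε).lipschitzOnWith.absolutelyContinuousOnInterval

lemma memLp_angularDeriv_circleBump (ε : ℝ) (p : ℝ≥0∞) :
    MemLp (angularDeriv (circleBump ε)) p angleMeasure := by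
  refine MemLp.of_bound (C := 1) (stronglyMeasurable_deriv _).aestronglyMeasurable
    (Filter.Eventually.of_forall fun θ => ?_)
  exact norm_deriv_le_of_lipschitz (lipschitzWith_circleBump ε)

lemma integral_circleBump_pos {ε : ℝ} (hε : 0 < ε) :
    0 < ∫ θ in (0 : ℝ)..(2 * Real.pi), (circleBump ε (Circle.exp θ)).re := by
  refine intervalIntegral.integral_pos (by positivity)
    (Complex.continuous_re.comp (lipschitzWith_circleBump ε).continuous).continuousOn
    (fun θ _ => ?_) ⟨Real.pi, ⟨by positivity, by linarith [Real.pi_pos]⟩, ?_⟩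
  · simp [circleBump]
  · simp [circleBump, Circle.coe_exp, hε]

/-- The bump is non-negative and lives where the rescaled kernel has real part at most -m, so there
is no cancellation. The constant is |c_{α,β}| times m times the mean of the bump. -/
lemma le_norm_dz_circleBump {α β : ℝ} {ε₀ ε m : ℝ} (hε : 0 < ε) (hεε : ε ≤ ε₀) (hm : 0 < m)
    (h : ∀ z w : ℂ, ‖z - 1‖ < ε₀ → ‖w + 1‖ < ε₀ → (rescaledDz α β z w).re ≤ -m)
    (hc : cAB α β ≠ 0) :
    ∃ κ : ℝ, 0 < κ ∧ ∀ z ∈ unitDisc, ‖z - 1‖ < ε →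
      κ * (1 - ‖z‖ ^ 2) ^ (α + β) ≤ ‖dz (abPoissonIntegral α β (circleBump ε)) z‖ := by
  set g : ℝ → ℂ := fun θ => circleBump ε (Circle.exp θ) with hg
  have hgc : Continuous g := (lipschitzWith_circleBump ε).continuous
  set A := ∫ θ in (0 : ℝ)..(2 * Real.pi), (g θ).re with hA
  have hA0 : 0 < A := integral_circleBump_pos hε
  refine ⟨|cAB α β| * (m * (1 / (2 * Real.pi) * A)), by positivity, fun z hz hz1 => ?_⟩
  have hpos := one_sub_norm_sq_pos hz
  have hpow : 0 < (1 - ‖z‖ ^ 2) ^ (α + β) := Real.rpow_pos_of_pos hpos _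
  set C : ℝ := cAB α β * (1 - ‖z‖ ^ 2) ^ (α + β) with hC
  have hC0 : (C : ℂ) ≠ 0 := by exact_mod_cast mul_ne_zero hc hpow.ne'
  have hK : ContDiffOn ℝ ((0 : ℕ) + 1) (abPoissonKernel α β) unitDisc :=
    contDiffOn_abPoissonKernel α β
  set E : ℝ → ℂ := fun θ => rescaledDz α β z (Complex.exp (-(θ * Complex.I))) with hE
  have hrot : ∀ θ : ℝ, dz (abPoissonKernel α β) (z * Complex.exp (-(θ * Complex.I))) *
      Complex.exp (-(θ * Complex.I)) = C * E θ := fun θ =>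
    dz_abPoissonKernel_rotate α β hz (norm_exp_neg_mul_I θ)
  have hEc : Continuous E := by
    have : E = fun θ : ℝ => (C : ℂ)⁻¹ * (dz (abPoissonKernel α β)
        (z * Complex.exp (-(θ * Complex.I))) * Complex.exp (-(θ * Complex.I))) := by
      funext θ
      rw [hrot, inv_mul_cancel_left₀ hC0]
    rw [this]
    exact continuous_const.mul ((hK.dz.continuousOn.comp_rotate hz).mul (by fun_prop))
  have hdz : dz (abPoissonIntegral α β (circleBump ε)) z =
      C * ((1 / (2 * Real.pi) : ℝ) * ∫ θ in (0 : ℝ)..(2 * Real.pi), E θ * g θ) := by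
    rw [abPoissonIntegral_eq_circleTransform, dz_circleTransform (contDiffOn_abPoissonKernel α β)
      (hgc.intervalIntegrable _ _) hz, circleTransform]
    simp only [← mul_assoc, hrot]
    simp only [mul_assoc]
    rw [intervalIntegral.integral_const_mul]
    push_cast
    ring
  have hre : (∫ θ in (0 : ℝ)..(2 * Real.pi), E θ * g θ).re ≤ -(m * A) := by
    have hEg : Continuous fun θ => E θ * g θ := hEc.mul hgc
    have e1 := Complex.reCLM.intervalIntegral_comp_comm
      (hEg.intervalIntegrable (μ := volume) 0 (2 * Real.pi))
    simp only [Complex.reCLM_apply] at e1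
    rw [← e1, hA, ← neg_mul, ← intervalIntegral.integral_const_mul]
    refine intervalIntegral.integral_mono_on (by positivity)
      ((Complex.continuous_re.comp (hEc.mul hgc)).intervalIntegrable _ _)
      ((continuous_const.mul (Complex.continuous_re.comp hgc)).intervalIntegrable _ _) ?_
    intro θ _
    have hgre : (E θ * g θ).re = (E θ).re * (g θ).re := by
      simp [hg, circleBump, Complex.mul_re]
    rw [hgre]
    -- Since -1 is real, e^{iθ} and the rotation e^{-iθ} are equally far from it; off this arc the
    -- bump vanishes.
    by_cases hw : ‖((Circle.exp θ : Circle) : ℂ) + 1‖ < ε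
    · refine mul_le_mul_of_nonneg_right (h z _ (hz1.trans_le hεε) ?_) (by simp [hg, circleBump])
      rw [← Complex.norm_conj, map_add, conj_exp_neg_mul_I, map_one, ← Circle.coe_exp]
      exact hw.trans_le hεε
    · have : g θ = 0 := by
        simp only [hg, circleBump]
        rw [max_eq_left (by linarith [not_lt.1 hw])]
        simp
      simp [this]
  rw [hdz, norm_mul, norm_mul, Complex.norm_real, Complex.norm_real, hC, norm_mul,
    Real.norm_eq_abs, Real.norm_of_nonneg hpow.le,
    Real.norm_of_nonneg (by positivity : 0 ≤ 1 / (2 * Real.pi))]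
  have hn : m * A ≤ ‖∫ θ in (0 : ℝ)..(2 * Real.pi), E θ * g θ‖ := by
    refine le_trans ?_ (Complex.abs_re_le_norm _)
    rw [abs_of_nonpos (hre.trans (by nlinarith))]
    linarith
  calc |cAB α β| * (m * (1 / (2 * Real.pi) * A)) * (1 - ‖z‖ ^ 2) ^ (α + β)
      = |cAB α β| * (1 - ‖z‖ ^ 2) ^ (α + β) * (1 / (2 * Real.pi) * (m * A)) := by ring
    _ ≤ _ := by gcongr

/-! #### Functions that are large near the point `1` -/

lemma norm_ofReal_mul_exp_sub_one_le {r : ℝ} (hr : r ∈ Ico (0 : ℝ) 1) (φ : ℝ) :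
    ‖(r : ℂ) * Complex.exp (φ * Complex.I) - 1‖ ≤ (1 - r) + |φ| := by
  have h1 := norm_exp_mul_I_sub_exp_mul_I_le φ 0
  simp only [Complex.ofReal_zero, zero_mul, Complex.exp_zero, sub_zero] at h1
  have e : (r : ℂ) * Complex.exp (φ * Complex.I) - 1 =
      ((r - 1 : ℝ) : ℂ) * Complex.exp (φ * Complex.I) + (Complex.exp (φ * Complex.I) - 1) := by
    push_cast; ring
  rw [e]
  refine (norm_add_le _ _).trans (add_le_add ?_ h1)
  rw [norm_mul, Complex.norm_exp_ofReal_mul_I, mul_one, Complex.norm_real, Real.norm_eq_abs,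
    abs_sub_comm, abs_of_nonneg (by linarith [hr.2])]

lemma le_lintegral_circle {v : ℂ → ℂ} {κ ε l : ℝ} (hκ : 0 < κ)
    (h : ∀ z ∈ unitDisc, ‖z - 1‖ < ε → κ * (1 - ‖z‖ ^ 2) ^ l ≤ ‖v z‖)
    {δ : ℝ} (hδ1 : δ ≤ 1) (hδε : 2 * δ ≤ ε) {r : ℝ} (hr : r ∈ Ioo (1 - δ) 1)
    {P : ℝ} (hP : 0 ≤ P) :
    ENNReal.ofReal (δ * (κ * (1 - r ^ 2) ^ l) ^ P) ≤
      ∫⁻ φ in Ioc 0 (2 * Real.pi), ‖v ((r : ℂ) * Complex.exp (φ * Complex.I))‖ₑ ^ P := by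
  have hr' : r ∈ Ico (0 : ℝ) 1 := ⟨by linarith [hr.1], hr.2⟩
  have hd : 0 < 1 - r ^ 2 := by nlinarith [hr'.1, hr'.2]
  -- The arc 0 < φ < δ at radius r > 1 - δ lies within (1-r) + φ < 2δ ≤ ε of the point 1, so the
  -- lower bound holds on all of it.
  have hsub : Ioo 0 δ ⊆ Ioc 0 (2 * Real.pi) := fun φ hφ =>
    ⟨hφ.1, by linarith [hφ.2, Real.pi_gt_three]⟩
  calc ENNReal.ofReal (δ * (κ * (1 - r ^ 2) ^ l) ^ P)
      = ∫⁻ _ in Ioo 0 δ, ENNReal.ofReal ((κ * (1 - r ^ 2) ^ l) ^ P) := by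
        rw [setLIntegral_const, Real.volume_Ioo, sub_zero, ← ENNReal.ofReal_mul (by positivity),
          mul_comm]
    _ ≤ ∫⁻ φ in Ioo 0 δ, ‖v ((r : ℂ) * Complex.exp (φ * Complex.I))‖ₑ ^ P := by
        refine setLIntegral_mono' measurableSet_Ioo fun φ hφ => ?_
        have h1 := h _ (ofReal_mul_exp_mem_unitDisc hr' φ)
          ((norm_ofReal_mul_exp_sub_one_le hr' φ).trans_lt (by
            rw [abs_of_pos hφ.1]; linarith [hr.1, hφ.2]))
        rw [norm_ofReal_mul_exp hr'.1] at h1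
        rw [← ENNReal.ofReal_rpow_of_nonneg (by positivity) hP, ← ofReal_norm]
        gcongr
    _ ≤ _ := lintegral_mono_set hsub

/-- The disc has finite area, so it suffices to refute the critical exponent -1/l. There the lower
bound raised to that power is a multiple of (1-r²)⁻¹, which is not integrable at 1. -/
lemma not_memLpDisc_of_le {v : ℂ → ℂ} (hvm : Measurable v) {κ ε l : ℝ} (hκ : 0 < κ) (hε : 0 < ε)
    (hl : l < 0) (h : ∀ z ∈ unitDisc, ‖z - 1‖ < ε → κ * (1 - ‖z‖ ^ 2) ^ l ≤ ‖v z‖) {p : ℝ≥0∞}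
    (hp : ENNReal.ofReal (-1 / l) ≤ p) : ¬ MemLpDisc p v := by
  intro hmem
  have hQ : 0 < -1 / l := div_pos_of_neg_of_neg (by norm_num) hl
  have hfin : IsFiniteMeasure (volume.restrict unitDisc) :=
    ⟨by rw [Measure.restrict_apply_univ]; exact measure_ball_lt_top⟩
  have h1 := (MemLp.mono_exponent hmem hp).2
  rw [eLpNorm_lt_top_iff_lintegral_rpow_enorm_lt_top (by simpa using hQ) ENNReal.ofReal_ne_top,
    ENNReal.toReal_ofReal hQ.le, lintegral_unitDisc_polar (hvm.enorm.pow_const _)] at h1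
  set Q := -1 / l with hQdef
  set δ := min (ε / 2) (1 / 2) with hδ
  have hδ0 : 0 < δ := by positivity
  have hδ1 : δ ≤ 1 / 2 := min_le_right _ _
  have hδε : 2 * δ ≤ ε := by linarith [min_le_left (ε / 2) (1 / 2)]
  -- The factor 1/4 comes from r ≥ 1/2 and 1 - r² ≤ 2(1 - r).
  have hlow : ∀ r ∈ Ioo (1 - δ) 1, ENNReal.ofReal (δ * κ ^ Q / 4 * (1 - r)⁻¹) ≤
      ENNReal.ofReal r * ∫⁻ φ in Ioc 0 (2 * Real.pi),
        ‖v ((r : ℂ) * Complex.exp (φ * Complex.I))‖ₑ ^ Q := by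
    intro r hr
    have hr0 : 1 / 2 < r := by linarith [hr.1]
    have hr1 : 0 < 1 - r := sub_pos.2 hr.2
    have hd : 0 < 1 - r ^ 2 := by nlinarith
    have e : (κ * (1 - r ^ 2) ^ l) ^ Q = κ ^ Q * (1 - r ^ 2)⁻¹ := by
      rw [Real.mul_rpow hκ.le (by positivity), ← Real.rpow_mul hd.le, hQdef,
        mul_div_cancel₀ _ hl.ne, Real.rpow_neg_one]
    refine le_trans ?_ (mul_le_mul_right (le_lintegral_circle hκ h (by linarith) hδε hr hQ.le)
      (ENNReal.ofReal r))
    rw [← ENNReal.ofReal_mul (by linarith), e]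
    refine ENNReal.ofReal_le_ofReal ?_
    have hκQ : 0 < κ ^ Q := Real.rpow_pos_of_pos hκ Q
    have h2 : (2 * (1 - r))⁻¹ ≤ (1 - r ^ 2)⁻¹ := inv_anti₀ hd (by nlinarith)
    calc δ * κ ^ Q / 4 * (1 - r)⁻¹ = (1 / 2) * (δ * (κ ^ Q * (2 * (1 - r))⁻¹)) := by
          rw [mul_inv]; ring
      _ ≤ r * (δ * (κ ^ Q * (1 - r ^ 2)⁻¹)) := by gcongr
  have h2 : ∫⁻ r in Ioo (1 - δ) 1, ENNReal.ofReal (δ * κ ^ Q / 4 * (1 - r)⁻¹) < ∞ :=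
    ((setLIntegral_mono' measurableSet_Ioo hlow).trans
      (lintegral_mono_set (Ioo_subset_Ioo_left (by linarith)))).trans_lt h1
  have hκQ : 0 < κ ^ Q := Real.rpow_pos_of_pos hκ Q
  have hint : IntegrableOn (fun r : ℝ => δ * κ ^ Q / 4 * (1 - r)⁻¹) (Ioo (1 - δ) 1) := by
    refine ⟨Measurable.aestronglyMeasurable (by fun_prop), ?_⟩
    rw [hasFiniteIntegral_iff_ofReal]
    · exact h2
    · filter_upwards [ae_restrict_mem measurableSet_Ioo] with r hr
      have : 0 < 1 - r := sub_pos.2 hr.2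
      simp only [Pi.zero_apply]
      positivity
  have hint2 : IntervalIntegrable (fun r : ℝ => (r - 1)⁻¹) volume (1 - δ) 1 := by
    rw [intervalIntegrable_iff_integrableOn_Ioo_of_le (by linarith)]
    have := hint.const_mul (-(δ * κ ^ Q / 4)⁻¹)
    refine IntegrableOn.congr_fun this (fun r _ => ?_) measurableSet_Ioo
    have e : r - 1 = -(1 - r) := by ring
    simp only [e, inv_neg]
    field_simp
  rw [intervalIntegrable_sub_inv_iff] at hint2
  rcases hint2 with h3 | h3
  · linarith
  · exact h3 right_mem_uIcc

lemma not_memHardy_one_of_le {v : ℂ → ℂ} {κ ε l : ℝ} (hκ : 0 < κ) (hε : 0 < ε)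
    (hl : l < 0) (h : ∀ z ∈ unitDisc, ‖z - 1‖ < ε → κ * (1 - ‖z‖ ^ 2) ^ l ≤ ‖v z‖) :
    ¬ MemHardy 1 v := by
  rintro ⟨-, -, hfin⟩
  set δ := min (ε / 2) (1 / 2) with hδ
  have hδ0 : 0 < δ := by positivity
  have hδ1 : δ ≤ 1 / 2 := min_le_right _ _
  have hδε : 2 * δ ≤ ε := by linarith [min_le_left (ε / 2) (1 / 2)]
  set M := (hardyNorm 1 v).toReal with hM
  set κ' := 1 / (2 * Real.pi) * δ * κ with hκ'
  have hκ'0 : 0 < κ' := by positivity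
  have hbound : ∀ r ∈ Ioo (1 - δ) 1, κ' * (1 - r ^ 2) ^ l ≤ M := by
    intro r hr
    have h1 : meanP 1 r v ≤ hardyNorm 1 v := by
      rw [hardyNorm, if_neg ENNReal.one_ne_top]
      exact le_iSup₂ (f := fun r (_ : r ∈ Ioo (0 : ℝ) 1) => meanP 1 r v) r
        ⟨by linarith [hr.1], hr.2⟩
    have h2 := lintegral_circle_rpow one_ne_zero ENNReal.one_ne_top r v
    rw [ENNReal.toReal_one, ENNReal.rpow_one] at h2
    have h3 := le_lintegral_circle hκ h (by linarith) hδε hr zero_le_one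
    have h4 : ENNReal.ofReal (κ' * (1 - r ^ 2) ^ l) ≤ hardyNorm 1 v := by
      refine le_trans ?_ h1
      rw [← h2]
      refine le_trans (le_of_eq ?_) (mul_le_mul_right h3 _)
      rw [← ENNReal.ofReal_mul (by positivity), Real.rpow_one, hκ']
      congr 1
      ring
    exact (ENNReal.ofReal_le_iff_le_toReal hfin.ne).1 h4
  have hM0 : 0 ≤ M := ENNReal.toReal_nonneg
  -- Chosen so that κ' x^l = M + κ' exceeds M. The radius 1 - s below satisfies 1 - (1-s)² ≤ 2s ≤ x,
  -- and l < 0, so the mean there is at least this large.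
  set x := (M / κ' + 1) ^ (1 / l) with hx
  have hx0 : 0 < x := by positivity
  have hxl : x ^ l = M / κ' + 1 := by
    rw [hx, ← Real.rpow_mul (by positivity), one_div_mul_cancel hl.ne, Real.rpow_one]
  set s := min (δ / 2) (x / 2) with hs
  have hs0 : 0 < s := by positivity
  have hsδ : s ≤ δ / 2 := min_le_left _ _
  have hsx : s ≤ x / 2 := min_le_right _ _
  have h1 := hbound (1 - s) ⟨by linarith, by linarith⟩
  have hd : 0 < 1 - (1 - s) ^ 2 := by nlinarith
  have h2 : x ^ l ≤ (1 - (1 - s) ^ 2) ^ l :=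
    Real.rpow_le_rpow_of_nonpos hd (by nlinarith) hl.le
  rw [hxl] at h2
  have h3 : κ' * (M / κ' + 1) ≤ M := (mul_le_mul_of_nonneg_left h2 hκ'0.le).trans h1
  rw [mul_add, mul_div_cancel₀ _ hκ'0.ne'] at h3
  linarith

lemma cAB_ne_zero {α β : ℝ} (hα : ∀ n : ℕ, α ≠ -((n : ℝ) + 1)) (hβ : ∀ n : ℕ, β ≠ -((n : ℝ) + 1))
    (hαβ : -1 < α + β) : cAB α β ≠ 0 := by
  refine div_ne_zero (mul_ne_zero ?_ ?_) (Real.Gamma_pos_of_pos (by linarith)).ne'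
  -- At its poles `Real.Gamma` takes the value 0, so excluding the negative integers is what keeps
  -- the constant non-zero.
  · exact Real.Gamma_ne_zero fun n hn => hα n (by linarith)
  · exact Real.Gamma_ne_zero fun n hn => hβ n (by linarith)

lemma conj_circleBump (ε : ℝ) : (fun w => starRingEnd ℂ (circleBump ε w)) = circleBump ε :=
  funext fun _ => Complex.conj_ofReal _

lemma CircleAbsCont.intervalIntegrable {f : Circle → ℂ} (hf : CircleAbsCont f) :
    IntervalIntegrable (fun θ : ℝ => f (Circle.exp θ)) volume 0 (2 * Real.pi) :=
  ContinuousOn.intervalIntegrable (AbsolutelyContinuousOnInterval.continuousOn hf)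

/-- A function whose two Wirtinger derivatives blow up like `(1 - |z|²)^(α+β)` near `1`. -/
lemma exists_le_norm_dz_dzbar {α β : ℝ} (hα : ∀ n : ℕ, α ≠ -((n : ℝ) + 1))
    (hβ : ∀ n : ℕ, β ≠ -((n : ℝ) + 1)) (hαβ : -1 < α + β) :
    ∃ f : Circle → ℂ, CircleAbsCont f ∧ (∀ p, MemLp (angularDeriv f) p angleMeasure) ∧
      ∃ κ ε : ℝ, 0 < κ ∧ 0 < ε ∧ ∀ z ∈ unitDisc, ‖z - 1‖ < ε →
        κ * (1 - ‖z‖ ^ 2) ^ (α + β) ≤ ‖dz (abPoissonIntegral α β f) z‖ ∧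
        κ * (1 - ‖z‖ ^ 2) ^ (α + β) ≤ ‖dzbar (abPoissonIntegral α β f) z‖ := by
  obtain ⟨ε₁, m₁, hε₁, hm₁, h₁⟩ := exists_re_rescaledDz_le hαβ
  obtain ⟨ε₂, m₂, hε₂, hm₂, h₂⟩ := exists_re_rescaledDz_le (add_comm α β ▸ hαβ)
  have hc := cAB_ne_zero hα hβ hαβ
  have hε := lt_min hε₁ hε₂
  obtain ⟨κ₁, hκ₁, hb₁⟩ := le_norm_dz_circleBump hε (min_le_left _ _) hm₁ h₁ hc
  obtain ⟨κ₂, hκ₂, hb₂⟩ := le_norm_dz_circleBump hε (min_le_right _ _) hm₂ h₂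
    (cAB_comm α β ▸ hc)
  have hac := circleAbsCont_circleBump (min ε₁ ε₂)
  refine ⟨circleBump (min ε₁ ε₂), hac, memLp_angularDeriv_circleBump _, min κ₁ κ₂, min ε₁ ε₂,
    lt_min hκ₁ hκ₂, hε, fun z hz hz1 => ⟨?_, ?_⟩⟩
  · refine (mul_le_mul_of_nonneg_right (min_le_left _ _) ?_).trans (hb₁ z hz hz1)
    exact Real.rpow_nonneg (one_sub_norm_sq_pos hz).le _
  -- The bump is real, so the bound for ∂_z̄ is the bound for ∂_z of the same datum with α and β
  -- exchanged. Taking the smaller of the two widths lets one bump serve both.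
  · rw [norm_dzbar_abPoissonIntegral α β hac hz, conj_circleBump]
    refine (mul_le_mul_of_nonneg_right (min_le_right _ _) ?_).trans ?_
    · exact Real.rpow_nonneg (one_sub_norm_sq_pos hz).le _
    · rw [add_comm α β]
      exact hb₂ z hz hz1

lemma meanP_le_cConst {p N : ℝ≥0∞} {w : ℂ → ℂ} {c l : ℝ} (hl : 0 < l)
    (h : ∀ r ∈ Ico (0 : ℝ) 1, meanP p r w ≤ ENNReal.ofReal (|c| * integralI l r) * N) :
    ∀ r ∈ Ico (0 : ℝ) 1, meanP p r w ≤ ENNReal.ofReal (|c| * cConst l) * N := by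
  intro r hr
  refine (h r hr).trans ?_
  gcongr
  exact integralI_le_cConst hl hr

theorem theorem2p2 (α β : ℝ) (hα : ∀ n : ℕ, α ≠ -((n : ℝ) + 1))
    (hβ : ∀ n : ℕ, β ≠ -((n : ℝ) + 1)) (hαβ : -1 < α + β) (p : ℝ≥0∞) (hp : 1 ≤ p) :
    (∀ f : Circle → ℂ, CircleAbsCont f → MemLp (angularDeriv f) p angleMeasure →
      ∀ u : ℂ → ℂ, u = abPoissonIntegral α β f →
        IsABHarmonic α β u ∧
        (∀ r ∈ Ico (0 : ℝ) 1,
          meanP p r (fun z => z * dz u z) ≤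
            ENNReal.ofReal (|cAB α β| * integralI (α + β) r) *
              (eLpNorm (angularDeriv f) p angleMeasure
                + ENNReal.ofReal |β| * circleNorm p f) ∧
          meanP p r (fun z => starRingEnd ℂ z * dzbar u z) ≤
            ENNReal.ofReal (|cAB α β| * integralI (α + β) r) *
              (eLpNorm (angularDeriv f) p angleMeasure
                + ENNReal.ofReal |α| * circleNorm p f)) ∧
        (0 < α + β →
          MemHardy p (dz u) ∧ MemHardy p (dzbar u) ∧
          hardyNorm p (fun z => z * dz u z) ≤
            ENNReal.ofReal (|cAB α β| * cConst (α + β)) *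
              (eLpNorm (angularDeriv f) p angleMeasure
                + ENNReal.ofReal |β| * circleNorm p f) ∧
          hardyNorm p (fun z => starRingEnd ℂ z * dzbar u z) ≤
            ENNReal.ofReal (|cAB α β| * cConst (α + β)) *
              (eLpNorm (angularDeriv f) p angleMeasure
                + ENNReal.ofReal |α| * circleNorm p f)) ∧
        (α + β < 0 → p < ENNReal.ofReal (-1 / (α + β)) →
          MemLpDisc p (dz u) ∧ MemLpDisc p (dzbar u))) ∧
    (α + β < 0 → ENNReal.ofReal (-1 / (α + β)) ≤ p →
      ∃ f : Circle → ℂ, CircleAbsCont f ∧ MemLp (angularDeriv f) p angleMeasure ∧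
        ∃ u : ℂ → ℂ, u = abPoissonIntegral α β f ∧ IsABHarmonic α β u ∧
          ¬ MemLpDisc p (dz u) ∧ ¬ MemLpDisc p (dzbar u) ∧
          ¬ MemHardy 1 (dz u) ∧ ¬ MemHardy 1 (dzbar u)) := by
  refine ⟨fun f hf hf' u hu => ?_, fun hneg hpl => ?_⟩
  · subst hu
    have hharm := isABHarmonic_abPoissonIntegral α β hf.intervalIntegrable
    have hM₁ : ∀ r ∈ Ico (0 : ℝ) 1, _ := fun r hr => meanP_mul_dz_le α β hf hp hr
    have hM₂ : ∀ r ∈ Ico (0 : ℝ) 1, _ := fun r hr => meanP_conj_mul_dzbar_le α β hf hp hr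
    have hN : ∀ a : ℝ, eLpNorm (angularDeriv f) p angleMeasure
        + ENNReal.ofReal |a| * circleNorm p f < ∞ := fun a =>
      ENNReal.add_lt_top.2 ⟨hf'.2, ENNReal.mul_lt_top ENNReal.ofReal_lt_top
        (circleNorm_lt_top hf p)⟩
    have hw₁ : ∀ z ∈ unitDisc, ‖z * dz (abPoissonIntegral α β f) z‖ =
        ‖z‖ * ‖dz (abPoissonIntegral α β f) z‖ := fun z _ => norm_mul _ _
    have hw₂ : ∀ z ∈ unitDisc, ‖starRingEnd ℂ z * dzbar (abPoissonIntegral α β f) z‖ =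
        ‖z‖ * ‖dzbar (abPoissonIntegral α β f) z‖ := fun z _ => by
      rw [norm_mul, RCLike.norm_conj]
    refine ⟨hharm, fun r hr => ⟨hM₁ r hr, hM₂ r hr⟩, fun hpos => ?_, fun hneg hlt => ?_⟩
    · have hC₁ := meanP_le_cConst hpos hM₁
      have hC₂ := meanP_le_cConst hpos hM₂
      exact ⟨memHardy_of_meanP_le hharm.continuousOn_dz (measurable_dz _) hw₁
          (ENNReal.mul_lt_top ENNReal.ofReal_lt_top (hN β)) hC₁,
        memHardy_of_meanP_le hharm.continuousOn_dzbar (measurable_dzbar _) hw₂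
          (ENNReal.mul_lt_top ENNReal.ofReal_lt_top (hN α)) hC₂,
        hardyNorm_le_of_meanP_le (continuousOn_id.mul hharm.continuousOn_dz) hC₁,
        hardyNorm_le_of_meanP_le (Complex.continuous_conj.continuousOn.mul
          hharm.continuousOn_dzbar) hC₂⟩
    · exact ⟨memLpDisc_of_meanP_le_integralI hharm.continuousOn_dz (measurable_dz _) hw₁
          (hN β).ne (abs_nonneg _) hp hneg hlt hM₁,
        memLpDisc_of_meanP_le_integralI hharm.continuousOn_dzbar (measurable_dzbar _) hw₂
          (hN α).ne (abs_nonneg _) hp hneg hlt hM₂⟩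
  -- The datum does not depend on p, as its angular derivative is bounded.
  · obtain ⟨f, hf, hf', κ, ε, hκ, hε, h⟩ := exists_le_norm_dz_dzbar hα hβ hαβ
    have h₁ := fun z hz hz1 => (h z hz hz1).1
    have h₂ := fun z hz hz1 => (h z hz hz1).2
    exact ⟨f, hf, hf' p, _, rfl, isABHarmonic_abPoissonIntegral α β hf.intervalIntegrable,
      not_memLpDisc_of_le (measurable_dz _) hκ hε hneg h₁ hpl,
      not_memLpDisc_of_le (measurable_dzbar _) hκ hε hneg h₂ hpl,
      not_memHardy_one_of_le hκ hε hneg h₁, not_memHardy_one_of_le hκ hε hneg h₂⟩
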